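/- Let $K$ be a field of characteristic $0$, let $S=K[x_1,\dots,x_n]$ be the polynomial ring with its standard grading ($\deg x_j=1$), and let $I\subset S$ be a graded (homogeneous) ideal. For a finitely generated graded $S$-module $M$ let $\beta_{i,j}(M)=\dim_K \operatorname{Tor}_i^S(K,M)_j$ denote its graded Betti numbers, where $K=S/(x_1,\dots,x_n)$. Let $\operatorname{Gin}(I)$ be the generic initial ideal of $I$ with respect to the (graded) reverse lexicographic order induced by $x_1>\cdots>x_n$, that is, the ideal which equals the initial ideal $\operatorname{in}(gI)$ for all $g$ in some nonempty Zariski open subset of $GL_n(K)$, where $g\in GL_n(K)$ acts on $S$ by a linear change of coordinates. If, for some integers $i>1$ and $k\ge 0$, $$\beta_{i,i+k}(S/I)=\beta_{i,i+k}\big(S/\operatorname{Gin}(I)\big),$$ then $$\beta_{q,q+k}(S/I)=\beta_{q,q+k}\big(S/\operatorname{Gin}(I)\big)\qquad\text{for all } q\ge i.$$ -/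

import Mathlib

attribute [local instance] MvPolynomial.gradedAlgebra

/-- Exponent vectors of monomials in `n` variables, carrying the graded reverse lexicographic
order. -/
def DegRevLex (n : ℕ) : Type := Fin n →₀ ℕ

namespace DegRevLex

noncomputable instance (n : ℕ) : AddCommMonoid (DegRevLex n) :=
  inferInstanceAs (AddCommMonoid (Fin n →₀ ℕ))

/-- The identity map from exponent vectors to exponent vectors with the graded reverse
lexicographic order. -/
noncomputable def of (n : ℕ) : (Fin n →₀ ℕ) ≃+ DegRevLex n := AddEquiv.refl (Fin n →₀ ℕ)

/-- The key by which exponent vectors are compared: first the total degree; then, in case of a tie,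
the last exponents in which they differ, a larger exponent making the monomial smaller. -/
noncomputable def key {n : ℕ} (a : Fin n →₀ ℕ) : ℕ ×ₗ (Colex (Fin n → ℕ))ᵒᵈ :=
  toLex (a.degree, OrderDual.toDual (toColex (a : Fin n → ℕ)))

theorem key_injective {n : ℕ} : Function.Injective (key (n := n)) := by
  intro a b h
  have h2 : (a : Fin n → ℕ) = b := congrArg (fun x => (ofLex x).2) h
  exact DFunLike.coe_injective h2

noncomputable instance (n : ℕ) : LinearOrder (DegRevLex n) :=
  LinearOrder.lift' (fun a : DegRevLex n => key ((of n).symm a))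
    (key_injective.comp (of n).symm.injective)

theorem lt_iff {n : ℕ} (a b : Fin n →₀ ℕ) :
    of n a < of n b ↔ a.degree < b.degree ∨
      (a.degree = b.degree ∧ ∃ j, (∀ l, j < l → a l = b l) ∧ b j < a j) := by
  change key a < key b ↔ _
  rw [Prod.Lex.lt_iff]
  refine or_congr Iff.rfl (and_congr Iff.rfl ?_)
  change (∃ j, (∀ l, j < l → b l = a l) ∧ b j < a j) ↔ _
  simp only [eq_comm]

theorem degree_le {n : ℕ} {a b : Fin n →₀ ℕ} (h : of n a < of n b) : a.degree ≤ b.degree := by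
  rcases (lt_iff a b).1 h with h | h
  · exact h.le
  · exact h.1.le

instance (n : ℕ) : IsOrderedAddMonoid (DegRevLex n) where
  add_le_add_left a b h c := by
    obtain ⟨a, rfl⟩ := (of n).surjective a
    obtain ⟨b, rfl⟩ := (of n).surjective b
    obtain ⟨c, rfl⟩ := (of n).surjective c
    rcases h.eq_or_lt with h | h
    · rw [h]
    · rw [← map_add, ← map_add]
      refine le_of_lt ((lt_iff _ _).2 ?_)
      rw [map_add, map_add]
      rcases (lt_iff a b).1 h with h | ⟨h, j, hj, hlt⟩
      · left; omega
      · right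
        refine ⟨by omega, j, fun l hl => ?_, ?_⟩
        · simp [hj l hl]
        · simpa using hlt

instance (n : ℕ) : WellFoundedLT (DegRevLex n) where
  wf := by
    refine ⟨fun a => ?_⟩
    obtain ⟨a, rfl⟩ := (of n).surjective a
    have hfin : {b : DegRevLex n | ((of n).symm b).degree ≤ a.degree}.Finite :=
      Finsupp.finite_of_degree_le (σ := Fin n) a.degree
    have hacc := (Set.wellFoundedOn_iff.1 (hfin.wellFoundedOn (r := (· < ·)))).apply (of n a)
    have hmain : ∀ x, Acc (fun x y : DegRevLex n => x < y ∧
        x ∈ {b : DegRevLex n | ((of n).symm b).degree ≤ a.degree} ∧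
        y ∈ {b : DegRevLex n | ((of n).symm b).degree ≤ a.degree}) x →
        ((of n).symm x).degree ≤ a.degree → Acc (· < ·) x := by
      intro x hx
      induction hx with
      | intro x _ ih =>
        intro hx
        refine Acc.intro _ fun y hy => ?_
        have hyx : ((of n).symm y).degree ≤ ((of n).symm x).degree :=
          degree_le (by simpa using hy)
        exact ih y ⟨hy, hyx.trans hx, hx⟩ (hyx.trans hx)
    exact hmain _ hacc (by simp)

end DegRevLex

/-- The graded reverse lexicographic order on the monomials in `x_0, …, x_{n-1}`, induced by
`x_0 > x_1 > ⋯ > x_{n-1}`. -/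
noncomputable def degRevLex (n : ℕ) : MonomialOrder (Fin n) where
  syn := DegRevLex n
  toSyn := DegRevLex.of n
  toSyn_monotone a b h := by
    rcases h.eq_or_lt with rfl | h'
    · exact le_rfl
    · refine le_of_lt ((DegRevLex.lt_iff a b).2 (Or.inl ?_))
      obtain ⟨c, rfl⟩ := exists_add_of_le h
      have hc : c ≠ 0 := by rintro rfl; simp at h'
      have : c.degree ≠ 0 := by rwa [ne_eq, Finsupp.degree_eq_zero_iff]
      rw [map_add]; omega

open scoped MonomialOrder in
/-- The textbook description of the graded reverse lexicographic order. -/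
theorem degRevLex_lt_iff {n : ℕ} (a b : Fin n →₀ ℕ) :
    a ≺[degRevLex n] b ↔ a.degree < b.degree ∨
      (a.degree = b.degree ∧ ∃ j, (∀ l, j < l → a l = b l) ∧ b j < a j) :=
  DegRevLex.lt_iff a b

namespace GradedPoly

open MvPolynomial TensorProduct

/-- The degree `j` part of the graded free module `⨁_b S(-deg b)` over `S = K[x_0, …, x_{n-1}]`,
whose `b`-th basis vector sits in degree `deg b`: the `b`-th coordinate has to be homogeneous of
degree `j - deg b` (and to vanish when `j < deg b`). -/
noncomputable def freePart (K : Type*) [Field K] (n : ℕ) {r : ℕ} (deg : Fin r → ℕ) (j : ℕ) :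
    Submodule K (Fin r → MvPolynomial (Fin n) K) where
  carrier := {v | ∀ b, ∀ m ∈ (v b).support, m.degree + deg b = j}
  zero_mem' := by intro b m hm; simp at hm
  add_mem' := by
    intro v w hv hw b m hm
    rcases Finset.mem_union.1 (support_add hm) with h | h
    · exact hv b m h
    · exact hw b m h
  smul_mem' := by
    intro c v hv b m hm
    exact hv b m (support_smul hm)

/-- A graded free resolution `⋯ ⟶ F_1 ⟶ F_0 ⟶ S/I ⟶ 0` of `S/I` by finitely generated graded free
modules `F_i = ⨁_b S(-deg i b)` over `S = K[x_0, …, x_{n-1}]`, all maps being homogeneous of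
degree `0`. -/
structure GradedFreeResolution {K : Type*} [Field K] {n : ℕ}
    (I : Ideal (MvPolynomial (Fin n) K)) where
  /-- the rank of `F_i` -/
  rank : ℕ → ℕ
  /-- the degrees of the basis vectors of `F_i` -/
  deg : ∀ i, Fin (rank i) → ℕ
  /-- the differential `F_{i+1} ⟶ F_i` -/
  d : ∀ i, (Fin (rank (i + 1)) → MvPolynomial (Fin n) K) →ₗ[MvPolynomial (Fin n) K]
    (Fin (rank i) → MvPolynomial (Fin n) K)
  /-- the augmentation `F_0 ⟶ S/I` -/
  aug : (Fin (rank 0) → MvPolynomial (Fin n) K) →ₗ[MvPolynomial (Fin n) K]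
    MvPolynomial (Fin n) K ⧸ I
  d_mem : ∀ i j, ∀ v ∈ freePart K n (deg (i + 1)) j, d i v ∈ freePart K n (deg i) j
  aug_mem : ∀ j, ∀ v ∈ freePart K n (deg 0) j,
    ∃ p : MvPolynomial (Fin n) K, p.IsHomogeneous j ∧ Ideal.Quotient.mk I p = aug v
  aug_surjective : Function.Surjective aug
  exact_zero : Function.Exact (d 0) aug
  exact_succ : ∀ i, Function.Exact (d (i + 1)) (d i)

section Existence

variable {K : Type*} [Field K] {n r : ℕ}

/-- The homogeneous component of degree `j` of a vector of a graded free module. -/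
noncomputable def comp (deg : Fin r → ℕ) (j : ℕ) (v : Fin r → MvPolynomial (Fin n) K) :
    Fin r → MvPolynomial (Fin n) K :=
  fun b => if deg b ≤ j then homogeneousComponent (j - deg b) (v b) else 0

theorem coeff_comp (deg : Fin r → ℕ) (j : ℕ) (v : Fin r → MvPolynomial (Fin n) K) (b : Fin r)
    (m : Fin n →₀ ℕ) :
    coeff m (comp deg j v b) = if m.degree + deg b = j then coeff m (v b) else 0 := by
  unfold comp
  split_ifs with h1 h2 h2
  · rw [coeff_homogeneousComponent, if_pos (by omega)]
  · rw [coeff_homogeneousComponent, if_neg (by omega)]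
  · omega
  · simp

theorem mem_freePart_iff (deg : Fin r → ℕ) (j : ℕ) (v : Fin r → MvPolynomial (Fin n) K) :
    v ∈ freePart K n deg j ↔ ∀ b m, m.degree + deg b ≠ j → coeff m (v b) = 0 := by
  refine forall_congr' fun b => forall_congr' fun m => ?_
  rw [mem_support_iff]; tauto

theorem comp_mem (deg : Fin r → ℕ) (j : ℕ) (v : Fin r → MvPolynomial (Fin n) K) :
    comp deg j v ∈ freePart K n deg j := by
  rw [mem_freePart_iff]
  intro b m h
  rw [coeff_comp, if_neg h]

theorem comp_of_mem (deg : Fin r → ℕ) {i : ℕ} (j : ℕ) {v : Fin r → MvPolynomial (Fin n) K}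
    (hv : v ∈ freePart K n deg i) : comp deg j v = if i = j then v else 0 := by
  rw [mem_freePart_iff] at hv
  ext b m
  rw [coeff_comp]
  split_ifs with h1 h2 h2
  · rfl
  · exact hv b m (by omega)
  · exact (hv b m (by omega)).symm
  · simp

theorem comp_sum (deg : Fin r → ℕ) (j : ℕ) {ι : Type*} (s : Finset ι)
    (v : ι → Fin r → MvPolynomial (Fin n) K) :
    comp deg j (∑ a ∈ s, v a) = ∑ a ∈ s, comp deg j (v a) := by
  ext b m
  simp only [Finset.sum_apply, coeff_sum, coeff_comp]
  split_ifs <;> simp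

theorem exists_sum_comp (deg : Fin r → ℕ) (v : Fin r → MvPolynomial (Fin n) K) (j : ℕ) :
    ∃ L, j < L ∧ v = ∑ l ∈ Finset.range L, comp deg l v := by
  refine ⟨(∑ b, ((v b).totalDegree + deg b)) + j + 1, by omega, ?_⟩
  ext b m
  simp only [Finset.sum_apply, coeff_sum, coeff_comp]
  rw [Finset.sum_ite_eq]
  split_ifs with h
  · rfl
  · by_contra hc
    apply h
    have h1 : m.degree ≤ (v b).totalDegree := le_totalDegree (mem_support_iff.2 hc)
    have h2 : (v b).totalDegree + deg b ≤ ∑ b, ((v b).totalDegree + deg b) :=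
      Finset.single_le_sum (f := fun b => (v b).totalDegree + deg b)
        (fun _ _ => Nat.zero_le _) (Finset.mem_univ b)
    rw [Finset.mem_range]; omega

/-- A graded submodule of a graded free module: it contains the components of its elements. -/
def IsGradedSubmodule (deg : Fin r → ℕ)
    (N : Submodule (MvPolynomial (Fin n) K) (Fin r → MvPolynomial (Fin n) K)) : Prop :=
  ∀ v ∈ N, ∀ j, comp deg j v ∈ N

theorem isGradedSubmodule_ker {r' : ℕ} (deg : Fin r → ℕ) (deg' : Fin r' → ℕ)
    (f : (Fin r' → MvPolynomial (Fin n) K) →ₗ[MvPolynomial (Fin n) K]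
      (Fin r → MvPolynomial (Fin n) K))
    (hf : ∀ j, ∀ v ∈ freePart K n deg' j, f v ∈ freePart K n deg j) :
    IsGradedSubmodule deg' (LinearMap.ker f) := by
  intro v hv j
  rw [LinearMap.mem_ker] at hv ⊢
  obtain ⟨L, hL, hs⟩ := exists_sum_comp deg' v j
  have h1 : comp deg j (f v) = f (comp deg' j v) := by
    conv_lhs => rw [hs]
    rw [map_sum, comp_sum, Finset.sum_eq_single j]
    · rw [comp_of_mem deg j (hf j _ (comp_mem _ _ _)), if_pos rfl]
    · intro l _ hl
      rw [comp_of_mem deg j (hf l _ (comp_mem _ _ _)), if_neg hl]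
    · intro h; exact absurd (Finset.mem_range.2 hL) h
  rw [← h1, hv]
  ext b m
  rw [coeff_comp]; simp

/-- A graded submodule of a finite graded free module is the image of a finite graded free module
under a homogeneous map of degree `0`. -/
theorem exists_cover (deg : Fin r → ℕ)
    (N : Submodule (MvPolynomial (Fin n) K) (Fin r → MvPolynomial (Fin n) K))
    (hN : IsGradedSubmodule deg N) :
    ∃ (r' : ℕ) (deg' : Fin r' → ℕ)
      (f : (Fin r' → MvPolynomial (Fin n) K) →ₗ[MvPolynomial (Fin n) K]
        (Fin r → MvPolynomial (Fin n) K)),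
      (∀ j, ∀ v ∈ freePart K n deg' j, f v ∈ freePart K n deg j) ∧ LinearMap.range f = N := by
  obtain ⟨T, hT⟩ := (IsNoetherian.noetherian N : N.FG)
  have hTN : ∀ t ∈ T, t ∈ N := fun t ht => hT ▸ Submodule.subset_span ht
  choose L _ hLs using fun v => exists_sum_comp (K := K) (n := n) deg v 0
  let ι := Σ t : T, Fin (L t.1)
  let e : Fin (Fintype.card ι) ≃ ι := (Fintype.equivFin ι).symm
  let w : Fin (Fintype.card ι) → (Fin r → MvPolynomial (Fin n) K) :=
    fun a => comp deg (e a).2 (e a).1.1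
  refine ⟨Fintype.card ι, fun a => (e a).2, Fintype.linearCombination _ w, ?_, ?_⟩
  · intro j v hv
    rw [Fintype.linearCombination_apply]
    refine Submodule.sum_mem _ fun a _ => ?_
    intro b m hm
    have hm' : m ∈ (v a * w a b).support := hm
    have hm2 := support_mul (v a) (w a b) hm'
    obtain ⟨x, hx, y, hy, rfl⟩ := Finset.mem_add.1 hm2
    have h1 := hv a x hx
    have h2 := comp_mem deg (e a).2 (e a).1.1 b y hy
    rw [map_add]
    simp only at h1
    omega
  · rw [Fintype.range_linearCombination]
    apply le_antisymm
    · rw [Submodule.span_le]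
      rintro _ ⟨a, rfl⟩
      exact hN _ (hTN _ (e a).1.2) _
    · rw [← hT, Submodule.span_le]
      intro t ht
      change t ∈ Submodule.span _ _
      rw [hLs t]
      refine Submodule.sum_mem _ fun l hl => Submodule.subset_span ?_
      refine ⟨e.symm ⟨⟨t, ht⟩, ⟨l, Finset.mem_range.1 hl⟩⟩, ?_⟩
      simp only [w]
      rw [Equiv.apply_symm_apply]

/-- Every quotient of a polynomial ring by a graded ideal has a graded free resolution. -/
theorem nonempty_gradedFreeResolution (I : Ideal (MvPolynomial (Fin n) K))
    (hI : I.IsHomogeneous (homogeneousSubmodule (Fin n) K)) :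
    Nonempty (GradedFreeResolution I) := by
  classical
  let St := Σ (r : ℕ) (deg : Fin r → ℕ),
    {N : Submodule (MvPolynomial (Fin n) K) (Fin r → MvPolynomial (Fin n) K) //
      IsGradedSubmodule deg N}
  choose cr cd cf chom crange using
    fun s : St => exists_cover (K := K) (n := n) s.2.1 s.2.2.1 s.2.2.2
  let next : St → St := fun s =>
    ⟨cr s, cd s, LinearMap.ker (cf s), isGradedSubmodule_ker _ _ (cf s) (chom s)⟩
  let aug : (Fin 1 → MvPolynomial (Fin n) K) →ₗ[MvPolynomial (Fin n) K]
      MvPolynomial (Fin n) K ⧸ I := I.mkQ ∘ₗ LinearMap.proj 0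
  have haug : IsGradedSubmodule (fun _ : Fin 1 => 0) (LinearMap.ker aug) := by
    intro v hv j
    have hv' : v 0 ∈ I := (Submodule.Quotient.mk_eq_zero I).1 hv
    refine (Submodule.Quotient.mk_eq_zero I).2 ?_
    have := homogeneousComponent_mem_of_mem hI hv' j
    simpa [comp] using this
  let s0 : St := ⟨1, fun _ => 0, LinearMap.ker aug, haug⟩
  let st : ℕ → St := fun i => Nat.rec s0 (fun _ s => next s) i
  have hst : ∀ i, st (i + 1) = next (st i) := fun _ => rfl
  refine ⟨{
    rank := fun i => (st i).1
    deg := fun i => (st i).2.1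
    d := fun i => cf (st i)
    aug := aug
    d_mem := fun i j v hv => chom (st i) j v hv
    aug_mem := fun j v hv => ⟨v 0, ?_, rfl⟩
    aug_surjective := ?_
    exact_zero := ?_
    exact_succ := ?_ }⟩
  · intro m hm
    have := hv 0 m (mem_support_iff.2 hm)
    rw [← this, Finsupp.degree_eq_weight_one]
    simp [st, s0]; rfl
  · intro x
    obtain ⟨p, rfl⟩ := I.mkQ_surjective x
    exact ⟨fun _ => p, rfl⟩
  · exact LinearMap.exact_iff.2 (crange s0).symm
  · intro i
    exact LinearMap.exact_iff.2 (crange (next (st i))).symm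

end Existence

namespace GradedFreeResolution

variable {K : Type*} [Field K] {n : ℕ} {I : Ideal (MvPolynomial (Fin n) K)}

/-- The module `K ⊗_S F_i`, where `K = S/(x_0, …, x_{n-1})`. -/
abbrev Fiber (F : GradedFreeResolution I) (i : ℕ) : Type _ :=
  (MvPolynomial (Fin n) K ⧸ idealOfVars (Fin n) K) ⊗[MvPolynomial (Fin n) K]
    (Fin (F.rank i) → MvPolynomial (Fin n) K)

/-- The degree `j` part of `K ⊗_S F_i`, where `K` sits in degree `0`. -/
noncomputable def fiberPart (F : GradedFreeResolution I) (i j : ℕ) : Submodule K (F.Fiber i) :=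
  (freePart K n (F.deg i) j).map ((TensorProduct.mk (MvPolynomial (Fin n) K)
    (MvPolynomial (Fin n) K ⧸ idealOfVars (Fin n) K)
    (Fin (F.rank i) → MvPolynomial (Fin n) K) 1).restrictScalars K)

/-- The differential `K ⊗_S F_{i+1} ⟶ K ⊗_S F_i`. -/
noncomputable def fiberD (F : GradedFreeResolution I) (i : ℕ) : F.Fiber (i + 1) →ₗ[K] F.Fiber i :=
  ((F.d i).lTensor (MvPolynomial (Fin n) K ⧸ idealOfVars (Fin n) K)).restrictScalars K

/-- The cycles of degree `j` in `K ⊗_S F_i`. -/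
noncomputable def cycles (F : GradedFreeResolution I) : ∀ i : ℕ, ℕ → Submodule K (F.Fiber i)
  | 0, j => F.fiberPart 0 j
  | i + 1, j => F.fiberPart (i + 1) j ⊓ LinearMap.ker (F.fiberD i)

/-- The boundaries of degree `j` in `K ⊗_S F_i`. -/
noncomputable def boundaries (F : GradedFreeResolution I) (i j : ℕ) : Submodule K (F.Fiber i) :=
  (F.fiberPart (i + 1) j).map (F.fiberD i)

/-- The degree `j` part of `Tor_i^S(K, S/I)`, computed by the resolution `F`: the homology of
`K ⊗_S F` at the `i`-th place in degree `j`, that is, the cycles modulo the boundaries. -/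
noncomputable def tor (F : GradedFreeResolution I) (i j : ℕ) :
    Submodule K (F.Fiber i ⧸ F.boundaries i j) :=
  (F.cycles i j).map (F.boundaries i j).mkQ

end GradedFreeResolution

open Classical in
/-- The graded Betti number `β_{i,j}(S/I) = dim_K Tor_i^S(K, S/I)_j` of `S/I`, for a graded ideal
`I`; the dimension does not depend on the resolution. (The value `0` is used for ideals that are
not graded.) -/
noncomputable def bettiNumber {K : Type*} [Field K] {n : ℕ} (I : Ideal (MvPolynomial (Fin n) K))
    (i j : ℕ) : ℕ :=
  if hI : I.IsHomogeneous (homogeneousSubmodule (Fin n) K) then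
    Module.finrank K ((nonempty_gradedFreeResolution I hI).some.tor i j)
  else 0

/-- The initial ideal `in(I)` with respect to the graded reverse lexicographic order induced by
`x_0 > x_1 > ⋯ > x_{n-1}`. -/
noncomputable def initialIdeal {K : Type*} [Field K] {n : ℕ} (I : Ideal (MvPolynomial (Fin n) K)) :
    Ideal (MvPolynomial (Fin n) K) :=
  Ideal.span ((degRevLex n).leadingTerm '' (I : Set (MvPolynomial (Fin n) K)))

/-- The linear change of coordinates `x_j ↦ ∑_i g_{ij} x_i` given by `g ∈ GL_n(K)`. -/
noncomputable def linearChange {K : Type*} [Field K] {n : ℕ}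
    (g : Matrix.GeneralLinearGroup (Fin n) K) :
    MvPolynomial (Fin n) K →ₐ[K] MvPolynomial (Fin n) K :=
  aeval fun j => ∑ i, C ((g : Matrix (Fin n) (Fin n) K) i j) * X i

/-- `J` is the generic initial ideal of `I`: there is a nonempty Zariski open set of coordinate
changes `g ∈ GL_n(K)` (the complement of the zero locus of a nonzero polynomial `p` in the entries
of `g`) on which `in(gI) = J`. -/
def IsGenericInitialIdeal {K : Type*} [Field K] {n : ℕ} (I J : Ideal (MvPolynomial (Fin n) K)) :
    Prop :=
  ∃ p : MvPolynomial (Fin n × Fin n) K, p ≠ 0 ∧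
    ∀ g : Matrix.GeneralLinearGroup (Fin n) K,
      eval (fun ij : Fin n × Fin n => (g : Matrix (Fin n) (Fin n) K) ij.1 ij.2) p ≠ 0 →
        initialIdeal (I.map (linearChange g)) = J

/-- The generic initial ideal `Gin(I)`: the ideal that equals `in(gI)` for generic `g ∈ GL_n(K)`.
(For a graded ideal over an infinite field there is exactly one such ideal.) -/
noncomputable def gin {K : Type*} [Field K] {n : ℕ} (I : Ideal (MvPolynomial (Fin n) K)) :
    Ideal (MvPolynomial (Fin n) K) :=
  Classical.epsilon (IsGenericInitialIdeal I)

end GradedPoly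

/-!
The proof compares the Koszul homology of `S / I` on generic linear forms `y_1, …, y_n` with the
Koszul homology of `S / Gin(I)` on the variables. Both compute the Betti numbers in homological
degrees at least two: the Koszul complex of the linear forms on the polynomial ring is acyclic, by
Euler's formula, and so dimensions can be shifted along a resolution
(`GradedPoly.bettiNumber_eq_hdim`).

For a set `Z` of forms, adding a form `y_j` to `Z` changes the dimension of the Koszul homology
`H_i(Z)` through the long exact sequence, in which only the ranks of the maps `y_j` on `H_i(Z)`
and on `H_{i-1}(Z)` enter (`Koszul.hdim_insert_succ`). For `S / Gin(I)` and final segments of the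
variables, adding the next variable, these ranks are zero in positive homological degrees, because
`Gin(I)` is strongly stable (`Koszul.IsStable.hrank_eq_zero`). In homological degree zero the two
sides have the same Hilbert functions: in the reverse lexicographic order the initial ideal of
`J + (x_{n-p+1}, …, x_n)` is `in(J) + (x_{n-p+1}, …, x_n)`, and the forms can be chosen such that
all their orderings are generic (`GradedPoly.exists_hdim_zero_eq`). Therefore
`β_{i,i+k}(S/Gin(I)) - β_{i,i+k}(S/I)` is, for `i ≥ 2`, a sum of ranks of multiplication maps, in
which the rank of each `y_j` on `H_i(Z)` with coefficients in degree `k - 1` and on `H_{i-1}(Z)`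
with coefficients in degree `k` occurs. If the difference is zero, all these maps are zero. It is
a formal property of Koszul complexes that multiplication maps which vanish on all `H_i(Z)` in a
given degree of the coefficients also vanish on all `H_{i+1}(Z)` in that degree
(`Koszul.rigidity`), so all ranks that contribute for larger `i` vanish as well
(`Koszul.hdim_eq_of_hdim_eq`).

Two classical facts on generic initial ideals are needed, and both rest on maximising, in each
degree and for each monomial `w`, the number of leading monomials of `g I` that are at least `w`.
The maximum is attained where a certain minor does not vanish, which makes the initial ideal
constant on an open set (`GradedPoly.exists_isGenericInitialIdeal`). If it were not strongly
stable, then a first order expansion of the change of coordinates `x_l ↦ x_l + t x_j` would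
produce a larger number of leading monomials (`GradedPoly.IsMaximalAt.exchange_mem`).
-/

/-! ### The Koszul complex of a family of commuting operators -/

namespace Koszul

section Operators

variable {ι K M M' : Type*} [LinearOrder ι] [Field K] [AddCommGroup M] [Module K M]
  [AddCommGroup M'] [Module K M']

/-- The sign `(-1) ^ #{l ∈ σ | l < j}` that moves `e_j` to its place in the wedge product `e_σ`. -/
def sgn (K : Type*) [Field K] (j : ι) (σ : Finset ι) : K := (-1) ^ (σ.filter (· < j)).card

theorem sgn_mul_self (j : ι) (σ : Finset ι) : sgn K j σ * sgn K j σ = 1 := by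
  rw [sgn, ← mul_pow]; simp

theorem sgn_insert {j l : ι} {σ : Finset ι} (h : j ∉ σ) :
    sgn K l (insert j σ) = if j < l then -sgn K l σ else sgn K l σ := by
  unfold sgn
  rw [Finset.filter_insert]
  split_ifs with h1
  · rw [Finset.card_insert_of_notMem (by simp [h]), pow_succ]; ring
  · rfl

theorem sgn_erase_self (j : ι) (σ : Finset ι) : sgn K j (σ.erase j) = sgn K j σ := by
  unfold sgn
  congr 2
  ext l
  simp only [Finset.mem_filter, Finset.mem_erase]
  exact ⟨fun h => ⟨h.1.2, h.2⟩, fun h => ⟨⟨h.2.ne, h.1⟩, h.2⟩⟩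

/-- Contraction with the dual of `e_j`. A chain `∑_σ z_σ e_σ` of the Koszul complex, with
coefficients `z_σ` in `M`, is encoded as the function `σ ↦ z_σ`. -/
def contr (j : ι) : (Finset ι → M) →ₗ[K] (Finset ι → M) where
  toFun z σ := if j ∈ σ then 0 else sgn K j σ • z (insert j σ)
  map_add' z w := by
    ext σ; simp only [Pi.add_apply]; split_ifs <;> simp
  map_smul' c z := by
    ext σ; simp only [Pi.smul_apply, RingHom.id_apply]; split_ifs
    · simp
    · rw [smul_comm]

/-- Multiplication by `e_j` from the left. -/
def wedge (j : ι) : (Finset ι → M) →ₗ[K] (Finset ι → M) where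
  toFun z σ := if j ∈ σ then sgn K j σ • z (σ.erase j) else 0
  map_add' z w := by
    ext σ; simp only [Pi.add_apply]; split_ifs <;> simp
  map_smul' c z := by
    ext σ; simp only [Pi.smul_apply, RingHom.id_apply]; split_ifs
    · rw [smul_comm]
    · simp

theorem contr_apply (j : ι) (z : Finset ι → M) (σ : Finset ι) :
    contr (K := K) j z σ = if j ∈ σ then 0 else sgn K j σ • z (insert j σ) := rfl

theorem wedge_apply (j : ι) (z : Finset ι → M) (σ : Finset ι) :
    wedge (K := K) j z σ = if j ∈ σ then sgn K j σ • z (σ.erase j) else 0 := rfl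

theorem contr_contr_self (j : ι) (z : Finset ι → M) :
    contr (K := K) j (contr (K := K) j z) = 0 := by
  ext σ
  simp [contr_apply]

theorem contr_contr {j l : ι} (h : j ≠ l) (z : Finset ι → M) :
    contr (K := K) j (contr (K := K) l z) = -contr (K := K) l (contr (K := K) j z) := by
  ext σ
  simp only [contr_apply, Pi.neg_apply, Finset.mem_insert, h, h.symm, false_or]
  by_cases hj : j ∈ σ
  · simp [hj]
  by_cases hl : l ∈ σ
  · simp [hl]
  simp only [hj, hl, if_false, Finset.insert_comm l j σ, smul_smul, sgn_insert hj, sgn_insert hl]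
  rcases lt_or_gt_of_ne h with h1 | h1
  · simp [h1, h1.not_gt, mul_comm]
  · simp [h1, h1.not_gt, mul_comm]

theorem contr_wedge_self (j : ι) (z : Finset ι → M) :
    contr (K := K) j (wedge (K := K) j z) = z - wedge (K := K) j (contr (K := K) j z) := by
  ext σ
  simp only [contr_apply, wedge_apply, Pi.sub_apply]
  by_cases hj : j ∈ σ
  · simp [hj, smul_smul, sgn_erase_self, sgn_mul_self]
  · simp [hj, smul_smul, sgn_insert hj, sgn_mul_self]

theorem contr_wedge {j l : ι} (h : j ≠ l) (z : Finset ι → M) :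
    contr (K := K) j (wedge (K := K) l z) = -wedge (K := K) l (contr (K := K) j z) := by
  ext σ
  simp only [contr_apply, wedge_apply, Pi.neg_apply, Finset.mem_insert, Finset.mem_erase, ne_eq, h,
    h.symm, not_false_eq_true, true_and, false_or]
  by_cases hj : j ∈ σ
  · simp [hj]
  by_cases hl : l ∈ σ
  · simp only [hj, hl, if_true, if_false, Finset.erase_insert_of_ne h, smul_smul, sgn_insert hj]
    obtain ⟨τ, hlτ, rfl⟩ : ∃ τ, l ∉ τ ∧ insert l τ = σ :=
      ⟨σ.erase l, Finset.notMem_erase _ _, Finset.insert_erase hl⟩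
    rw [Finset.erase_insert hlτ, sgn_insert hlτ, sgn_insert hlτ]
    rcases lt_or_gt_of_ne h with h1 | h1
    · simp [h1, h1.not_gt, mul_comm]
    · simp [h1, h1.not_gt, mul_comm]
  · simp [hj, hl]

theorem compLeft_contr (f : M →ₗ[K] M') (j : ι) (z : Finset ι → M) :
    f.compLeft (Finset ι) (contr (K := K) j z) = contr (K := K) j (f.compLeft (Finset ι) z) := by
  ext σ
  simp only [contr_apply, LinearMap.compLeft_apply, Function.comp_apply]
  split_ifs <;> simp

theorem compLeft_wedge (f : M →ₗ[K] M') (j : ι) (z : Finset ι → M) :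
    f.compLeft (Finset ι) (wedge (K := K) j z) = wedge (K := K) j (f.compLeft (Finset ι) z) := by
  ext σ
  simp only [wedge_apply, LinearMap.compLeft_apply, Function.comp_apply]
  split_ifs <;> simp

variable [Fintype ι]

/-- The Koszul differential of a family of operators `T`. -/
def diff (T : ι → M →ₗ[K] M) : (Finset ι → M) →ₗ[K] (Finset ι → M) :=
  ∑ j, (T j).compLeft (Finset ι) ∘ₗ contr j

theorem diff_apply (T : ι → M →ₗ[K] M) (z : Finset ι → M) :
    diff T z = ∑ j, (T j).compLeft (Finset ι) (contr (K := K) j z) := by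
  simp [diff]

theorem diff_apply_apply (T : ι → M →ₗ[K] M) (z : Finset ι → M) (σ : Finset ι) :
    diff T z σ = ∑ j, T j (contr (K := K) j z σ) := by
  simp [diff_apply]

theorem contr_diff (T : ι → M →ₗ[K] M) (l : ι) (z : Finset ι → M) :
    contr (K := K) l (diff T z) = -diff T (contr (K := K) l z) := by
  rw [diff_apply, diff_apply, map_sum, ← Finset.sum_neg_distrib]
  refine Finset.sum_congr rfl fun j _ => ?_
  rw [← compLeft_contr, ← map_neg]
  congr 1
  by_cases h : l = j
  · subst h; rw [contr_contr_self, neg_zero]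
  · exact contr_contr h z

theorem diff_wedge (T : ι → M →ₗ[K] M) (l : ι) (z : Finset ι → M) :
    diff T (wedge (K := K) l z) = (T l).compLeft (Finset ι) z - wedge (K := K) l (diff T z) := by
  rw [diff_apply, diff_apply, map_sum]
  rw [← Finset.add_sum_erase _ _ (Finset.mem_univ l), ← Finset.add_sum_erase _
    (fun j => wedge (K := K) l ((T j).compLeft (Finset ι) (contr (K := K) j z)))
    (Finset.mem_univ l), contr_wedge_self, map_sub, ← compLeft_wedge]
  have h : ∀ j ∈ Finset.univ.erase l, (T j).compLeft (Finset ι)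
      (contr (K := K) j (wedge (K := K) l z)) =
      -wedge (K := K) l ((T j).compLeft (Finset ι) (contr (K := K) j z)) := by
    intro j hj
    rw [contr_wedge (Finset.ne_of_mem_erase hj), map_neg, compLeft_wedge]
  rw [Finset.sum_congr rfl h, Finset.sum_neg_distrib]
  abel

theorem compLeft_diff {T : ι → M →ₗ[K] M} {T' : ι → M' →ₗ[K] M'} {f : M →ₗ[K] M'}
    (hf : ∀ j m, f (T j m) = T' j (f m)) (z : Finset ι → M) :
    f.compLeft (Finset ι) (diff T z) = diff T' (f.compLeft (Finset ι) z) := by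
  rw [diff_apply, diff_apply, map_sum]
  refine Finset.sum_congr rfl fun j _ => ?_
  rw [← compLeft_contr]
  ext σ
  simp [hf]

theorem diff_diff [CharZero K] {T : ι → M →ₗ[K] M} (hT : ∀ j l m, T j (T l m) = T l (T j m))
    (z : Finset ι → M) : diff T (diff T z) = 0 := by
  have h1 : diff T (diff T z) = -diff T (diff T z) := by
    conv_lhs => rw [diff_apply]
    conv_rhs => rw [diff_apply T z, map_sum]
    rw [← Finset.sum_neg_distrib]
    refine Finset.sum_congr rfl fun j _ => ?_
    rw [contr_diff, map_neg, compLeft_diff (fun l m => hT j l m)]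
  have h2 : (2 : K) • diff T (diff T z) = 0 := by
    rw [two_smul]; nth_rewrite 1 [h1]; simp
  exact (smul_eq_zero.1 h2).resolve_left two_ne_zero

theorem sum_wedge_contr (z : Finset ι → M) (σ : Finset ι) :
    (∑ j, wedge (K := K) j (contr (K := K) j z)) σ = (σ.card : K) • z σ := by
  rw [Finset.sum_apply]
  have h : ∀ j, wedge (K := K) j (contr (K := K) j z) σ = if j ∈ σ then z σ else 0 := by
    intro j
    simp only [wedge_apply, contr_apply]
    split_ifs with h1 h2
    · simp at h2
    · rw [sgn_erase_self, smul_smul, sgn_mul_self, one_smul, Finset.insert_erase h1]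
    · rfl
  simp [h, Nat.cast_smul_eq_nsmul]

end Operators

section Chains

variable {ι K M : Type*} [Field K] [AddCommGroup M] [Module K M]

/-- The chains `∑_σ z_σ e_σ` with `σ ⊆ Z`, `#σ = i` and coefficients in `𝓜 e`. -/
def chains (𝓜 : ℕ → Submodule K M) (Z : Finset ι) (i e : ℕ) : Submodule K (Finset ι → M) where
  carrier := {z | ∀ σ, z σ ∈ 𝓜 e ∧ (z σ ≠ 0 → σ ⊆ Z ∧ σ.card = i)}
  zero_mem' σ := by simp
  add_mem' {z w} hz hw σ := by
    refine ⟨add_mem (hz σ).1 (hw σ).1, fun h => ?_⟩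
    by_cases h1 : z σ = 0
    · exact (hw σ).2 fun h2 => h (by simp [h1, h2])
    · exact (hz σ).2 h1
  smul_mem' c z hz σ :=
    ⟨Submodule.smul_mem _ _ (hz σ).1, fun h => (hz σ).2 fun h1 => h (by simp [h1])⟩

variable {𝓜 : ℕ → Submodule K M} {Z : Finset ι} {i e : ℕ} {z : Finset ι → M}

theorem chains_mono {Z' : Finset ι} (h : Z ⊆ Z') : chains 𝓜 Z i e ≤ chains 𝓜 Z' i e :=
  fun _ hz σ => ⟨(hz σ).1, fun h1 => ⟨((hz σ).2 h1).1.trans h, ((hz σ).2 h1).2⟩⟩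

theorem eq_zero_of_mem_chains_empty (hz : z ∈ chains 𝓜 (∅ : Finset ι) (i + 1) e) : z = 0 := by
  ext σ
  by_contra h
  obtain ⟨h1, h2⟩ := (hz σ).2 h
  rw [Finset.subset_empty.1 h1] at h2
  simp at h2

theorem chains_zero_eq (Z' : Finset ι) : chains 𝓜 Z 0 e = chains 𝓜 Z' 0 e := by
  have h : ∀ Z Z' : Finset ι, chains 𝓜 Z 0 e ≤ chains 𝓜 Z' 0 e := fun Z Z' z hz σ =>
    ⟨(hz σ).1, fun h => ⟨by rw [Finset.card_eq_zero.1 ((hz σ).2 h).2]; simp, ((hz σ).2 h).2⟩⟩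
  exact le_antisymm (h _ _) (h _ _)

theorem compLeft_mem_chains {M' : Type*} [AddCommGroup M'] [Module K M'] {𝓜' : ℕ → Submodule K M'}
    {e' : ℕ} {f : M →ₗ[K] M'} (hf : ∀ m ∈ 𝓜 e, f m ∈ 𝓜' e') (hz : z ∈ chains 𝓜 Z i e) :
    f.compLeft (Finset ι) z ∈ chains 𝓜' Z i e' :=
  fun σ => ⟨hf _ (hz σ).1, fun h => (hz σ).2 fun h1 => h (by simp [h1])⟩

theorem map_chains {M' : Type*} [AddCommGroup M'] [Module K M'] (f : M →ₗ[K] M')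
    (Z : Finset ι) (i e : ℕ) : (chains 𝓜 Z i e).map (f.compLeft (Finset ι)) =
    chains (fun e => (𝓜 e).map f) Z i e := by
  apply le_antisymm
  · rintro _ ⟨z, hz, rfl⟩
    exact compLeft_mem_chains (fun m hm => ⟨m, hm, rfl⟩) hz
  · intro z hz
    have h : ∀ σ, ∃ m ∈ 𝓜 e, f m = z σ ∧ (m ≠ 0 → z σ ≠ 0) := by
      intro σ
      by_cases h0 : z σ = 0
      · exact ⟨0, zero_mem _, by simp [h0], by simp⟩
      · obtain ⟨m, hm, hmz⟩ := (hz σ).1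
        exact ⟨m, hm, hmz, fun _ => h0⟩
    choose m hm hmz hm0 using h
    exact ⟨m, fun σ => ⟨hm σ, fun h => (hz σ).2 (hm0 σ h)⟩, funext hmz⟩

variable [LinearOrder ι]

theorem contr_mem_chains {Z' : Finset ι} {j : ι} (hz : z ∈ chains 𝓜 Z (i + 1) e)
    (hZ : ∀ l ∈ Z, l ≠ j → l ∈ Z') : contr (K := K) j z ∈ chains 𝓜 Z' i e := by
  intro σ
  rw [contr_apply]
  split_ifs with h
  · simp
  · refine ⟨Submodule.smul_mem _ _ (hz _).1, fun h1 => ?_⟩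
    have h2 := (hz (insert j σ)).2 fun h3 => h1 (by simp [h3])
    rw [Finset.card_insert_of_notMem h] at h2
    refine ⟨fun l hl => hZ l (h2.1 (Finset.mem_insert_of_mem hl)) ?_, by omega⟩
    rintro rfl; exact h hl

theorem wedge_mem_chains {j : ι} (hz : z ∈ chains 𝓜 Z i e) :
    wedge (K := K) j z ∈ chains 𝓜 (insert j Z) (i + 1) e := by
  intro σ
  rw [wedge_apply]
  split_ifs with h
  · refine ⟨Submodule.smul_mem _ _ (hz _).1, fun h1 => ?_⟩
    have h2 := (hz (σ.erase j)).2 fun h3 => h1 (by simp [h3])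
    rw [Finset.card_erase_of_mem h] at h2
    have := Finset.card_pos.2 ⟨j, h⟩
    exact ⟨Finset.subset_insert_iff.2 h2.1, by omega⟩
  · simp

theorem contr_eq_zero {j : ι} (hz : z ∈ chains 𝓜 Z i e) (hj : j ∉ Z) :
    contr (K := K) j z = 0 := by
  ext σ
  rw [contr_apply]
  split_ifs with h
  · rfl
  · by_contra h1
    exact hj (((hz (insert j σ)).2 fun h3 => h1 (by simp [h3])).1 (Finset.mem_insert_self _ _))

theorem mem_chains_of_contr_eq_zero {j : ι} (hz : z ∈ chains 𝓜 (insert j Z) i e)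
    (h : contr (K := K) j z = 0) : z ∈ chains 𝓜 Z i e := by
  intro σ
  refine ⟨(hz σ).1, fun h1 => ?_⟩
  obtain ⟨h2, h3⟩ := (hz σ).2 h1
  refine ⟨fun l hl => (Finset.mem_insert.1 (h2 hl)).resolve_left ?_, h3⟩
  rintro rfl
  have h4 := congrFun h (σ.erase l)
  rw [contr_apply, if_neg (Finset.notMem_erase _ _), Finset.insert_erase hl, Pi.zero_apply,
    smul_eq_zero] at h4
  rcases h4 with h4 | h4
  · have := sgn_mul_self (K := K) l (σ.erase l)
    rw [h4] at this; simp at this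
  · exact h1 h4

instance [Finite ι] [∀ e, Module.Finite K (𝓜 e)] : Module.Finite K (chains 𝓜 Z i e) := by
  let f : chains 𝓜 Z i e →ₗ[K] (Finset ι → 𝓜 e) :=
    { toFun := fun z σ => ⟨z.1 σ, (z.2 σ).1⟩
      map_add' := fun _ _ => rfl
      map_smul' := fun _ _ => rfl }
  refine Module.Finite.of_injective f fun z w h => ?_
  ext σ
  exact congrArg Subtype.val (congrFun h σ)

variable [Fintype ι] {T : ι → M →ₗ[K] M}

theorem diff_mem_chains (hT : ∀ j, ∀ m ∈ 𝓜 e, T j m ∈ 𝓜 (e + 1))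
    (hz : z ∈ chains 𝓜 Z (i + 1) e) : diff T z ∈ chains 𝓜 Z i (e + 1) := by
  rw [diff_apply]
  exact Submodule.sum_mem _ fun j _ =>
    compLeft_mem_chains (hT j) (contr_mem_chains hz fun l hl _ => hl)

theorem diff_eq_zero_of_mem_chains_zero (hz : z ∈ chains 𝓜 Z 0 e) : diff T z = 0 := by
  rw [diff_apply]
  refine Finset.sum_eq_zero fun j _ => ?_
  have : contr (K := K) j z = 0 := by
    ext σ
    rw [contr_apply]
    split_ifs with h
    · rfl
    · by_contra h1
      have := ((hz (insert j σ)).2 fun h3 => h1 (by simp [h3])).2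
      simp at this
  rw [this, map_zero]

/-- The cycles among the chains with coefficients in `𝓜 e`. -/
def cycles (T : ι → M →ₗ[K] M) (𝓜 : ℕ → Submodule K M) (Z : Finset ι) (i e : ℕ) :
    Submodule K (Finset ι → M) :=
  chains 𝓜 Z i e ⊓ LinearMap.ker (diff T)

/-- The boundaries of the chains with coefficients in `𝓜 e`; they have coefficients in
`𝓜 (e + 1)`. -/
def boundaries (T : ι → M →ₗ[K] M) (𝓜 : ℕ → Submodule K M) (Z : Finset ι) (i e : ℕ) :
    Submodule K (Finset ι → M) :=
  (chains 𝓜 Z (i + 1) e).map (diff T)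

theorem mem_cycles : z ∈ cycles T 𝓜 Z i e ↔ z ∈ chains 𝓜 Z i e ∧ diff T z = 0 := Iff.rfl

/-- The dimension of the `i`-th Koszul homology on the variables in `Z`, with coefficients in
`𝓜 (e + 1)`. The shift by one makes room for `𝓜 0 = ⊥`, so that the boundaries into the
coefficients of smallest degree vanish. -/
noncomputable def hdim (T : ι → M →ₗ[K] M) (𝓜 : ℕ → Submodule K M) (Z : Finset ι) (i e : ℕ) : ℤ :=
  Module.finrank K (cycles T 𝓜 Z i (e + 1)) - Module.finrank K (boundaries T 𝓜 Z i e)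

/-- The rank of the operator `T j` on the `i`-th Koszul homology on the variables in `Z`, from
coefficients in `𝓜 e` to coefficients in `𝓜 (e + 1)`. -/
noncomputable def hrank (T : ι → M →ₗ[K] M) (𝓜 : ℕ → Submodule K M) (Z : Finset ι) (j : ι)
    (i e : ℕ) : ℤ :=
  Module.finrank K
    (boundaries T 𝓜 Z i e ⊔ (cycles T 𝓜 Z i e).map ((T j).compLeft (Finset ι)) :
      Submodule K (Finset ι → M)) - Module.finrank K (boundaries T 𝓜 Z i e)

instance [∀ e, Module.Finite K (𝓜 e)] : Module.Finite K (cycles T 𝓜 Z i e) :=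
  Submodule.finiteDimensional_inf_left _ _

instance [∀ e, Module.Finite K (𝓜 e)] : Module.Finite K (boundaries T 𝓜 Z i e) :=
  inferInstanceAs (Module.Finite K ((chains 𝓜 Z (i + 1) e).map (diff T)))

theorem hrank_nonneg [∀ e, Module.Finite K (𝓜 e)] (j : ι) : 0 ≤ hrank T 𝓜 Z j i e := by
  unfold hrank
  have := Submodule.finrank_mono (R := K) (s := boundaries T 𝓜 Z i e)
    (t := boundaries T 𝓜 Z i e ⊔ (cycles T 𝓜 Z i e).map ((T j).compLeft (Finset ι))) le_sup_left
  omega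

theorem hrank_eq_zero_iff [∀ e, Module.Finite K (𝓜 e)] (j : ι) : hrank T 𝓜 Z j i e = 0 ↔
    ∀ z ∈ cycles T 𝓜 Z i e, (T j).compLeft (Finset ι) z ∈ boundaries T 𝓜 Z i e := by
  have h1 : (boundaries T 𝓜 Z i e ⊔ (cycles T 𝓜 Z i e).map ((T j).compLeft (Finset ι)) =
      boundaries T 𝓜 Z i e) ↔
      ∀ z ∈ cycles T 𝓜 Z i e, (T j).compLeft (Finset ι) z ∈ boundaries T 𝓜 Z i e := by
    rw [sup_eq_left, Submodule.map_le_iff_le_comap]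
    rfl
  rw [← h1]
  unfold hrank
  constructor
  · intro h
    exact (Submodule.eq_of_le_of_finrank_eq le_sup_left (by omega)).symm
  · intro h
    rw [h, sub_self]

theorem boundaries_le_cycles [CharZero K] (hcomm : ∀ j l m, T j (T l m) = T l (T j m))
    (hT : ∀ j e, ∀ m ∈ 𝓜 e, T j m ∈ 𝓜 (e + 1)) :
    boundaries T 𝓜 Z i e ≤ cycles T 𝓜 Z i (e + 1) := by
  rintro _ ⟨w, hw, rfl⟩
  exact ⟨diff_mem_chains (fun j => hT j e) hw, diff_diff hcomm w⟩

theorem cycles_mono {Z' : Finset ι} (h : Z ⊆ Z') : cycles T 𝓜 Z i e ≤ cycles T 𝓜 Z' i e :=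
  inf_le_inf_right _ (chains_mono h)

theorem boundaries_mono {Z' : Finset ι} (h : Z ⊆ Z') :
    boundaries T 𝓜 Z i e ≤ boundaries T 𝓜 Z' i e :=
  Submodule.map_mono (chains_mono h)

theorem contr_mem_cycles {Z' : Finset ι} {j : ι} (hz : z ∈ cycles T 𝓜 Z (i + 1) e)
    (hZ : ∀ l ∈ Z, l ≠ j → l ∈ Z') : contr (K := K) j z ∈ cycles T 𝓜 Z' i e := by
  refine ⟨contr_mem_chains hz.1 hZ, ?_⟩
  have := contr_diff T j z
  rw [(mem_cycles.1 hz).2, map_zero] at this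
  exact neg_eq_zero.1 this.symm

theorem contr_mem_boundaries {Z' : Finset ι} {j : ι} (hz : z ∈ boundaries T 𝓜 Z (i + 1) e)
    (hZ : ∀ l ∈ Z, l ≠ j → l ∈ Z') : contr (K := K) j z ∈ boundaries T 𝓜 Z' i e := by
  obtain ⟨w, hw, rfl⟩ := hz
  exact ⟨-contr (K := K) j w, neg_mem (contr_mem_chains hw hZ), by rw [contr_diff, map_neg]⟩

end Chains

end Koszul

/-! ### Dimensions of subquotients -/

theorem Submodule.finrank_map_add_finrank_inf_ker {K V V' : Type*} [Field K] [AddCommGroup V]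
    [Module K V] [AddCommGroup V'] [Module K V'] (f : V →ₗ[K] V') (W : Submodule K V)
    [Module.Finite K W] :
    Module.finrank K (W.map f) + Module.finrank K (W ⊓ LinearMap.ker f : Submodule K V) =
      Module.finrank K W := by
  rw [← LinearMap.finrank_range_add_finrank_ker (f.domRestrict W), LinearMap.range_domRestrict]
  congr 1
  have h : (LinearMap.ker (f.domRestrict W)).map W.subtype = W ⊓ LinearMap.ker f := by
    rw [LinearMap.ker_domRestrict]
    exact Submodule.map_comap_subtype _ _
  rw [← h]
  exact (LinearEquiv.finrank_eq (Submodule.equivMapOfInjective _ W.injective_subtype _)).symm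

/-- A linear map `f` preserves the dimension of a subquotient `W / U` with `W ⊓ ker f ≤ U`. -/
theorem Submodule.finrank_map_sub_finrank_map {K V V' : Type*} [Field K] [AddCommGroup V]
    [Module K V] [AddCommGroup V'] [Module K V'] (f : V →ₗ[K] V') {W U : Submodule K V}
    [Module.Finite K W] (hU : U ≤ W) (h : W ⊓ LinearMap.ker f ≤ U) :
    (Module.finrank K (W.map f) - Module.finrank K (U.map f) : ℤ) =
      Module.finrank K W - Module.finrank K U := by
  have : Module.Finite K U := Submodule.finiteDimensional_of_le hU
  have h1 := W.finrank_map_add_finrank_inf_ker f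
  have h2 := U.finrank_map_add_finrank_inf_ker f
  have h3 : U ⊓ LinearMap.ker f = W ⊓ LinearMap.ker f :=
    le_antisymm (inf_le_inf_right _ hU) (le_inf h inf_le_right)
  rw [h3] at h2
  omega

/-! ### The long exact sequence for adding one variable -/

namespace Koszul

section Recursion

variable {ι K M : Type*} [LinearOrder ι] [Fintype ι] [Field K] [AddCommGroup M]
  [Module K M] {T : ι → M →ₗ[K] M} {𝓜 : ℕ → Submodule K M} {Z : Finset ι} {i e : ℕ} {j : ι}

theorem cycles_insert_inf_ker : cycles T 𝓜 (insert j Z) i e ⊓ LinearMap.ker (contr (K := K) j) ≤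
    cycles T 𝓜 Z i e :=
  fun _ hz => ⟨mem_chains_of_contr_eq_zero hz.1.1 hz.2, hz.1.2⟩

theorem cycles_insert_inf_ker_eq (hj : j ∉ Z) :
    cycles T 𝓜 (insert j Z) i e ⊓ LinearMap.ker (contr (K := K) j) = cycles T 𝓜 Z i e :=
  le_antisymm cycles_insert_inf_ker fun _ hz =>
    ⟨cycles_mono (Finset.subset_insert _ _) hz, contr_eq_zero hz.1 hj⟩

/-- The contraction with `e_j` maps the cycles on `Z ∪ {j}` onto the cycles on `Z` that `T j` sends
to boundaries. -/
theorem map_contr_cycles (hj : j ∉ Z) :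
    (cycles T 𝓜 (insert j Z) (i + 1) e).map (contr (K := K) j) =
      cycles T 𝓜 Z i e ⊓ (boundaries T 𝓜 Z i e).comap ((T j).compLeft (Finset ι)) := by
  apply le_antisymm
  · rintro _ ⟨z, hz, rfl⟩
    have hZ : ∀ l ∈ insert j Z, l ≠ j → l ∈ Z :=
      fun l hl h => (Finset.mem_insert.1 hl).resolve_left h
    refine ⟨contr_mem_cycles hz hZ, ?_⟩
    have h1 := diff_wedge T j (contr (K := K) j z)
    have h2 : diff T (contr (K := K) j z) = 0 := (contr_mem_cycles hz hZ).2
    rw [h2, map_zero, sub_zero] at h1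
    refine ⟨-(z - wedge (K := K) j (contr (K := K) j z)), neg_mem ?_, ?_⟩
    · refine mem_chains_of_contr_eq_zero (j := j) (sub_mem hz.1 ?_) ?_
      · exact wedge_mem_chains (contr_mem_chains hz.1 hZ)
      · rw [map_sub, contr_wedge_self, contr_contr_self]; simp
    · rw [map_neg, map_sub, h1, (mem_cycles.1 hz).2, zero_sub, neg_neg]
  · rintro b ⟨hb, a, ha, hab⟩
    have hb0 : contr (K := K) j b = 0 := contr_eq_zero hb.1 hj
    have ha0 : contr (K := K) j a = 0 := contr_eq_zero ha hj
    refine ⟨wedge (K := K) j b - a, ⟨sub_mem (wedge_mem_chains hb.1)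
      (chains_mono (Finset.subset_insert _ _) ha), ?_⟩, ?_⟩
    · rw [SetLike.mem_coe, LinearMap.mem_ker, map_sub, diff_wedge, (mem_cycles.1 hb).2, hab]; simp
    · rw [map_sub, contr_wedge_self, hb0, ha0]; simp

theorem boundaries_insert_inf_ker (hj : j ∉ Z) :
    boundaries T 𝓜 (insert j Z) i e ⊓ LinearMap.ker (contr (K := K) j) =
      boundaries T 𝓜 Z i e ⊔ (cycles T 𝓜 Z i e).map ((T j).compLeft (Finset ι)) := by
  apply le_antisymm
  · rintro _ ⟨⟨w, hw, rfl⟩, h⟩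
    rw [SetLike.mem_coe, LinearMap.mem_ker, contr_diff, neg_eq_zero] at h
    have hc : contr (K := K) j w ∈ cycles T 𝓜 Z i e :=
      ⟨contr_mem_chains hw fun l hl h => (Finset.mem_insert.1 hl).resolve_left h, h⟩
    have h1 : w - wedge (K := K) j (contr (K := K) j w) ∈ chains 𝓜 Z (i + 1) e := by
      refine mem_chains_of_contr_eq_zero (j := j) (sub_mem hw (wedge_mem_chains hc.1)) ?_
      rw [map_sub, contr_wedge_self, contr_contr_self]; simp
    refine Submodule.mem_sup.2 ⟨_, ⟨_, h1, rfl⟩, _, ⟨_, hc, rfl⟩, ?_⟩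
    rw [map_sub, diff_wedge, h]; simp
  · refine sup_le ?_ ?_
    · intro z hz
      refine ⟨boundaries_mono (Finset.subset_insert _ _) hz, ?_⟩
      obtain ⟨w, hw, rfl⟩ := hz
      rw [SetLike.mem_coe, LinearMap.mem_ker, contr_diff, contr_eq_zero hw hj]; simp
    · rintro _ ⟨z, hz, rfl⟩
      refine ⟨⟨wedge (K := K) j z, wedge_mem_chains hz.1, ?_⟩, ?_⟩
      · rw [diff_wedge, (mem_cycles.1 hz).2]; simp
      · rw [SetLike.mem_coe, LinearMap.mem_ker, ← compLeft_contr, contr_eq_zero hz.1 hj, map_zero]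

theorem map_contr_boundaries (hj : j ∉ Z) :
    (boundaries T 𝓜 (insert j Z) (i + 1) e).map (contr (K := K) j) = boundaries T 𝓜 Z i e := by
  apply le_antisymm
  · rintro _ ⟨z, hz, rfl⟩
    exact contr_mem_boundaries hz fun l hl h => (Finset.mem_insert.1 hl).resolve_left h
  · rintro _ ⟨w, hw, rfl⟩
    refine ⟨diff T (-wedge (K := K) j w), ⟨_, neg_mem (wedge_mem_chains hw), rfl⟩, ?_⟩
    rw [contr_diff, map_neg, map_neg, neg_neg, contr_wedge_self, contr_eq_zero hw hj]; simp

theorem hdim_insert_zero (hj : j ∉ Z) : hdim T 𝓜 (insert j Z) 0 e =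
    hdim T 𝓜 Z 0 e - hrank T 𝓜 Z j 0 e := by
  have h1 : cycles T 𝓜 (insert j Z) 0 (e + 1) = cycles T 𝓜 Z 0 (e + 1) := by
    rw [cycles, cycles, chains_zero_eq Z]
  have h2 : boundaries T 𝓜 (insert j Z) 0 e =
      boundaries T 𝓜 Z 0 e ⊔ (cycles T 𝓜 Z 0 e).map ((T j).compLeft (Finset ι)) := by
    rw [← boundaries_insert_inf_ker hj, eq_comm, inf_eq_left]
    rintro _ ⟨w, hw, rfl⟩
    rw [LinearMap.mem_ker, contr_diff, neg_eq_zero]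
    exact diff_eq_zero_of_mem_chains_zero (contr_mem_chains hw fun l hl _ => hl)
  unfold hdim hrank
  rw [h1, h2]
  omega

theorem hdim_empty_succ : hdim T 𝓜 ∅ (i + 1) e = 0 := by
  have h1 : ∀ i e, chains 𝓜 (∅ : Finset ι) (i + 1) e = ⊥ := fun i e =>
    (Submodule.eq_bot_iff _).2 fun z hz => eq_zero_of_mem_chains_empty hz
  rw [hdim, cycles, boundaries, h1, h1, bot_inf_eq, Submodule.map_bot, sub_self]

variable [∀ e, Module.Finite K (𝓜 e)]

theorem finrank_cycles_inf_comap :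
    (Module.finrank K (cycles T 𝓜 Z i e ⊓ (boundaries T 𝓜 Z i e).comap
      ((T j).compLeft (Finset ι)) : Submodule K (Finset ι → M)) : ℤ) =
      Module.finrank K (cycles T 𝓜 Z i e) - hrank T 𝓜 Z j i e := by
  set B := boundaries T 𝓜 Z i e with hB
  set C := cycles T 𝓜 Z i e with hC
  set t := (T j).compLeft (Finset ι)
  have h1 := C.finrank_map_add_finrank_inf_ker (B.mkQ ∘ₗ t)
  have h2 := (B ⊔ C.map t).finrank_map_add_finrank_inf_ker B.mkQ
  rw [LinearMap.ker_comp, Submodule.ker_mkQ, Submodule.map_comp] at h1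
  rw [Submodule.ker_mkQ, inf_of_le_right le_sup_left, Submodule.map_sup, B.mkQ_map_self,
    bot_sup_eq] at h2
  have h3 : hrank T 𝓜 Z j i e =
    Module.finrank K (B ⊔ C.map t : Submodule K (Finset ι → M)) - Module.finrank K B := rfl
  omega

/-- The long exact sequence of multiplication by `T j` on the Koszul homology, in terms of
dimensions. -/
theorem hdim_insert_succ (hj : j ∉ Z) : hdim T 𝓜 (insert j Z) (i + 1) e =
    hdim T 𝓜 Z (i + 1) e - hrank T 𝓜 Z j (i + 1) e +
      (hdim T 𝓜 Z i e - hrank T 𝓜 Z j i (e + 1)) := by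
  have h1 := (cycles T 𝓜 (insert j Z) (i + 1) (e + 1)).finrank_map_add_finrank_inf_ker
    (contr (K := K) j)
  have h2 := (boundaries T 𝓜 (insert j Z) (i + 1) e).finrank_map_add_finrank_inf_ker
    (contr (K := K) j)
  rw [map_contr_cycles hj, cycles_insert_inf_ker_eq hj] at h1
  rw [map_contr_boundaries hj, boundaries_insert_inf_ker hj] at h2
  have h3 := finrank_cycles_inf_comap (T := T) (𝓜 := 𝓜) (Z := Z) (i := i) (e := e + 1) (j := j)
  have h4 : hrank T 𝓜 Z j (i + 1) e = Module.finrank K (boundaries T 𝓜 Z (i + 1) e ⊔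
      (cycles T 𝓜 Z (i + 1) e).map ((T j).compLeft (Finset ι)) : Submodule K (Finset ι → M)) -
    Module.finrank K (boundaries T 𝓜 Z (i + 1) e) := rfl
  unfold hdim
  omega

end Recursion

/-! ### Rigidity of vanishing multiplication maps -/

section Rigidity

variable {ι K M : Type*} [LinearOrder ι] [Fintype ι] [Field K] [AddCommGroup M]
  [Module K M] {T : ι → M →ₗ[K] M} {𝓜 : ℕ → Submodule K M} {i e : ℕ}

/-- If multiplication by further variables kills the homology with coefficients in `𝓜 e`, then
adding variables is injective on homology with coefficients in `𝓜 (e + 1)`. -/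
theorem mem_boundaries_of_subset
    (h : ∀ (Z : Finset ι) (j : ι), j ∉ Z → ∀ z ∈ cycles T 𝓜 Z i e,
      (T j).compLeft (Finset ι) z ∈ boundaries T 𝓜 Z i e)
    {Z Z' : Finset ι} (hZ : Z ⊆ Z') {x : Finset ι → M} (hx : x ∈ chains 𝓜 Z i (e + 1))
    (hx' : x ∈ boundaries T 𝓜 Z' i e) : x ∈ boundaries T 𝓜 Z i e := by
  induction hn : (Z' \ Z).card generalizing Z with
  | zero =>
    rwa [subset_antisymm hZ (Finset.sdiff_eq_empty_iff_subset.1 (Finset.card_eq_zero.1 hn))]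
  | succ n ih =>
    obtain ⟨l, hl⟩ := Finset.card_pos.1 (by omega : 0 < (Z' \ Z).card)
    rw [Finset.mem_sdiff] at hl
    have h1 : x ∈ boundaries T 𝓜 (insert l Z) i e := by
      refine ih (Finset.insert_subset hl.1 hZ) (chains_mono (Finset.subset_insert _ _) hx) ?_
      rw [Finset.sdiff_insert, Finset.card_erase_of_mem (Finset.mem_sdiff.2 hl), hn]; rfl
    have h2 : x ∈ boundaries T 𝓜 (insert l Z) i e ⊓ LinearMap.ker (contr (K := K) l) :=
      ⟨h1, contr_eq_zero hx hl.2⟩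
    rw [boundaries_insert_inf_ker hl.2] at h2
    have h3 : boundaries T 𝓜 Z i e ⊔ (cycles T 𝓜 Z i e).map ((T l).compLeft (Finset ι)) ≤
        boundaries T 𝓜 Z i e := by
      refine sup_le le_rfl ?_
      rintro _ ⟨z, hz, rfl⟩
      exact h Z l hl.2 z hz
    exact h3 h2

/-- If multiplication by further variables is zero on all `i`-th Koszul homology with coefficients
in `𝓜 e`, then also on the `(i + 1)`-st. For a cycle `z` on `Z`, the cycle `T j z` is shown to be
homologous to cycles on smaller and smaller subsets of `Z`, and there are none on the empty set. -/
theorem rigidity [CharZero K] (hcomm : ∀ j l m, T j (T l m) = T l (T j m))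
    (hT : ∀ j e, ∀ m ∈ 𝓜 e, T j m ∈ 𝓜 (e + 1))
    (h : ∀ (Z : Finset ι) (j : ι), j ∉ Z → ∀ z ∈ cycles T 𝓜 Z i e,
      (T j).compLeft (Finset ι) z ∈ boundaries T 𝓜 Z i e)
    (Z : Finset ι) (j : ι) (hj : j ∉ Z) (z : Finset ι → M) (hz : z ∈ cycles T 𝓜 Z (i + 1) e) :
    (T j).compLeft (Finset ι) z ∈ boundaries T 𝓜 Z (i + 1) e := by
  -- Induction on `J`: the cycle `T j z` is homologous to a cycle `b` on `Z \ J`.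
  have key : ∀ J ⊆ Z, ∃ b ∈ cycles T 𝓜 (Z \ J) (i + 1) (e + 1),
      (T j).compLeft (Finset ι) z - b ∈ boundaries T 𝓜 Z (i + 1) e := by
    intro J
    induction J using Finset.induction_on with
    | empty =>
      intro _
      refine ⟨(T j).compLeft (Finset ι) z, ⟨?_, ?_⟩, by simp⟩
      · rw [Finset.sdiff_empty]; exact compLeft_mem_chains (hT j e) hz.1
      · rw [SetLike.mem_coe, LinearMap.mem_ker, ← compLeft_diff (fun l m => hcomm j l m),
          (mem_cycles.1 hz).2, map_zero]
    | insert l J hl ih =>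
      intro hJ
      obtain ⟨b, hb, hzb⟩ := ih fun x hx => hJ (Finset.mem_insert_of_mem hx)
      have hlZ : l ∈ Z := hJ (Finset.mem_insert_self _ _)
      have hlS : l ∉ Z \ insert l J := by simp
      have hins : insert l (Z \ insert l J) = Z \ J := by
        ext x
        simp only [Finset.mem_insert, Finset.mem_sdiff]
        by_cases hx : x = l
        · subst hx; simp [hlZ, hl]
        · simp [hx]
      have hc : contr (K := K) l b ∈ cycles T 𝓜 (Z \ insert l J) i (e + 1) :=
        contr_mem_cycles hb fun x hx hxl => by
          rw [Finset.mem_sdiff] at hx ⊢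
          exact ⟨hx.1, fun hx' => hx.2 ((Finset.mem_insert.1 hx').resolve_left hxl)⟩
      have herase : ∀ x ∈ Z, x ≠ l → x ∈ Z.erase l := fun x hx hxl =>
        Finset.mem_erase.2 ⟨hxl, hx⟩
      -- The coefficient of `e_l` in `b` bounds, since that of `T j z` does by assumption; a
      -- bounding chain `w` lives on `Z \ insert l J`, and `d (e_l w)` removes `e_l` from `b`.
      have h1 : contr (K := K) l b ∈ boundaries T 𝓜 (Z.erase l) i e := by
        have h2 := contr_mem_boundaries hzb herase
        have h3 := h (Z.erase l) j (fun hx => hj (Finset.mem_of_mem_erase hx)) _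
          (contr_mem_cycles hz herase)
        rw [map_sub, ← compLeft_contr] at h2
        simpa using sub_mem h3 h2
      have h2 : contr (K := K) l b ∈ boundaries T 𝓜 (Z \ insert l J) i e := by
        refine mem_boundaries_of_subset h (fun x hx => ?_) hc.1 h1
        rw [Finset.mem_sdiff] at hx
        exact herase x hx.1 fun hxl => hx.2 (by simp [hxl])
      obtain ⟨w, hw, hwb⟩ := h2
      have hw' : diff T (wedge (K := K) l w) ∈ boundaries T 𝓜 (Z \ J) (i + 1) e :=
        ⟨_, hins ▸ wedge_mem_chains hw, rfl⟩
      refine ⟨b + diff T (wedge (K := K) l w), ?_, ?_⟩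
      · have hcyc := add_mem hb (boundaries_le_cycles hcomm hT hw')
        refine ⟨mem_chains_of_contr_eq_zero (j := l) (hins.symm ▸ hcyc.1) ?_, hcyc.2⟩
        rw [map_add, diff_wedge, map_sub, ← compLeft_contr, contr_eq_zero hw hlS, contr_wedge_self,
          hwb, contr_contr_self]
        simp
      · rw [← sub_sub]
        exact sub_mem hzb (boundaries_mono Finset.sdiff_subset hw')
  obtain ⟨b, hb, hzb⟩ := key Z subset_rfl
  rw [Finset.sdiff_self] at hb
  rwa [eq_zero_of_mem_chains_empty hb.1, sub_zero] at hzb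

end Rigidity

end Koszul

/-! ### Koszul homology in homological degree zero -/

namespace Koszul

/-- The span of the images of `N` under the operators `T l`, `l ∈ Z`. -/
def opSpan {ι K M : Type*} [Field K] [AddCommGroup M] [Module K M] (T : ι → M →ₗ[K] M)
    (Z : Finset ι) (N : Submodule K M) : Submodule K M :=
  ⨆ l ∈ Z, N.map (T l)

section DegreeZero

variable {ι K M : Type*} [Field K] [AddCommGroup M]
  [Module K M] {T : ι → M →ₗ[K] M} {𝓜 : ℕ → Submodule K M} {Z : Finset ι} {i e : ℕ}

theorem map_mem_opSpan {N : Submodule K M} {l : ι} (hl : l ∈ Z) {m : M} (hm : m ∈ N) :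
    T l m ∈ opSpan T Z N :=
  Submodule.mem_iSup_of_mem l (Submodule.mem_iSup_of_mem hl ⟨m, hm, rfl⟩)

theorem opSpan_le {N P : Submodule K M} :
    opSpan T Z N ≤ P ↔ ∀ l ∈ Z, ∀ m ∈ N, T l m ∈ P := by
  simp only [opSpan, iSup_le_iff, Submodule.map_le_iff_le_comap]
  rfl

theorem eq_of_mem_chains_zero {z w : Finset ι → M} (hz : z ∈ chains 𝓜 Z 0 e)
    (hw : w ∈ chains 𝓜 Z 0 e) (h : z ∅ = w ∅) : z = w := by
  have h1 : ∀ x ∈ chains 𝓜 Z 0 e, ∀ σ ≠ ∅, x σ = 0 := fun x hx σ hσ => by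
    by_contra h2
    exact hσ (Finset.card_eq_zero.1 ((hx σ).2 h2).2)
  ext σ
  by_cases hσ : σ = ∅
  · rw [hσ, h]
  · rw [h1 z hz σ hσ, h1 w hw σ hσ]

theorem finrank_map_proj_empty {W : Submodule K (Finset ι → M)} (hW : W ≤ chains 𝓜 Z 0 e) :
    Module.finrank K (W.map (LinearMap.proj (∅ : Finset ι) : (Finset ι → M) →ₗ[K] M)) =
      Module.finrank K W := by
  have hinj : Function.Injective
      ((LinearMap.proj (∅ : Finset ι) : (Finset ι → M) →ₗ[K] M).domRestrict W) := by
    intro z w h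
    exact Subtype.ext (eq_of_mem_chains_zero (hW z.2) (hW w.2) h)
  rw [← LinearMap.range_domRestrict]
  exact LinearMap.finrank_range_of_inj hinj

theorem single_mem_chains [DecidableEq ι] {σ : Finset ι} (hσ : σ ⊆ Z) {m : M} (hm : m ∈ 𝓜 e) :
    Pi.single σ m ∈ chains 𝓜 Z σ.card e := by
  intro τ
  by_cases h : τ = σ
  · subst h; rw [Pi.single_eq_same]; exact ⟨hm, fun _ => ⟨hσ, rfl⟩⟩
  · rw [Pi.single_eq_of_ne h]; simp

theorem map_proj_chains_zero : (chains 𝓜 Z 0 e).map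
    (LinearMap.proj (∅ : Finset ι) : (Finset ι → M) →ₗ[K] M) = 𝓜 e := by
  classical
  apply le_antisymm
  · rintro _ ⟨z, hz, rfl⟩
    exact (hz ∅).1
  · intro m hm
    exact ⟨Pi.single ∅ m, single_mem_chains (σ := ∅) (by simp) hm, by simp⟩

variable [LinearOrder ι] [Fintype ι]

theorem diff_apply_empty (w : Finset ι → M) : diff T w ∅ = ∑ j, T j (w {j}) := by
  rw [diff_apply_apply]
  refine Finset.sum_congr rfl fun j _ => ?_
  simp [contr_apply, sgn]

theorem map_proj_boundaries_zero : (boundaries T 𝓜 Z 0 e).map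
    (LinearMap.proj (∅ : Finset ι) : (Finset ι → M) →ₗ[K] M) = opSpan T Z (𝓜 e) := by
  apply le_antisymm
  · rintro _ ⟨_, ⟨w, hw, rfl⟩, rfl⟩
    rw [LinearMap.proj_apply, diff_apply_empty]
    refine Submodule.sum_mem _ fun j _ => ?_
    by_cases h : w {j} = 0
    · simp [h]
    · exact map_mem_opSpan (((hw _).2 h).1 (Finset.mem_singleton_self j)) (hw _).1
  · rw [opSpan_le]
    intro l hl m hm
    refine ⟨diff T (Pi.single {l} m), ⟨_, single_mem_chains (σ := {l}) (by simpa using hl) hm, rfl⟩,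
      ?_⟩
    rw [LinearMap.proj_apply, diff_apply_empty, Finset.sum_eq_single l]
    · simp
    · intro j _ hj; rw [Pi.single_eq_of_ne (by simpa using hj), map_zero]
    · simp

theorem cycles_zero_eq : cycles T 𝓜 Z 0 e = chains 𝓜 Z 0 e :=
  inf_eq_left.2 fun _ hz => diff_eq_zero_of_mem_chains_zero hz

theorem boundaries_zero_le (hT : ∀ j e, ∀ m ∈ 𝓜 e, T j m ∈ 𝓜 (e + 1)) :
    boundaries T 𝓜 Z 0 e ≤ chains 𝓜 Z 0 (e + 1) := by
  rintro _ ⟨w, hw, rfl⟩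
  exact diff_mem_chains (fun j => hT j e) hw

theorem mem_boundaries_zero (hT : ∀ j e, ∀ m ∈ 𝓜 e, T j m ∈ 𝓜 (e + 1)) {z : Finset ι → M}
    (hz : z ∈ chains 𝓜 Z 0 (e + 1)) :
    z ∈ boundaries T 𝓜 Z 0 e ↔ z ∅ ∈ opSpan T Z (𝓜 e) := by
  rw [← map_proj_boundaries_zero]
  refine ⟨fun h => ⟨z, h, rfl⟩, ?_⟩
  rintro ⟨w, hw, h⟩
  rwa [← eq_of_mem_chains_zero (boundaries_zero_le hT hw) hz h]

theorem hdim_zero (hT : ∀ j e, ∀ m ∈ 𝓜 e, T j m ∈ 𝓜 (e + 1)) : hdim T 𝓜 Z 0 e =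
    Module.finrank K (𝓜 (e + 1)) - Module.finrank K (opSpan T Z (𝓜 e)) := by
  rw [hdim, cycles_zero_eq, ← finrank_map_proj_empty (W := chains 𝓜 Z 0 (e + 1)) le_rfl,
    ← finrank_map_proj_empty (boundaries_zero_le hT), map_proj_chains_zero,
    map_proj_boundaries_zero]

end DegreeZero

/-! ### Stable families -/

section Stable

variable {ι K M : Type*} [LinearOrder ι] [Fintype ι] [Field K] [CharZero K] [AddCommGroup M]
  [Module K M] {T : ι → M →ₗ[K] M} {𝓜 : ℕ → Submodule K M}

/-- The condition on a family of operators that is satisfied for the variables on `S / J`, with `J`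
a strongly stable monomial ideal: the homology classes in degree zero on the variables after `a`
that are killed by `T a` lift to elements killed by all `T j`, `j ≤ a`. -/
def IsStable (T : ι → M →ₗ[K] M) (𝓜 : ℕ → Submodule K M) : Prop :=
  ∀ a e, ∀ m ∈ 𝓜 (e + 1), T a m ∈ opSpan T (Finset.univ.filter (a < ·)) (𝓜 (e + 1)) →
    ∃ m' ∈ 𝓜 (e + 1), m - m' ∈ opSpan T (Finset.univ.filter (a < ·)) (𝓜 e) ∧
      ∀ j ≤ a, T j m' = 0

/-- For a stable family, each class of positive homological degree on a final segment of the
variables is represented by a cycle whose coefficients are killed by the preceding operators. -/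
theorem IsStable.exists_boundary (hstab : IsStable T 𝓜)
    (hcomm : ∀ j l m, T j (T l m) = T l (T j m))
    (hT : ∀ j e, ∀ m ∈ 𝓜 e, T j m ∈ 𝓜 (e + 1)) (Z : Finset ι) :
    (∀ x ∈ Z, ∀ y, x ≤ y → y ∈ Z) → ∀ i e, ∀ z ∈ cycles T 𝓜 Z (i + 1) (e + 1),
      ∃ b ∈ boundaries T 𝓜 Z (i + 1) e, ∀ j, (∀ x ∈ Z, j ≤ x) →
        (T j).compLeft (Finset ι) (z - b) = 0 := by
  induction Z using Finset.induction_on_min with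
  | empty =>
    intro _ i e z hz
    refine ⟨0, zero_mem _, fun j _ => ?_⟩
    rw [eq_zero_of_mem_chains_empty hz.1]; simp
  | insert a s ha ih =>
    intro hup i e z hz
    have has : a ∉ s := fun h => lt_irrefl _ (ha a h)
    have hs : ∀ x ∈ s, ∀ y, x ≤ y → y ∈ s := fun x hx y hxy =>
      (Finset.mem_insert.1 (hup x (Finset.mem_insert_of_mem hx) y hxy)).resolve_left
        ((ha x hx).trans_le hxy).ne'
    have hsa : s = Finset.univ.filter (a < ·) := by
      ext y
      simp only [Finset.mem_filter, Finset.mem_univ, true_and]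
      exact ⟨ha y, fun h => (Finset.mem_insert.1 (hup a (Finset.mem_insert_self _ _) y
        h.le)).resolve_left h.ne'⟩
    have hins : ∀ l ∈ insert a s, l ≠ a → l ∈ s :=
      fun l hl h => (Finset.mem_insert.1 hl).resolve_left h
    set ζ := contr (K := K) a z with hζ
    have hζc : ζ ∈ cycles T 𝓜 s i (e + 1) := contr_mem_cycles hz hins
    -- The class of `ζ` has a representative killed by all `T j`, `j ≤ a`.
    have hw : ∃ w ∈ chains 𝓜 s (i + 1) e, ∀ j ≤ a,
        (T j).compLeft (Finset ι) (ζ - diff T w) = 0 := by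
      cases i with
      | succ i =>
        obtain ⟨_, ⟨w, hw, rfl⟩, h⟩ := ih hs i e ζ hζc
        exact ⟨w, hw, fun j hj => h j fun x hx => hj.trans (ha x hx).le⟩
      | zero =>
        have h1 : ζ ∈ cycles T 𝓜 s 0 (e + 1) ⊓
            (boundaries T 𝓜 s 0 (e + 1)).comap ((T a).compLeft (Finset ι)) := by
          rw [← map_contr_cycles has]
          exact ⟨z, hz, rfl⟩
        have h2 := (mem_boundaries_zero hT (compLeft_mem_chains (hT a (e + 1)) hζc.1)).1 h1.2
        rw [hsa] at h2
        obtain ⟨m', hm', hmm, hk⟩ := hstab a e (ζ ∅) (hζc.1 ∅).1 h2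
        rw [← hsa] at hmm
        have hs' : Pi.single ∅ m' ∈ chains 𝓜 s 0 (e + 1) :=
          single_mem_chains (σ := ∅) (by simp) hm'
        have h3 : ζ - Pi.single ∅ m' ∈ boundaries T 𝓜 s 0 e :=
          (mem_boundaries_zero hT (sub_mem hζc.1 hs')).2 (by simpa using hmm)
        obtain ⟨w, hw, hwe⟩ := h3
        refine ⟨w, hw, fun j hj => ?_⟩
        rw [hwe, sub_sub_cancel]
        ext σ
        by_cases hσ : σ = ∅
        · subst hσ; simp [hk j hj]
        · simp [Pi.single_eq_of_ne hσ]
    obtain ⟨w, hw, hwk⟩ := hw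
    set ζ' := ζ - diff T w with hζ'
    have hζ'c : ζ' ∈ cycles T 𝓜 s i (e + 1) :=
      sub_mem hζc (boundaries_le_cycles hcomm hT ⟨w, hw, rfl⟩)
    have hdw : diff T (wedge (K := K) a w) ∈ boundaries T 𝓜 (insert a s) (i + 1) e :=
      ⟨_, wedge_mem_chains hw, rfl⟩
    -- Up to the boundary of `e_a w`, the cycle `z` is `e_a ζ'` plus a cycle `y` on `s`.
    set y := z + diff T (wedge (K := K) a w) - wedge (K := K) a ζ' with hy
    have hyc : y ∈ cycles T 𝓜 s (i + 1) (e + 1) := by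
      refine cycles_insert_inf_ker (j := a) ⟨sub_mem (add_mem hz
        (boundaries_le_cycles hcomm hT hdw)) ⟨wedge_mem_chains hζ'c.1, ?_⟩, ?_⟩
      · rw [SetLike.mem_coe, LinearMap.mem_ker, diff_wedge, hwk a le_rfl, (mem_cycles.1 hζ'c).2,
          map_zero, sub_zero]
      · rw [SetLike.mem_coe, LinearMap.mem_ker, hy, map_sub, map_add, contr_wedge_self,
          contr_diff, contr_wedge_self, contr_eq_zero hw has, contr_eq_zero hζ'c.1 has, hζ']
        simp [hζ]
    obtain ⟨b, hb, hbk⟩ := ih hs i e y hyc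
    refine ⟨b - diff T (wedge (K := K) a w),
      sub_mem (boundaries_mono (Finset.subset_insert _ _) hb) hdw, fun j hj => ?_⟩
    have h1 : z - (b - diff T (wedge (K := K) a w)) = (y - b) + wedge (K := K) a ζ' := by
      rw [hy]; abel
    rw [h1, map_add, hbk j fun x hx => hj x (Finset.mem_insert_of_mem hx), compLeft_wedge,
      hwk j (hj a (Finset.mem_insert_self _ _)), map_zero, add_zero]

theorem IsStable.hrank_eq_zero (hstab : IsStable T 𝓜) [∀ e, Module.Finite K (𝓜 e)]
    (hcomm : ∀ j l m, T j (T l m) = T l (T j m))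
    (hT : ∀ j e, ∀ m ∈ 𝓜 e, T j m ∈ 𝓜 (e + 1)) (h0 : 𝓜 0 = ⊥) (a : ι) (i e : ℕ) :
    hrank T 𝓜 (Finset.univ.filter (a < ·)) a (i + 1) e = 0 := by
  rw [hrank_eq_zero_iff]
  intro z hz
  cases e with
  | zero =>
    have : z = 0 := by
      ext σ
      have := (hz.1 σ).1
      rwa [h0, Submodule.mem_bot] at this
    rw [this, map_zero]
    exact zero_mem _
  | succ e =>
    obtain ⟨_, ⟨w, hw, rfl⟩, h⟩ := hstab.exists_boundary hcomm hT _
      (fun x hx y hxy => by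
        simp only [Finset.mem_filter, Finset.mem_univ, true_and] at hx ⊢
        exact hx.trans_le hxy) i e z hz
    have h1 := h a fun x hx => ((Finset.mem_filter.1 hx).2).le
    rw [map_sub, sub_eq_zero] at h1
    rw [h1, compLeft_diff (fun l m => hcomm a l m)]
    exact ⟨_, compLeft_mem_chains (hT a e) hw, rfl⟩

end Stable

/-! ### Comparison with a stable family -/

section Comparison

variable {n : ℕ} {K M M' : Type*} [Field K] [CharZero K] [AddCommGroup M] [Module K M]
  [AddCommGroup M'] [Module K M'] {T : Fin n → M →ₗ[K] M} {𝓜 : ℕ → Submodule K M}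
  {T' : Fin n → M' →ₗ[K] M'} {𝓜' : ℕ → Submodule K M'}

/-- The last `p` of `n` variables. -/
def lastVars (n p : ℕ) : Finset (Fin n) := Finset.univ.filter fun l => n ≤ l + p

theorem mem_lastVars {p : ℕ} {l : Fin n} : l ∈ lastVars n p ↔ n ≤ l + p := by
  simp [lastVars]

theorem lastVars_self : lastVars n n = Finset.univ := by
  ext l; simp [mem_lastVars]

theorem lastVars_zero : lastVars n 0 = ∅ := by
  ext l; simp [mem_lastVars, l.2]

theorem lastVars_eq {p : ℕ} (hp : p < n) :
    lastVars n p = Finset.univ.filter ((⟨n - 1 - p, by omega⟩ : Fin n) < ·) := by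
  ext l
  simp only [mem_lastVars, Finset.mem_filter, Finset.mem_univ, true_and, Fin.lt_def]
  omega

theorem lastVars_succ {p : ℕ} (hp : p < n) :
    lastVars n (p + 1) = insert (⟨n - 1 - p, by omega⟩ : Fin n) (lastVars n p) := by
  ext l
  simp only [mem_lastVars, Finset.mem_insert, Fin.ext_iff]
  omega

theorem notMem_lastVars {p : ℕ} (hp : p < n) : (⟨n - 1 - p, by omega⟩ : Fin n) ∉ lastVars n p := by
  simp only [mem_lastVars]
  omega

theorem card_lastVars {p : ℕ} (hp : p ≤ n) : (lastVars n p).card = p := by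
  induction p with
  | zero => rw [lastVars_zero, Finset.card_empty]
  | succ p ih => rw [lastVars_succ hp, Finset.card_insert_of_notMem (notMem_lastVars hp),
      ih (by omega)]

variable [∀ e, Module.Finite K (𝓜 e)] [∀ e, Module.Finite K (𝓜' e)]

/-- Passing from `Z` to `Z ∪ {j}`, the defect `hdim' - hdim` between a stable family and a family
with the same homology in degree zero grows by ranks of multiplication maps. -/
theorem defect_insert (hcomm' : ∀ j l m, T' j (T' l m) = T' l (T' j m))
    (hT' : ∀ j e, ∀ m ∈ 𝓜' e, T' j m ∈ 𝓜' (e + 1)) (h0' : 𝓜' 0 = ⊥) (hstab : IsStable T' 𝓜')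
    (hzero : ∀ Z e, hdim T 𝓜 Z 0 e = hdim T' 𝓜' (lastVars n Z.card) 0 e)
    {Z : Finset (Fin n)} {j : Fin n} (hj : j ∉ Z) (i e : ℕ) :
    hdim T' 𝓜' (lastVars n (insert j Z).card) (i + 1) e - hdim T 𝓜 (insert j Z) (i + 1) e =
      hdim T' 𝓜' (lastVars n Z.card) (i + 1) e - hdim T 𝓜 Z (i + 1) e + hrank T 𝓜 Z j (i + 1) e +
      (hdim T' 𝓜' (lastVars n Z.card) i e - hdim T 𝓜 Z i e +
        if i = 0 then 0 else hrank T 𝓜 Z j i (e + 1)) := by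
  have hp : Z.card < n := by
    simpa using Finset.card_lt_univ_of_notMem hj
  have hc : (insert j Z).card = Z.card + 1 := Finset.card_insert_of_notMem hj
  have h1 := hdim_insert_succ (T := T) (𝓜 := 𝓜) (i := i) (e := e) hj
  have h2 := hdim_insert_succ (T := T') (𝓜 := 𝓜') (i := i) (e := e) (notMem_lastVars hp)
  have hr : ∀ i e, hrank T' 𝓜' (lastVars n Z.card) ⟨n - 1 - Z.card, by omega⟩ (i + 1) e = 0 := by
    intro i e
    rw [lastVars_eq hp]
    exact hstab.hrank_eq_zero hcomm' hT' h0' _ i e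
  rw [← lastVars_succ hp, ← hc, hr] at h2
  cases i with
  | succ i =>
    rw [hr] at h2
    rw [if_neg (by omega)]
    omega
  | zero =>
    have h3 := hdim_insert_zero (T := T) (𝓜 := 𝓜) (e := e + 1) hj
    have h4 := hdim_insert_zero (T := T') (𝓜 := 𝓜') (e := e + 1) (notMem_lastVars hp)
    rw [← lastVars_succ hp, ← hc] at h4
    have h5 := hzero Z (e + 1)
    have h6 := hzero (insert j Z) (e + 1)
    rw [if_pos rfl]
    omega

/-- Rigidity in comparison with a stable family: the defect in homological degree `i ≥ 2` is a sum
of ranks of multiplication maps on the homology of degrees `i` and `i - 1`; if they all vanish,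
they also vanish in the higher degrees of the same strand. -/
theorem hdim_eq_of_hdim_eq (hcomm : ∀ j l m, T j (T l m) = T l (T j m))
    (hT : ∀ j e, ∀ m ∈ 𝓜 e, T j m ∈ 𝓜 (e + 1))
    (hcomm' : ∀ j l m, T' j (T' l m) = T' l (T' j m))
    (hT' : ∀ j e, ∀ m ∈ 𝓜' e, T' j m ∈ 𝓜' (e + 1)) (h0' : 𝓜' 0 = ⊥) (hstab : IsStable T' 𝓜')
    (hzero : ∀ Z e, hdim T 𝓜 Z 0 e = hdim T' 𝓜' (lastVars n Z.card) 0 e) {i k : ℕ} (hi : 1 < i)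
    (h : hdim T 𝓜 Finset.univ i k = hdim T' 𝓜' Finset.univ i k) {q : ℕ} (hq : i ≤ q) :
    hdim T 𝓜 Finset.univ q k = hdim T' 𝓜' Finset.univ q k := by
  set δ : ℕ → Finset (Fin n) → ℕ → ℤ := fun i Z e =>
    hdim T' 𝓜' (lastVars n Z.card) i e - hdim T 𝓜 Z i e with hδ
  have hδ0 : ∀ Z e, δ 0 Z e = 0 := fun Z e => by simp only [hδ]; rw [hzero]; omega
  have hδe : ∀ i e, δ (i + 1) ∅ e = 0 := fun i e => by
    simp only [hδ]
    rw [Finset.card_empty, lastVars_zero, hdim_empty_succ, hdim_empty_succ, sub_zero]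
  have hins : ∀ Z j, j ∉ Z → ∀ i e, δ (i + 1) (insert j Z) e = δ (i + 1) Z e +
      hrank T 𝓜 Z j (i + 1) e + (δ i Z e + if i = 0 then 0 else hrank T 𝓜 Z j i (e + 1)) :=
    fun Z j hj i e => defect_insert hcomm' hT' h0' hstab hzero hj i e
  have hpos : ∀ i Z e, 0 ≤ δ i Z e := by
    intro i
    induction i with
    | zero => intro Z e; exact (hδ0 Z e).ge
    | succ i ih =>
      intro Z e
      induction Z using Finset.induction_on with
      | empty => exact (hδe i e).ge
      | insert j Z hj ihZ =>
        rw [hins Z j hj]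
        have h1 := ih Z e
        have h2 := hrank_nonneg (T := T) (𝓜 := 𝓜) (Z := Z) (i := i + 1) (e := e) j
        have h3 : 0 ≤ if i = 0 then 0 else hrank T 𝓜 Z j i (e + 1) := by
          split_ifs
          · exact le_rfl
          · exact hrank_nonneg j
        omega
  have huniv : ∀ i, δ i Finset.univ k = 0 ↔
      hdim T 𝓜 Finset.univ i k = hdim T' 𝓜' Finset.univ i k := fun i => by
    simp only [hδ]
    rw [Finset.card_univ, Fintype.card_fin, lastVars_self]
    omega
  obtain ⟨i, rfl⟩ : ∃ i', i = i' + 2 := ⟨i - 2, by omega⟩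
  have hins2 : ∀ Z j, j ∉ Z → δ (i + 2) (insert j Z) k = δ (i + 2) Z k +
      hrank T 𝓜 Z j (i + 2) k + (δ (i + 1) Z k + hrank T 𝓜 Z j (i + 1) (k + 1)) := by
    intro Z j hj
    have := hins Z j hj (i + 1) k
    rwa [if_neg (by omega)] at this
  -- The defect is monotone in `Z` and vanishes for all variables, hence for all `Z`.
  have hall : ∀ Z, δ (i + 2) Z k = 0 := by
    intro Z
    induction hm : (Finset.univ \ Z).card generalizing Z with
    | zero =>
      rw [Finset.eq_univ_iff_forall.2 fun x => Finset.sdiff_eq_empty_iff_subset.1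
        (Finset.card_eq_zero.1 hm) (Finset.mem_univ x)]
      exact (huniv _).2 h
    | succ m ih =>
      obtain ⟨l, hl⟩ := Finset.card_pos.1 (by omega : 0 < (Finset.univ \ Z).card)
      have h1 := ih (insert l Z) (by
        rw [Finset.sdiff_insert, Finset.card_erase_of_mem hl, hm]; rfl)
      rw [hins2 Z l (Finset.mem_sdiff.1 hl).2] at h1
      have h2 := hpos (i + 2) Z k
      have h3 := hpos (i + 1) Z k
      have h4 := hrank_nonneg (T := T) (𝓜 := 𝓜) (Z := Z) (i := i + 2) (e := k) l
      have h5 := hrank_nonneg (T := T) (𝓜 := 𝓜) (Z := Z) (i := i + 1) (e := k + 1) l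
      omega
  have hr : ∀ Z j, j ∉ Z → hrank T 𝓜 Z j (i + 2) k = 0 ∧ hrank T 𝓜 Z j (i + 1) (k + 1) = 0 := by
    intro Z j hj
    have h1 := hall (insert j Z)
    rw [hins2 Z j hj] at h1
    have h2 := hpos (i + 2) Z k
    have h3 := hpos (i + 1) Z k
    have h4 := hrank_nonneg (T := T) (𝓜 := 𝓜) (Z := Z) (i := i + 2) (e := k) j
    have h5 := hrank_nonneg (T := T) (𝓜 := 𝓜) (Z := Z) (i := i + 1) (e := k + 1) j
    exact ⟨by omega, by omega⟩
  -- Rigidity carries the vanishing of both families of ranks to all higher degrees.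
  have hrig : ∀ i e, (∀ Z j, j ∉ Z → hrank T 𝓜 Z j i e = 0) → ∀ m, ∀ Z j, j ∉ Z →
      hrank T 𝓜 Z j (i + m) e = 0 := by
    intro i e h0 m
    induction m with
    | zero => exact h0
    | succ m ih =>
      simp only [hrank_eq_zero_iff] at ih ⊢
      exact rigidity hcomm hT ih
  have hfin : ∀ m Z, δ (i + 2 + m) Z k = 0 := by
    intro m
    induction m with
    | zero => exact hall
    | succ m ih =>
      intro Z
      induction Z using Finset.induction_on with
      | empty => exact hδe _ _
      | insert j Z hj ihZ =>
        rw [← add_assoc] at ihZ ⊢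
        have h1 : hrank T 𝓜 Z j (i + 2 + m + 1) k = 0 :=
          hrig (i + 2) k (fun Z j hj => (hr Z j hj).1) (m + 1) Z j hj
        have h2 := hrig (i + 1) (k + 1) (fun Z j hj => (hr Z j hj).2) (m + 1) Z j hj
        rw [show i + 1 + (m + 1) = i + 2 + m by omega] at h2
        rw [hins Z j hj, if_neg (by omega), ihZ, ih, h1, h2]
        rfl
  obtain ⟨m, rfl⟩ := Nat.exists_eq_add_of_le hq
  exact (huniv _).1 (hfin m _)

end Comparison

/-! ### Dimension shifting -/

section DimensionShift

variable {ι K M M' : Type*} [LinearOrder ι] [Fintype ι] [Field K] [CharZero K] [AddCommGroup M]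
  [Module K M] [AddCommGroup M'] [Module K M'] {T : ι → M →ₗ[K] M} {T' : ι → M' →ₗ[K] M'}
  {𝓑 : ℕ → Submodule K M} {f : M →ₗ[K] M'} {Z : Finset ι}

variable [∀ e, Module.Finite K (𝓑 e)]

/-- The connecting homomorphism, in terms of dimensions, for a short exact sequence whose middle
term is acyclic. -/
theorem hdim_map_succ (hcomm : ∀ j l m, T j (T l m) = T l (T j m))
    (hT : ∀ j e, ∀ m ∈ 𝓑 e, T j m ∈ 𝓑 (e + 1)) (hf : ∀ j m, f (T j m) = T' j (f m))
    (hac : ∀ i e, cycles T 𝓑 Z (i + 1) (e + 1) ≤ boundaries T 𝓑 Z (i + 1) e) (i e : ℕ) :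
    hdim T' (fun e => (𝓑 e).map f) Z (i + 1) e =
      Module.finrank K (chains (fun e => 𝓑 e ⊓ LinearMap.ker f) Z i (e + 2) ⊓
        boundaries T 𝓑 Z i (e + 1) : Submodule K (Finset ι → M)) -
      Module.finrank K (boundaries T (fun e => 𝓑 e ⊓ LinearMap.ker f) Z i (e + 1)) := by
  set 𝓐 : ℕ → Submodule K M := fun e => 𝓑 e ⊓ LinearMap.ker f with h𝓐
  set F := f.compLeft (Finset ι)
  have hmem : ∀ i e z, z ∈ chains 𝓐 Z i e ↔ z ∈ chains 𝓑 Z i e ∧ F z = 0 := by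
    intro i e z
    constructor
    · exact fun h => ⟨fun σ => ⟨(h σ).1.1, (h σ).2⟩, funext fun σ => (h σ).1.2⟩
    · exact fun h σ => ⟨⟨(h.1 σ).1, congrFun h.2 σ⟩, (h.1 σ).2⟩
  -- Both sides are images of `W / U`, under `F` and under the differential.
  let W : Submodule K (Finset ι → M) :=
    chains 𝓑 Z (i + 1) (e + 1) ⊓ LinearMap.ker (F ∘ₗ diff T)
  let U : Submodule K (Finset ι → M) := chains 𝓐 Z (i + 1) (e + 1) ⊔ boundaries T 𝓑 Z (i + 1) e
  have hfd : Module.Finite K W := Submodule.finiteDimensional_inf_left _ _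
  have hU : U ≤ W := by
    refine sup_le (fun z hz => ⟨((hmem _ _ _).1 hz).1, ?_⟩) fun z hz => ?_
    · rw [SetLike.mem_coe, LinearMap.mem_ker, LinearMap.comp_apply, compLeft_diff hf,
        ((hmem _ _ _).1 hz).2, map_zero]
    · have := boundaries_le_cycles hcomm hT hz
      refine ⟨this.1, ?_⟩
      rw [SetLike.mem_coe, LinearMap.mem_ker, LinearMap.comp_apply, (mem_cycles.1 this).2, map_zero]
  have hWF : W.map F = cycles T' (fun e => (𝓑 e).map f) Z (i + 1) (e + 1) := by
    apply le_antisymm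
    · rintro _ ⟨z, ⟨hz, hz'⟩, rfl⟩
      refine ⟨?_, ?_⟩
      · rw [← map_chains]; exact ⟨z, hz, rfl⟩
      · rw [SetLike.mem_coe, LinearMap.mem_ker, ← compLeft_diff hf]; exact hz'
    · rintro y ⟨hy, hy'⟩
      rw [SetLike.mem_coe, ← map_chains] at hy
      obtain ⟨z, hz, rfl⟩ := hy
      refine ⟨z, ⟨hz, ?_⟩, rfl⟩
      rw [SetLike.mem_coe, LinearMap.mem_ker, LinearMap.comp_apply, compLeft_diff hf]; exact hy'
  have hUF : U.map F = boundaries T' (fun e => (𝓑 e).map f) Z (i + 1) e := by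
    have h1 : (chains 𝓐 Z (i + 1) (e + 1)).map F = ⊥ := by
      rw [Submodule.eq_bot_iff]
      rintro _ ⟨z, hz, rfl⟩
      exact ((hmem _ _ _).1 hz).2
    have h2 : F ∘ₗ diff T = diff T' ∘ₗ F := LinearMap.ext fun z => compLeft_diff hf z
    rw [Submodule.map_sup, h1, bot_sup_eq, boundaries, boundaries, ← map_chains,
      ← Submodule.map_comp, ← Submodule.map_comp, h2]
  have hWd : W.map (diff T) = chains 𝓐 Z i (e + 2) ⊓ boundaries T 𝓑 Z i (e + 1) := by
    apply le_antisymm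
    · rintro _ ⟨z, ⟨hz, hz'⟩, rfl⟩
      exact ⟨(hmem _ _ _).2 ⟨diff_mem_chains (fun j => hT j _) hz, hz'⟩, z, hz, rfl⟩
    · rintro _ ⟨hz', z, hz, rfl⟩
      exact ⟨z, ⟨hz, ((hmem _ _ _).1 hz').2⟩, rfl⟩
  have hUd : U.map (diff T) = boundaries T 𝓐 Z i (e + 1) := by
    have h1 : (boundaries T 𝓑 Z (i + 1) e).map (diff T) = ⊥ := by
      rw [Submodule.eq_bot_iff]
      rintro _ ⟨z, hz, rfl⟩
      exact (boundaries_le_cycles hcomm hT hz).2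
    rw [Submodule.map_sup, h1, sup_bot_eq]
    rfl
  have h1 := Submodule.finrank_map_sub_finrank_map F hU
    fun z hz => Submodule.mem_sup_left ((hmem _ _ _).2 ⟨hz.1.1, hz.2⟩)
  have h2 := Submodule.finrank_map_sub_finrank_map (diff T) hU
    fun z hz => Submodule.mem_sup_right (hac i e ⟨hz.1.1, hz.2⟩)
  rw [hWF, hUF] at h1
  rw [hWd, hUd] at h2
  rw [hdim, h1, h2]

/-- Dimension shifting: the connecting homomorphism is bijective. -/
theorem hdim_map_add_two (hcomm : ∀ j l m, T j (T l m) = T l (T j m))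
    (hT : ∀ j e, ∀ m ∈ 𝓑 e, T j m ∈ 𝓑 (e + 1)) (hf : ∀ j m, f (T j m) = T' j (f m))
    (hac : ∀ i e, cycles T 𝓑 Z (i + 1) (e + 1) ≤ boundaries T 𝓑 Z (i + 1) e) (i e : ℕ) :
    hdim T' (fun e => (𝓑 e).map f) Z (i + 2) e =
      hdim T (fun e => 𝓑 e ⊓ LinearMap.ker f) Z (i + 1) (e + 1) := by
  have h : chains (fun e => 𝓑 e ⊓ LinearMap.ker f) Z (i + 1) (e + 2) ⊓
      boundaries T 𝓑 Z (i + 1) (e + 1) =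
      cycles T (fun e => 𝓑 e ⊓ LinearMap.ker f) Z (i + 1) (e + 2) := by
    apply le_antisymm
    · exact fun z hz => ⟨hz.1, (boundaries_le_cycles hcomm hT hz.2).2⟩
    · exact fun z hz => ⟨hz.1, hac _ _ ⟨fun σ => ⟨(hz.1 σ).1.1, (hz.1 σ).2⟩, hz.2⟩⟩
  rw [hdim_map_succ hcomm hT hf hac, hdim, h]

/-- Dimension shifting at the end, where the middle term has homology in degree zero. -/
theorem hdim_map_one (hcomm : ∀ j l m, T j (T l m) = T l (T j m))
    (hT : ∀ j e, ∀ m ∈ 𝓑 e, T j m ∈ 𝓑 (e + 1)) (hT' : ∀ j e, ∀ m ∈ 𝓑 e ⊓ LinearMap.ker f,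
      T j m ∈ 𝓑 (e + 1) ⊓ LinearMap.ker f) (hf : ∀ j m, f (T j m) = T' j (f m))
    (hac : ∀ i e, cycles T 𝓑 Z (i + 1) (e + 1) ≤ boundaries T 𝓑 Z (i + 1) e) (e : ℕ) :
    hdim T' (fun e => (𝓑 e).map f) Z 1 e =
      Module.finrank K (𝓑 (e + 2) ⊓ LinearMap.ker f ⊓ opSpan T Z (𝓑 (e + 1)) : Submodule K M) -
      Module.finrank K (opSpan T Z (𝓑 (e + 1) ⊓ LinearMap.ker f)) := by
  set 𝓐 : ℕ → Submodule K M := fun e => 𝓑 e ⊓ LinearMap.ker f with h𝓐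
  have h : (chains 𝓐 Z 0 (e + 2) ⊓ boundaries T 𝓑 Z 0 (e + 1)).map
      (LinearMap.proj (∅ : Finset ι) : (Finset ι → M) →ₗ[K] M) =
      𝓐 (e + 2) ⊓ opSpan T Z (𝓑 (e + 1)) := by
    apply le_antisymm
    · rintro _ ⟨z, ⟨hz, hz'⟩, rfl⟩
      refine ⟨(hz ∅).1, ?_⟩
      rw [← map_proj_boundaries_zero]
      exact ⟨z, hz', rfl⟩
    · rintro m ⟨hm, hm'⟩
      rw [SetLike.mem_coe, ← map_proj_chains_zero (Z := Z) (𝓜 := 𝓐)] at hm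
      obtain ⟨z, hz, rfl⟩ := hm
      refine ⟨z, ⟨hz, ?_⟩, rfl⟩
      exact (mem_boundaries_zero hT fun σ => ⟨(hz σ).1.1, (hz σ).2⟩).2 hm'
  rw [hdim_map_succ hcomm hT hf hac,
    ← finrank_map_proj_empty (𝓜 := 𝓐) (Z := Z) (e := e + 2) inf_le_left,
    ← finrank_map_proj_empty (boundaries_zero_le (𝓜 := 𝓐) hT'), map_proj_boundaries_zero, h]

end DimensionShift

end Koszul

/-! ### The Koszul complex of a sequence of linear forms -/

namespace GradedPoly

open MvPolynomial TensorProduct Koszul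

section LinearForms

variable {K : Type*} [Field K] {n : ℕ}

/-- The homogeneous polynomials of degree `e - 1` (and `⊥` for `e = 0`). -/
noncomputable def polyGr (K : Type*) [Field K] (n : ℕ) : ℕ → Submodule K (MvPolynomial (Fin n) K)
  | 0 => ⊥
  | e + 1 => homogeneousSubmodule (Fin n) K e

/-- The part of degree `e - 1` of a graded free module (and `⊥` for `e = 0`). -/
noncomputable def freeGr (K : Type*) [Field K] (n : ℕ) {r : ℕ} (deg : Fin r → ℕ) :
    ℕ → Submodule K (Fin r → MvPolynomial (Fin n) K)
  | 0 => ⊥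
  | e + 1 => freePart K n deg e

/-- The part of degree `e - 1` of `S / I` (and `⊥` for `e = 0`). -/
noncomputable def quotGr (I : Ideal (MvPolynomial (Fin n) K)) (e : ℕ) :
    Submodule K (MvPolynomial (Fin n) K ⧸ I) :=
  (polyGr K n e).map (I.mkQ.restrictScalars K)

/-- Multiplication by the forms `ψ X_0, …, ψ X_{n-1}` on an `S`-module, for an automorphism `ψ`
of `S`. -/
noncomputable def varOp (ψ : MvPolynomial (Fin n) K ≃ₐ[K] MvPolynomial (Fin n) K) (M : Type*)
    [AddCommGroup M] [Module K M] [Module (MvPolynomial (Fin n) K) M]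
    [IsScalarTower K (MvPolynomial (Fin n) K) M] (l : Fin n) : M →ₗ[K] M :=
  Algebra.lsmul K K M (ψ (X l))

/-- An automorphism of the polynomial ring that preserves degrees, i.e. a linear change of
coordinates. -/
def IsGradedAut (ψ : MvPolynomial (Fin n) K ≃ₐ[K] MvPolynomial (Fin n) K) : Prop :=
  ∀ p d, p.IsHomogeneous d ↔ (ψ p).IsHomogeneous d

variable {ψ : MvPolynomial (Fin n) K ≃ₐ[K] MvPolynomial (Fin n) K}

theorem varOp_apply {M : Type*} [AddCommGroup M] [Module K M] [Module (MvPolynomial (Fin n) K) M]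
    [IsScalarTower K (MvPolynomial (Fin n) K) M] (l : Fin n) (m : M) :
    varOp ψ M l m = ψ (X l) • m := rfl

theorem varOp_comm {M : Type*} [AddCommGroup M] [Module K M] [Module (MvPolynomial (Fin n) K) M]
    [IsScalarTower K (MvPolynomial (Fin n) K) M] (j l : Fin n) (m : M) :
    varOp ψ M j (varOp ψ M l m) = varOp ψ M l (varOp ψ M j m) := by
  simp only [varOp_apply]
  rw [smul_comm]

theorem map_varOp {M M' : Type*} [AddCommGroup M] [Module K M] [Module (MvPolynomial (Fin n) K) M]
    [IsScalarTower K (MvPolynomial (Fin n) K) M] [AddCommGroup M'] [Module K M']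
    [Module (MvPolynomial (Fin n) K) M'] [IsScalarTower K (MvPolynomial (Fin n) K) M']
    (f : M →ₗ[MvPolynomial (Fin n) K] M') (j : Fin n) (m : M) :
    f.restrictScalars K (varOp ψ M j m) = varOp ψ M' j (f.restrictScalars K m) := by
  simp [varOp_apply]

theorem mem_polyGr_iff {e : ℕ} {p : MvPolynomial (Fin n) K} :
    p ∈ polyGr K n e ↔ ∀ m ∈ p.support, m.degree + 1 = e := by
  cases e with
  | zero =>
    rw [polyGr, Submodule.mem_bot]
    refine ⟨fun h => by simp [h], fun h => ?_⟩
    by_contra hp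
    obtain ⟨m, hm⟩ := Finset.nonempty_iff_ne_empty.2 (fun h => hp (support_eq_empty.1 h))
    exact absurd (h m hm) (by omega)
  | succ e =>
    rw [polyGr, mem_homogeneousSubmodule]
    refine ⟨fun h m hm => by rw [h.degree_eq_sum_deg_support hm]; rfl, fun h m hm => ?_⟩
    have h1 : Finsupp.weight 1 m = m.degree :=
      (DFunLike.congr_fun (Finsupp.degree_eq_weight_one (R := ℕ)) m).symm
    have h2 := h m (mem_support_iff.2 hm)
    rw [h1]
    omega

theorem mem_freeGr_iff {r : ℕ} {deg : Fin r → ℕ} {e : ℕ} {v : Fin r → MvPolynomial (Fin n) K} :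
    v ∈ freeGr K n deg e ↔ ∀ b, v b ∈ polyGr K n (e - deg b) := by
  simp only [mem_polyGr_iff]
  cases e with
  | zero =>
    rw [freeGr, Submodule.mem_bot]
    constructor
    · rintro rfl; simp
    · intro h
      ext b m
      by_contra hm
      have := h b m (mem_support_iff.2 hm)
      omega
  | succ e =>
    refine forall_congr' fun b => forall_congr' fun m => forall_congr' fun _ => ?_
    omega

instance (e : ℕ) : Module.Finite K (polyGr K n e) := by
  cases e with
  | zero => exact inferInstanceAs (Module.Finite K (⊥ : Submodule K (MvPolynomial (Fin n) K)))
  | succ e => exact Module.Finite.iff_fg.2 (homogeneousSubmodule_fg (Fin n) K e)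

instance {r : ℕ} (deg : Fin r → ℕ) (e : ℕ) : Module.Finite K (freeGr K n deg e) := by
  let f : freeGr K n deg e →ₗ[K] (∀ b, polyGr K n (e - deg b)) :=
    { toFun := fun v b => ⟨v.1 b, mem_freeGr_iff.1 v.2 b⟩
      map_add' := fun _ _ => rfl
      map_smul' := fun _ _ => rfl }
  refine Module.Finite.of_injective f fun v w h => ?_
  ext1
  funext b
  exact congrArg Subtype.val (congrFun h b)

instance (I : Ideal (MvPolynomial (Fin n) K)) (e : ℕ) : Module.Finite K (quotGr I e) :=
  inferInstanceAs (Module.Finite K ((polyGr K n e).map (I.mkQ.restrictScalars K)))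

theorem mul_mem_polyGr {e : ℕ} {p q : MvPolynomial (Fin n) K} (hp : p.IsHomogeneous 1)
    (hq : q ∈ polyGr K n e) : p * q ∈ polyGr K n (e + 1) := by
  cases e with
  | zero =>
    rw [polyGr, Submodule.mem_bot] at hq
    simp [hq]
  | succ e =>
    rw [polyGr, mem_homogeneousSubmodule] at hq ⊢
    rw [add_comm]
    exact hp.mul hq

theorem IsGradedAut.isHomogeneous_X (hψ : IsGradedAut ψ) (l : Fin n) :
    (ψ (X l)).IsHomogeneous 1 := (hψ _ _).1 (MvPolynomial.isHomogeneous_X K l)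

theorem IsGradedAut.symm (hψ : IsGradedAut ψ) : IsGradedAut ψ.symm := fun p d => by
  rw [hψ (ψ.symm p), ψ.apply_symm_apply]

theorem IsGradedAut.map_mem_polyGr (hψ : IsGradedAut ψ) {e : ℕ} {p : MvPolynomial (Fin n) K}
    (hp : p ∈ polyGr K n e) : ψ p ∈ polyGr K n e := by
  cases e with
  | zero =>
    rw [polyGr, Submodule.mem_bot] at hp ⊢
    simp [hp]
  | succ e => exact (hψ _ _).1 hp

theorem IsGradedAut.varOp_mem_polyGr (hψ : IsGradedAut ψ) (l : Fin n) (e : ℕ)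
    (p : MvPolynomial (Fin n) K) (hp : p ∈ polyGr K n e) :
    varOp ψ (MvPolynomial (Fin n) K) l p ∈ polyGr K n (e + 1) :=
  mul_mem_polyGr (hψ.isHomogeneous_X l) hp

theorem IsGradedAut.varOp_mem_freeGr (hψ : IsGradedAut ψ) {r : ℕ} {deg : Fin r → ℕ} (l : Fin n)
    (e : ℕ) (v : Fin r → MvPolynomial (Fin n) K) (hv : v ∈ freeGr K n deg e) :
    varOp ψ (Fin r → MvPolynomial (Fin n) K) l v ∈ freeGr K n deg (e + 1) := by
  rw [mem_freeGr_iff] at hv ⊢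
  intro b
  rw [varOp_apply, Pi.smul_apply]
  by_cases h : deg b ≤ e
  · rw [Nat.sub_add_comm h]
    exact hψ.varOp_mem_polyGr l _ _ (hv b)
  · have h1 := hv b
    rw [Nat.sub_eq_zero_of_le (by omega), polyGr, Submodule.mem_bot] at h1
    rw [h1, smul_zero]
    exact zero_mem _

theorem IsGradedAut.varOp_mem_quotGr (hψ : IsGradedAut ψ) {I : Ideal (MvPolynomial (Fin n) K)}
    (l : Fin n) (e : ℕ) (m : MvPolynomial (Fin n) K ⧸ I) (hm : m ∈ quotGr I e) :
    varOp ψ (MvPolynomial (Fin n) K ⧸ I) l m ∈ quotGr I (e + 1) := by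
  obtain ⟨p, hp, rfl⟩ := hm
  exact ⟨_, hψ.varOp_mem_polyGr l e p hp, map_varOp I.mkQ l p⟩

theorem pderiv_mem_polyGr {e : ℕ} {p : MvPolynomial (Fin n) K} (l : Fin n)
    (hp : p ∈ polyGr K n (e + 1)) : pderiv l p ∈ polyGr K n e := by
  rw [polyGr, mem_homogeneousSubmodule] at hp
  cases e with
  | zero =>
    rw [← totalDegree_zero_iff_isHomogeneous, totalDegree_eq_zero_iff_eq_C] at hp
    rw [hp, pderiv_C]
    exact zero_mem _
  | succ e => exact hp.pderiv

/-- Euler's formula, in the form that the partial derivatives give a contracting homotopy for the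
Koszul complex of `X_0, …, X_{n-1}` on the polynomial ring in characteristic zero. -/
theorem cycles_polyGr_le [CharZero K] (i e : ℕ) :
    cycles (varOp (AlgEquiv.refl : MvPolynomial (Fin n) K ≃ₐ[K] _) (MvPolynomial (Fin n) K))
        (polyGr K n) Finset.univ (i + 1) (e + 1) ≤
      boundaries (varOp (AlgEquiv.refl : MvPolynomial (Fin n) K ≃ₐ[K] _) (MvPolynomial (Fin n) K))
        (polyGr K n) Finset.univ (i + 1) e := by
  rintro z ⟨hz, hz'⟩
  rw [SetLike.mem_coe, LinearMap.mem_ker] at hz'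
  set T := varOp (AlgEquiv.refl : MvPolynomial (Fin n) K ≃ₐ[K] _) (MvPolynomial (Fin n) K) with hT
  let D : Fin n → (Finset (Fin n) → MvPolynomial (Fin n) K) →ₗ[K]
      (Finset (Fin n) → MvPolynomial (Fin n) K) :=
    fun l => ((pderiv l : Derivation K _ _).toLinearMap).compLeft (Finset (Fin n))
  have hD : ∀ l, diff T (D l z) = -contr (K := K) l z := by
    intro l
    have h1 : D l (diff T z) = contr (K := K) l z + diff T (D l z) := by
      ext1 σ
      simp only [D, LinearMap.compLeft_apply, Function.comp_apply, Pi.add_apply]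
      rw [diff_apply_apply, diff_apply_apply, map_sum]
      have h2 : ∀ j, pderiv l (T j (contr (K := K) j z σ)) =
          (if j = l then contr (K := K) l z σ else 0) +
            T j (contr (K := K) j (D l z) σ) := by
        intro j
        have h3 : contr (K := K) j (D l z) σ = pderiv l (contr (K := K) j z σ) := by
          rw [← compLeft_contr]; rfl
        rw [h3, hT, varOp_apply, varOp_apply, smul_eq_mul, smul_eq_mul, Derivation.leibniz]
        simp only [AlgEquiv.coe_refl, id_eq, smul_eq_mul]
        rw [pderiv_X, add_comm]
        congr 1
        by_cases h : j = l
        · subst h; simp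
        · simp [h]
      refine (Finset.sum_congr rfl fun j _ => h2 j).trans ?_
      rw [Finset.sum_add_distrib, Finset.sum_ite_eq' Finset.univ l]
      simp [D]
    rw [hz', map_zero] at h1
    exact (neg_eq_of_add_eq_zero_right h1.symm).symm
  have hsum : diff T (∑ l, wedge (K := K) l (D l z)) = ((e + (i + 1) : ℕ) : K) • z := by
    rw [map_sum]
    ext1 σ
    rw [Finset.sum_apply]
    have h1 : ∀ l, diff T (wedge (K := K) l (D l z)) σ =
        X l * pderiv l (z σ) + wedge (K := K) l (contr (K := K) l z) σ := by
      intro l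
      rw [diff_wedge, hD, map_neg, sub_neg_eq_add]
      rfl
    rw [Finset.sum_congr rfl fun l _ => h1 l, Finset.sum_add_distrib]
    have h2 := sum_wedge_contr (K := K) z σ
    rw [Finset.sum_apply] at h2
    have h3 : (z σ).IsHomogeneous e := (hz σ).1
    rw [h2, h3.sum_X_mul_pderiv]
    by_cases h0 : z σ = 0
    · simp [h0]
    · rw [((hz σ).2 h0).2, Pi.smul_apply, Nat.cast_smul_eq_nsmul, Nat.cast_smul_eq_nsmul,
        ← add_smul]
  have hne : ((e + (i + 1) : ℕ) : K) ≠ 0 := Nat.cast_ne_zero.2 (by omega)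
  refine ⟨((e + (i + 1) : ℕ) : K)⁻¹ • ∑ l, wedge (K := K) l (D l z), ?_, ?_⟩
  · refine Submodule.smul_mem _ _ (Submodule.sum_mem _ fun l _ => ?_)
    refine chains_mono (Finset.subset_univ _) (wedge_mem_chains (Z := Finset.univ) ?_)
    exact compLeft_mem_chains (fun m hm => pderiv_mem_polyGr l hm) hz
  · rw [map_smul, hsum, smul_smul, inv_mul_cancel₀ hne, one_smul]

theorem IsGradedAut.cycles_polyGr_le [CharZero K] (hψ : IsGradedAut ψ) (i e : ℕ) :
    cycles (varOp ψ (MvPolynomial (Fin n) K)) (polyGr K n) Finset.univ (i + 1) (e + 1) ≤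
      boundaries (varOp ψ (MvPolynomial (Fin n) K)) (polyGr K n) Finset.univ (i + 1) e := by
  rintro z ⟨hz, hz'⟩
  rw [SetLike.mem_coe, LinearMap.mem_ker] at hz'
  have h1 : ∀ j m, ψ.toLinearMap
      (varOp (AlgEquiv.refl : MvPolynomial (Fin n) K ≃ₐ[K] _) (MvPolynomial (Fin n) K) j m) =
      varOp ψ (MvPolynomial (Fin n) K) j (ψ.toLinearMap m) := fun j m => by
    simp only [varOp_apply, smul_eq_mul]
    simp
  have h2 : ∀ j m, ψ.symm.toLinearMap (varOp ψ (MvPolynomial (Fin n) K) j m) =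
      varOp (AlgEquiv.refl : MvPolynomial (Fin n) K ≃ₐ[K] _) (MvPolynomial (Fin n) K) j
        (ψ.symm.toLinearMap m) := fun j m => by
    simp only [varOp_apply, smul_eq_mul]
    simp
  obtain ⟨w, hw, hwz⟩ := GradedPoly.cycles_polyGr_le i e
    (show ψ.symm.toLinearMap.compLeft (Finset (Fin n)) z ∈ _ from
      ⟨compLeft_mem_chains (fun m hm => hψ.symm.map_mem_polyGr hm) hz, by
        rw [SetLike.mem_coe, LinearMap.mem_ker, ← compLeft_diff h2, hz', map_zero]⟩)
  refine ⟨ψ.toLinearMap.compLeft (Finset (Fin n)) w,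
    compLeft_mem_chains (fun m hm => hψ.map_mem_polyGr hm) hw, ?_⟩
  rw [← compLeft_diff h1, hwz]
  ext1 σ
  simp

theorem IsGradedAut.cycles_freeGr_le [CharZero K] (hψ : IsGradedAut ψ) {r : ℕ} (deg : Fin r → ℕ)
    (i e : ℕ) :
    cycles (varOp ψ (Fin r → MvPolynomial (Fin n) K)) (freeGr K n deg) Finset.univ
        (i + 1) (e + 1) ≤
      boundaries (varOp ψ (Fin r → MvPolynomial (Fin n) K)) (freeGr K n deg) Finset.univ
        (i + 1) e := by
  rintro z ⟨hz, hz'⟩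
  rw [SetLike.mem_coe, LinearMap.mem_ker] at hz'
  let π : Fin r → (Fin r → MvPolynomial (Fin n) K) →ₗ[K] MvPolynomial (Fin n) K :=
    fun b => LinearMap.proj b
  have hπ : ∀ b j v, π b (varOp ψ (Fin r → MvPolynomial (Fin n) K) j v) =
      varOp ψ (MvPolynomial (Fin n) K) j (π b v) := fun b j v => rfl
  have h : ∀ b, ∃ w ∈ chains (polyGr K n) Finset.univ (i + 2) (e - deg b),
      diff (varOp ψ (MvPolynomial (Fin n) K)) w = (π b).compLeft (Finset (Fin n)) z := by
    intro b
    have h1 : (π b).compLeft (Finset (Fin n)) z ∈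
        cycles (varOp ψ (MvPolynomial (Fin n) K)) (polyGr K n) Finset.univ (i + 1)
          (e + 1 - deg b) :=
      ⟨compLeft_mem_chains (fun m hm => mem_freeGr_iff.1 hm b) hz, by
        rw [SetLike.mem_coe, LinearMap.mem_ker, ← compLeft_diff (hπ b), hz', map_zero]⟩
    by_cases hb : deg b ≤ e
    · rw [Nat.sub_add_comm hb] at h1
      exact hψ.cycles_polyGr_le i _ h1
    · refine ⟨0, zero_mem _, ?_⟩
      rw [map_zero]
      ext1 σ
      have := (h1.1 σ).1
      rw [Nat.sub_eq_zero_of_le (by omega), polyGr, Submodule.mem_bot] at this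
      exact this.symm
  choose w hw hwz using h
  refine ⟨fun σ b => w b σ, fun σ => ⟨mem_freeGr_iff.2 fun b => (hw b σ).1, fun h0 => ?_⟩, ?_⟩
  · obtain ⟨b, hb⟩ := Function.ne_iff.1 h0
    exact (hw b σ).2 hb
  · ext1 σ
    funext b
    have := compLeft_diff (hπ b) (fun σ b => w b σ)
    have h2 := congrFun (this.trans (hwz b)) σ
    exact h2

theorem IsGradedAut.opSpan_polyGr [CharZero K] (hψ : IsGradedAut ψ) (e : ℕ) :
    opSpan (varOp ψ (MvPolynomial (Fin n) K)) Finset.univ (polyGr K n e) =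
      polyGr K n (e + 1) ⊓ (idealOfVars (Fin n) K).restrictScalars K := by
  have hmem : ∀ p : MvPolynomial (Fin n) K, ∀ d, p.IsHomogeneous d →
      (p ∈ idealOfVars (Fin n) K ↔ d ≠ 0 ∨ p = 0) := by
    intro p d hp
    have := mem_pow_idealOfVars_iff 1 p
    rw [pow_one] at this
    rw [this]
    constructor
    · intro h
      by_cases h0 : p = 0
      · exact Or.inr h0
      · obtain ⟨m, hm⟩ := Finset.nonempty_iff_ne_empty.2 (fun h => h0 (support_eq_empty.1 h))
        have h1 := h m hm
        have h2 : d = m.degree := hp.degree_eq_sum_deg_support hm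
        left; omega
    · rintro (h | rfl)
      · intro m hm
        have h2 : d = m.degree := hp.degree_eq_sum_deg_support hm
        omega
      · simp
  apply le_antisymm
  · rw [opSpan_le]
    intro l _ p hp
    refine ⟨hψ.varOp_mem_polyGr l e p hp, ?_⟩
    exact Ideal.mul_mem_right _ _ ((hmem _ 1 (hψ.isHomogeneous_X l)).2 (Or.inl one_ne_zero))
  · rintro p ⟨hp, hpm⟩
    have hp' : p.IsHomogeneous e := hp
    rcases (hmem p e hp').1 hpm with h | rfl
    · have h1 := (hψ.symm p e).1 hp'
      have h2 := h1.sum_X_mul_pderiv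
      have h3 := congrArg ψ h2
      rw [map_sum, map_nsmul, ψ.apply_symm_apply] at h3
      have h4 : p = (e : K)⁻¹ • ∑ l, ψ (X l * pderiv l (ψ.symm p)) := by
        rw [h3, ← Nat.cast_smul_eq_nsmul K, smul_smul, inv_mul_cancel₀ (Nat.cast_ne_zero.2 h),
          one_smul]
      rw [h4]
      refine Submodule.smul_mem _ _ (Submodule.sum_mem _ fun l _ => ?_)
      rw [map_mul]
      exact map_mem_opSpan (T := varOp ψ (MvPolynomial (Fin n) K)) (Finset.mem_univ l)
        (hψ.map_mem_polyGr (pderiv_mem_polyGr l (e := e) h1))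
    · exact zero_mem _

theorem IsGradedAut.mem_opSpan_freeGr [CharZero K] (hψ : IsGradedAut ψ) {r : ℕ} {deg : Fin r → ℕ}
    {e : ℕ} {v : Fin r → MvPolynomial (Fin n) K} :
    v ∈ opSpan (varOp ψ (Fin r → MvPolynomial (Fin n) K)) Finset.univ (freeGr K n deg e) ↔
      v ∈ freeGr K n deg (e + 1) ∧ ∀ b, v b ∈ idealOfVars (Fin n) K := by
  constructor
  · intro hv
    have hle : opSpan (varOp ψ (Fin r → MvPolynomial (Fin n) K)) Finset.univ (freeGr K n deg e) ≤
        freeGr K n deg (e + 1) := opSpan_le.2 fun l _ m hm => hψ.varOp_mem_freeGr l e m hm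
    refine ⟨hle hv, fun b => ?_⟩
    have hle' : opSpan (varOp ψ (Fin r → MvPolynomial (Fin n) K)) Finset.univ (freeGr K n deg e) ≤
        ((idealOfVars (Fin n) K).restrictScalars K).comap (LinearMap.proj b) := by
      refine opSpan_le.2 fun l _ m hm => ?_
      have h1 : ψ (X l) ∈ opSpan (varOp ψ (MvPolynomial (Fin n) K)) Finset.univ (polyGr K n 1) := by
        have := map_mem_opSpan (T := varOp ψ (MvPolynomial (Fin n) K)) (N := polyGr K n 1)
          (Finset.mem_univ l) (m := 1) (isHomogeneous_one (Fin n) K)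
        simpa [varOp_apply] using this
      rw [hψ.opSpan_polyGr] at h1
      exact Ideal.mul_mem_right _ _ h1.2
    exact hle' hv
  · rintro ⟨hv, hvm⟩
    rw [mem_freeGr_iff] at hv
    have h1 : v = ∑ b, LinearMap.single K (fun _ => MvPolynomial (Fin n) K) b (v b) := by
      simp [LinearMap.sum_single_apply]
    rw [h1]
    refine Submodule.sum_mem _ fun b _ => ?_
    by_cases hb : deg b ≤ e
    · have h2 : v b ∈ opSpan (varOp ψ (MvPolynomial (Fin n) K)) Finset.univ
          (polyGr K n (e - deg b)) := by
        rw [hψ.opSpan_polyGr, ← Nat.sub_add_comm hb]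
        exact ⟨hv b, hvm b⟩
      have h3 : opSpan (varOp ψ (MvPolynomial (Fin n) K)) Finset.univ (polyGr K n (e - deg b)) ≤
          (opSpan (varOp ψ (Fin r → MvPolynomial (Fin n) K)) Finset.univ
            (freeGr K n deg e)).comap (LinearMap.single K (fun _ => MvPolynomial (Fin n) K) b) := by
        refine opSpan_le.2 fun l hl p hp => ?_
        have h4 : LinearMap.single K (fun _ => MvPolynomial (Fin n) K) b p ∈ freeGr K n deg e := by
          rw [mem_freeGr_iff]
          intro b'
          by_cases h : b' = b
          · subst h; simpa using hp
          · simp [Pi.single_eq_of_ne h]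
        have h5 := map_mem_opSpan (T := varOp ψ (Fin r → MvPolynomial (Fin n) K)) hl h4
        have h6 : varOp ψ (Fin r → MvPolynomial (Fin n) K) l
            (LinearMap.single K (fun _ => MvPolynomial (Fin n) K) b p) =
            LinearMap.single K (fun _ => MvPolynomial (Fin n) K) b
              (varOp ψ (MvPolynomial (Fin n) K) l p) := by
          rw [varOp_apply, varOp_apply, LinearMap.single_apply, LinearMap.single_apply,
            ← Pi.single_smul]
        rw [h6] at h5
        exact h5
      exact h3 h2
    · have h2 := hv b
      rw [Nat.sub_eq_zero_of_le (by omega), polyGr, Submodule.mem_bot] at h2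
      rw [h2, map_zero]
      exact zero_mem _

end LinearForms

end GradedPoly

/-! ### Graded Betti numbers as dimensions of Koszul homology -/

namespace GradedPoly

open MvPolynomial TensorProduct Koszul

section Graded

variable {K : Type*} [Field K] {n : ℕ}

theorem comp_map {r r' : ℕ} {deg : Fin r → ℕ} {deg' : Fin r' → ℕ}
    (f : (Fin r' → MvPolynomial (Fin n) K) →ₗ[MvPolynomial (Fin n) K]
      (Fin r → MvPolynomial (Fin n) K))
    (hf : ∀ j, ∀ v ∈ freePart K n deg' j, f v ∈ freePart K n deg j) (j : ℕ)
    (v : Fin r' → MvPolynomial (Fin n) K) : comp deg j (f v) = f (comp deg' j v) := by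
  obtain ⟨L, hL, hs⟩ := exists_sum_comp deg' v j
  conv_lhs => rw [hs]
  rw [map_sum, comp_sum, Finset.sum_eq_single j]
  · rw [comp_of_mem deg j (hf j _ (comp_mem _ _ _)), if_pos rfl]
  · intro l _ hl
    rw [comp_of_mem deg j (hf l _ (comp_mem _ _ _)), if_neg hl]
  · intro h; exact absurd (Finset.mem_range.2 hL) h

theorem map_mem_freeGr {r r' : ℕ} {deg : Fin r → ℕ} {deg' : Fin r' → ℕ}
    {f : (Fin r' → MvPolynomial (Fin n) K) →ₗ[MvPolynomial (Fin n) K]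
      (Fin r → MvPolynomial (Fin n) K)}
    (hf : ∀ j, ∀ v ∈ freePart K n deg' j, f v ∈ freePart K n deg j) {e : ℕ}
    {v : Fin r' → MvPolynomial (Fin n) K} (hv : v ∈ freeGr K n deg' e) :
    f v ∈ freeGr K n deg e := by
  cases e with
  | zero =>
    rw [freeGr, Submodule.mem_bot] at hv ⊢
    rw [hv, map_zero]
  | succ e => exact hf e v hv

/-- An exact sequence of homogeneous maps is exact in each degree. -/
theorem map_freeGr_eq {r r' : ℕ} {deg : Fin r → ℕ} {deg' : Fin r' → ℕ}
    {f : (Fin r' → MvPolynomial (Fin n) K) →ₗ[MvPolynomial (Fin n) K]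
      (Fin r → MvPolynomial (Fin n) K)}
    (hf : ∀ j, ∀ v ∈ freePart K n deg' j, f v ∈ freePart K n deg j) {M : Type*} [AddCommGroup M]
    [Module K M] [Module (MvPolynomial (Fin n) K) M] [IsScalarTower K (MvPolynomial (Fin n) K) M]
    {g : (Fin r → MvPolynomial (Fin n) K) →ₗ[MvPolynomial (Fin n) K] M}
    (hfg : Function.Exact f g) (e : ℕ) :
    (freeGr K n deg' e).map (f.restrictScalars K) =
      freeGr K n deg e ⊓ LinearMap.ker (g.restrictScalars K) := by
  apply le_antisymm
  · rintro _ ⟨v, hv, rfl⟩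
    exact ⟨map_mem_freeGr hf hv, (hfg _).2 ⟨v, rfl⟩⟩
  · rintro v ⟨hv, hgv⟩
    obtain ⟨w, rfl⟩ := (hfg v).1 hgv
    cases e with
    | zero =>
      rw [SetLike.mem_coe, freeGr, Submodule.mem_bot] at hv
      exact ⟨0, zero_mem _, by rw [map_zero, hv]⟩
    | succ e =>
      refine ⟨comp deg' e w, comp_mem _ _ _, ?_⟩
      have h1 := comp_map f hf e w
      rw [comp_of_mem deg e hv, if_pos rfl] at h1
      exact h1.symm

theorem mem_quotGr_succ {I : Ideal (MvPolynomial (Fin n) K)} {e : ℕ}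
    {m : MvPolynomial (Fin n) K ⧸ I} :
    m ∈ quotGr I (e + 1) ↔ ∃ p : MvPolynomial (Fin n) K, p.IsHomogeneous e ∧
      Ideal.Quotient.mk I p = m := Iff.rfl

theorem GradedFreeResolution.map_aug {I : Ideal (MvPolynomial (Fin n) K)}
    (hI : I.IsHomogeneous (homogeneousSubmodule (Fin n) K)) (F : GradedFreeResolution I) (e : ℕ) :
    (freeGr K n (F.deg 0) e).map (F.aug.restrictScalars K) = quotGr I e := by
  cases e with
  | zero => rw [quotGr, freeGr, polyGr, Submodule.map_bot, Submodule.map_bot]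
  | succ e =>
    apply le_antisymm
    · rintro _ ⟨v, hv, rfl⟩
      exact F.aug_mem e v hv
    · intro m hm
      obtain ⟨p, hp, rfl⟩ := mem_quotGr_succ.1 hm
      obtain ⟨w, hw⟩ := F.aug_surjective (Ideal.Quotient.mk I p)
      refine ⟨comp (F.deg 0) e w, comp_mem _ _ _, ?_⟩
      choose q hq hqw using fun l => F.aug_mem l (comp (F.deg 0) l w) (comp_mem _ _ _)
      obtain ⟨L, hL, hs⟩ := exists_sum_comp (F.deg 0) w e
      have h1 : p - ∑ l ∈ Finset.range L, q l ∈ I := by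
        rw [← Ideal.Quotient.eq, map_sum, Finset.sum_congr rfl fun l _ => hqw l, ← map_sum, ← hs,
          hw]
      have h2 := homogeneousComponent_mem_of_mem hI h1 e
      rw [map_sub, map_sum, homogeneousComponent_of_mem hp, if_pos rfl, Finset.sum_eq_single e,
        homogeneousComponent_of_mem (hq e), if_pos rfl, ← Ideal.Quotient.eq, hqw] at h2
      · exact h2.symm
      · intro l _ hl
        rw [homogeneousComponent_of_mem (hq l), if_neg (Ne.symm hl)]
      · intro h; exact absurd (Finset.mem_range.2 hL) h

end Graded

section Tor

variable {K : Type*} [Field K] {n : ℕ}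
  {ψ : MvPolynomial (Fin n) K ≃ₐ[K] MvPolynomial (Fin n) K}
  {I : Ideal (MvPolynomial (Fin n) K)} (F : GradedFreeResolution I)

theorem mk_one_eq_zero_iff {r : ℕ} (v : Fin r → MvPolynomial (Fin n) K) :
    (1 : MvPolynomial (Fin n) K ⧸ idealOfVars (Fin n) K) ⊗ₜ[MvPolynomial (Fin n) K] v = 0 ↔
      ∀ b, v b ∈ idealOfVars (Fin n) K := by
  have hsmul : ∀ p : MvPolynomial (Fin n) K,
      p • (1 : MvPolynomial (Fin n) K ⧸ idealOfVars (Fin n) K) = 0 ↔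
        p ∈ idealOfVars (Fin n) K := by
    intro p
    have h : p • (1 : MvPolynomial (Fin n) K ⧸ idealOfVars (Fin n) K) =
        Submodule.Quotient.mk (p • 1) := rfl
    rw [h, Submodule.Quotient.mk_eq_zero, smul_eq_mul, mul_one]
  constructor
  · intro h b
    have h1 := congrArg ((TensorProduct.rid (MvPolynomial (Fin n) K)
      (MvPolynomial (Fin n) K ⧸ idealOfVars (Fin n) K)).toLinearMap ∘ₗ
      (LinearMap.proj b : (Fin r → MvPolynomial (Fin n) K) →ₗ[MvPolynomial (Fin n) K] _).lTensor
        (MvPolynomial (Fin n) K ⧸ idealOfVars (Fin n) K)) h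
    rw [map_zero, LinearMap.comp_apply, LinearMap.lTensor_tmul, LinearEquiv.coe_coe,
      TensorProduct.rid_tmul, LinearMap.proj_apply] at h1
    exact (hsmul _).1 h1
  · intro h
    have h1 : v = ∑ b, v b • Pi.single b (1 : MvPolynomial (Fin n) K) := by
      ext1 b
      simp [Finset.sum_apply, Pi.single_apply]
    rw [h1, TensorProduct.tmul_sum]
    refine Finset.sum_eq_zero fun b _ => ?_
    rw [← TensorProduct.smul_tmul, (hsmul _).2 (h b), TensorProduct.zero_tmul]

/-- The map `v ↦ 1 ⊗ v` from `F_i` to `K ⊗_S F_i`. -/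
noncomputable def GradedFreeResolution.toFiber (i : ℕ) :
    (Fin (F.rank i) → MvPolynomial (Fin n) K) →ₗ[K] F.Fiber i :=
  (TensorProduct.mk (MvPolynomial (Fin n) K) (MvPolynomial (Fin n) K ⧸ idealOfVars (Fin n) K)
    (Fin (F.rank i) → MvPolynomial (Fin n) K) 1).restrictScalars K

theorem GradedFreeResolution.toFiber_eq_zero {i : ℕ}
    {v : Fin (F.rank i) → MvPolynomial (Fin n) K} :
    F.toFiber i v = 0 ↔ ∀ b, v b ∈ idealOfVars (Fin n) K := mk_one_eq_zero_iff v

theorem GradedFreeResolution.fiberD_toFiber (i : ℕ)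
    (v : Fin (F.rank (i + 1)) → MvPolynomial (Fin n) K) :
    F.fiberD i (F.toFiber (i + 1) v) = F.toFiber i (F.d i v) := rfl

/-- The image in degree `e - 1` of the differential `F_{s+1} ⟶ F_s`. -/
noncomputable def GradedFreeResolution.image (s e : ℕ) :
    Submodule K (Fin (F.rank s) → MvPolynomial (Fin n) K) :=
  (freeGr K n (F.deg (s + 1)) e).map ((F.d s).restrictScalars K)

theorem finrank_map_mkQ {V : Type*} [AddCommGroup V] [Module K V] {W U : Submodule K V}
    [Module.Finite K W] (h : U ≤ W) :
    (Module.finrank K (W.map U.mkQ) : ℤ) = Module.finrank K W - Module.finrank K U := by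
  have h1 := W.finrank_map_add_finrank_inf_ker U.mkQ
  rw [Submodule.ker_mkQ, inf_of_le_right h] at h1
  omega

/-- `Tor_{s+1}` as the kernel of `K ⊗ N ⟶ K ⊗ F_s` for the image `N` of `F_{s+1} ⟶ F_s`. -/
theorem GradedFreeResolution.finrank_tor [CharZero K] (hψ : IsGradedAut ψ) (s j : ℕ) :
    (Module.finrank K (F.tor (s + 1) j) : ℤ) =
      Module.finrank K (F.image s (j + 1) ⊓ opSpan (varOp ψ _) Finset.univ
        (freeGr K n (F.deg s) j) : Submodule K (Fin (F.rank s) → MvPolynomial (Fin n) K)) -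
      Module.finrank K (opSpan (varOp ψ _) Finset.univ (F.image s j)) := by
  set d : (Fin (F.rank (s + 1)) → MvPolynomial (Fin n) K) →ₗ[K]
    (Fin (F.rank s) → MvPolynomial (Fin n) K) := (F.d s).restrictScalars K with hd
  -- Both sides are images of `W / U`, under `v ↦ 1 ⊗ v` and under the differential.
  let W : Submodule K (Fin (F.rank (s + 1)) → MvPolynomial (Fin n) K) :=
    freeGr K n (F.deg (s + 1)) (j + 1) ⊓ LinearMap.ker (F.toFiber s ∘ₗ d)
  let U : Submodule K (Fin (F.rank (s + 1)) → MvPolynomial (Fin n) K) :=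
    F.image (s + 1) (j + 1) ⊔
      opSpan (varOp ψ _) Finset.univ (freeGr K n (F.deg (s + 1)) j)
  have hfd : Module.Finite K W := Submodule.finiteDimensional_inf_left _ _
  have hdd : ∀ w, F.d s (F.d (s + 1) w) = 0 := fun w => (F.exact_succ s _).2 ⟨w, rfl⟩
  have him : F.image (s + 1) (j + 1) =
      freeGr K n (F.deg (s + 1)) (j + 1) ⊓ LinearMap.ker d :=
    map_freeGr_eq (F.d_mem (s + 1)) (F.exact_succ s) (j + 1)
  have hspan : ∀ v, v ∈ opSpan (varOp ψ _) Finset.univ (freeGr K n (F.deg (s + 1)) j) ↔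
      v ∈ freeGr K n (F.deg (s + 1)) (j + 1) ∧ F.toFiber (s + 1) v = 0 := fun v => by
    rw [hψ.mem_opSpan_freeGr, F.toFiber_eq_zero]
  have hspan' : ∀ v, v ∈ opSpan (varOp ψ _) Finset.univ (freeGr K n (F.deg s) j) ↔
      v ∈ freeGr K n (F.deg s) (j + 1) ∧ F.toFiber s v = 0 := fun v => by
    rw [hψ.mem_opSpan_freeGr, F.toFiber_eq_zero]
  have hU : U ≤ W := by
    refine sup_le ?_ fun v hv => ?_
    · rw [him]
      refine inf_le_inf_left _ fun v hv => ?_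
      rw [LinearMap.mem_ker] at hv ⊢
      rw [LinearMap.comp_apply, hv, map_zero]
    · obtain ⟨h1, h2⟩ := (hspan v).1 hv
      refine ⟨h1, ?_⟩
      have h3 := F.fiberD_toFiber s v
      rw [h2, map_zero] at h3
      exact h3.symm
  have hWf : W.map (F.toFiber (s + 1)) = F.cycles (s + 1) j := by
    apply le_antisymm
    · rintro _ ⟨v, ⟨hv, hv'⟩, rfl⟩
      exact ⟨⟨v, hv, rfl⟩, hv'⟩
    · rintro _ ⟨⟨v, hv, rfl⟩, hv'⟩
      exact ⟨v, ⟨hv, hv'⟩, rfl⟩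
  have hUf : U.map (F.toFiber (s + 1)) = F.boundaries (s + 1) j := by
    have h1 : (opSpan (varOp ψ _) Finset.univ (freeGr K n (F.deg (s + 1)) j)).map
        (F.toFiber (s + 1)) = ⊥ := by
      rw [Submodule.eq_bot_iff]
      rintro _ ⟨v, hv, rfl⟩
      exact ((hspan v).1 hv).2
    rw [Submodule.map_sup, h1, sup_bot_eq]
    apply le_antisymm
    · rintro _ ⟨_, ⟨v, hv, rfl⟩, rfl⟩
      exact ⟨F.toFiber (s + 2) v, ⟨v, hv, rfl⟩, rfl⟩
    · rintro _ ⟨_, ⟨v, hv, rfl⟩, rfl⟩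
      exact ⟨_, ⟨v, hv, rfl⟩, rfl⟩
  have hWd : W.map d = F.image s (j + 1) ⊓
      opSpan (varOp ψ _) Finset.univ (freeGr K n (F.deg s) j) := by
    apply le_antisymm
    · rintro _ ⟨v, ⟨hv, hv'⟩, rfl⟩
      exact ⟨⟨v, hv, rfl⟩, (hspan' _).2 ⟨map_mem_freeGr (F.d_mem s) hv, hv'⟩⟩
    · rintro _ ⟨⟨v, hv, rfl⟩, hv'⟩
      exact ⟨v, ⟨hv, ((hspan' _).1 hv').2⟩, rfl⟩
  have hUd : U.map d = opSpan (varOp ψ _) Finset.univ (F.image s j) := by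
    have h1 : (F.image (s + 1) (j + 1)).map d = ⊥ := by
      rw [Submodule.eq_bot_iff]
      rintro _ ⟨_, ⟨v, hv, rfl⟩, rfl⟩
      exact hdd v
    rw [Submodule.map_sup, h1, bot_sup_eq]
    apply le_antisymm
    · rw [Submodule.map_le_iff_le_comap, opSpan_le]
      intro l hl m hm
      rw [Submodule.mem_comap, hd, map_varOp]
      exact map_mem_opSpan hl ⟨m, hm, rfl⟩
    · rw [opSpan_le]
      rintro l hl _ ⟨m, hm, rfl⟩
      exact ⟨_, map_mem_opSpan hl hm, map_varOp (F.d s) l m⟩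
  have h1 := Submodule.finrank_map_sub_finrank_map (F.toFiber (s + 1)) hU
    fun v hv => Submodule.mem_sup_right ((hspan v).2 ⟨hv.1.1, hv.2⟩)
  have h2 := Submodule.finrank_map_sub_finrank_map d hU
    fun v hv => Submodule.mem_sup_left (him ▸ ⟨hv.1.1, hv.2⟩)
  have hUf' : U.map (F.toFiber (s + 1)) ≤ W.map (F.toFiber (s + 1)) := Submodule.map_mono hU
  rw [hWd, hUd] at h2
  rw [h2, ← h1]
  unfold GradedFreeResolution.tor
  rw [← hWf, ← hUf]
  exact finrank_map_mkQ hUf'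

theorem GradedFreeResolution.hdim_image [CharZero K] (hψ : IsGradedAut ψ) (i s e : ℕ) :
    hdim (varOp ψ _) (F.image s) Finset.univ (i + 2) e =
      hdim (varOp ψ _) (F.image (s + 1)) Finset.univ (i + 1) (e + 1) := by
  have h := hdim_map_add_two (T := varOp ψ (Fin (F.rank (s + 1)) → MvPolynomial (Fin n) K))
    (T' := varOp ψ (Fin (F.rank s) → MvPolynomial (Fin n) K)) (Z := Finset.univ)
    (𝓑 := freeGr K n (F.deg (s + 1))) (f := (F.d s).restrictScalars K) varOp_comm
    hψ.varOp_mem_freeGr (map_varOp (F.d s)) (hψ.cycles_freeGr_le (F.deg (s + 1))) i e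
  have h1 : (fun e => freeGr K n (F.deg (s + 1)) e ⊓ LinearMap.ker ((F.d s).restrictScalars K)) =
      F.image (s + 1) :=
    funext fun e => (map_freeGr_eq (F.d_mem (s + 1)) (F.exact_succ s) e).symm
  rw [h1] at h
  exact h

theorem GradedFreeResolution.varOp_mem_image (hψ : IsGradedAut ψ) (s : ℕ) (l : Fin n) (e : ℕ)
    (v : Fin (F.rank s) → MvPolynomial (Fin n) K) (hv : v ∈ F.image s e) :
    varOp ψ _ l v ∈ F.image s (e + 1) := by
  obtain ⟨w, hw, rfl⟩ := hv
  exact ⟨_, hψ.varOp_mem_freeGr l e w hw, map_varOp (F.d s) l w⟩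

theorem GradedFreeResolution.hdim_image_one [CharZero K] (hψ : IsGradedAut ψ) (s e : ℕ) :
    hdim (varOp ψ _) (F.image s) Finset.univ 1 e =
      Module.finrank K (F.tor (s + 2) (e + 1)) := by
  have h1 : ∀ e, F.image (s + 1) e =
      freeGr K n (F.deg (s + 1)) e ⊓ LinearMap.ker ((F.d s).restrictScalars K) :=
    fun e => map_freeGr_eq (F.d_mem (s + 1)) (F.exact_succ s) e
  have h := hdim_map_one (T := varOp ψ (Fin (F.rank (s + 1)) → MvPolynomial (Fin n) K))
    (T' := varOp ψ (Fin (F.rank s) → MvPolynomial (Fin n) K)) (Z := Finset.univ)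
    (𝓑 := freeGr K n (F.deg (s + 1))) (f := (F.d s).restrictScalars K) varOp_comm
    hψ.varOp_mem_freeGr
    (fun j e m hm => by rw [← h1] at hm ⊢; exact F.varOp_mem_image hψ _ j e m hm)
    (map_varOp (F.d s)) (hψ.cycles_freeGr_le (F.deg (s + 1))) e
  rw [← h1, ← h1] at h
  rw [F.finrank_tor hψ]
  exact h

/-- `dim Tor_i(K, S/I)_{i+e}` is the dimension of the `i`-th Koszul homology of `S / I` with
coefficients of degree `e`, with respect to any basis of the linear forms. -/
theorem GradedFreeResolution.finrank_tor_eq_hdim [CharZero K] (hψ : IsGradedAut ψ)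
    (hI : I.IsHomogeneous (homogeneousSubmodule (Fin n) K)) {i : ℕ} (hi : 1 < i) (e : ℕ) :
    (Module.finrank K (F.tor i (i + e)) : ℤ) =
      hdim (varOp ψ _) (quotGr I) Finset.univ i e := by
  obtain ⟨i, rfl⟩ : ∃ i', i = i' + 2 := ⟨i - 2, by omega⟩
  have h := hdim_map_add_two (T := varOp ψ (Fin (F.rank 0) → MvPolynomial (Fin n) K))
    (T' := varOp ψ (MvPolynomial (Fin n) K ⧸ I)) (Z := Finset.univ)
    (𝓑 := freeGr K n (F.deg 0)) (f := F.aug.restrictScalars K) varOp_comm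
    hψ.varOp_mem_freeGr (map_varOp F.aug) (hψ.cycles_freeGr_le (F.deg 0)) i e
  have h1 : (fun e => freeGr K n (F.deg 0) e ⊓ LinearMap.ker (F.aug.restrictScalars K)) =
      F.image 0 :=
    funext fun e => (map_freeGr_eq (F.d_mem 0) F.exact_zero e).symm
  have h2 : (fun e => (freeGr K n (F.deg 0) e).map (F.aug.restrictScalars K)) = quotGr I :=
    funext fun e => F.map_aug hI e
  rw [h1, h2] at h
  rw [h]
  have h3 : ∀ i s e, hdim (varOp ψ _) (F.image s) Finset.univ (i + 1) e =
      hdim (varOp ψ _) (F.image (s + i)) Finset.univ 1 (e + i) := by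
    intro i
    induction i with
    | zero => intro s e; rfl
    | succ i ih =>
      intro s e
      rw [F.hdim_image hψ, ih, add_assoc, add_assoc, add_comm 1 i]
  rw [h3, F.hdim_image_one hψ, zero_add, show i + 2 + e = e + 1 + i + 1 by omega]

/-- Betti numbers as dimensions of Koszul homology. The condition `1 < i` leaves room for the two
steps of the resolution that dimension shifting uses. -/
theorem bettiNumber_eq_hdim [CharZero K] (hψ : IsGradedAut ψ)
    (hI : I.IsHomogeneous (homogeneousSubmodule (Fin n) K)) {i : ℕ} (hi : 1 < i) (e : ℕ) :
    (bettiNumber I i (i + e) : ℤ) = hdim (varOp ψ _) (quotGr I) Finset.univ i e := by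
  rw [bettiNumber, dif_pos hI]
  exact GradedFreeResolution.finrank_tor_eq_hdim _ hψ hI hi e

end Tor

end GradedPoly

/-! ### Leading exponents of spaces of polynomials -/

namespace MonomialOrder

open MvPolynomial
open scoped MonomialOrder

variable {σ K : Type*} [Field K] {m : MonomialOrder σ}

/-- The exponents of the leading monomials of the nonzero elements of a space of polynomials. -/
def leadingExps (m : MonomialOrder σ) (V : Submodule K (MvPolynomial σ K)) : Set (σ →₀ ℕ) :=
  {u | ∃ f ∈ V, f ≠ 0 ∧ m.degree f = u}

theorem leadingExps_mono {V W : Submodule K (MvPolynomial σ K)} (h : V ≤ W) :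
    m.leadingExps V ⊆ m.leadingExps W :=
  fun _ ⟨f, hf, h0, hu⟩ => ⟨f, h hf, h0, hu⟩

theorem degree_eq_of_forall_le {f : MvPolynomial σ K} {u : σ →₀ ℕ} (h : coeff u f ≠ 0)
    (hle : ∀ w ∈ f.support, w ≼[m] u) : m.degree f = u := by
  have h1 : m.degree f ≼[m] u := m.degree_le_iff.2 hle
  have h2 : u ≼[m] m.degree f := m.le_degree (mem_support_iff.2 h)
  exact m.toSyn.injective (le_antisymm h1 h2)

/-- A nontrivial linear combination of polynomials with distinct leading exponents does not have
all its coefficients at these exponents equal to zero. -/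
theorem exists_coeff_sum_ne_zero {ι : Type*} [Fintype ι] {f : ι → MvPolynomial σ K}
    (h0 : ∀ i, f i ≠ 0) (hinj : Function.Injective fun i => m.degree (f i)) {c : ι → K}
    (hc : c ≠ 0) : ∃ i, coeff (m.degree (f i)) (∑ j, c j • f j) ≠ 0 := by
  classical
  obtain ⟨i0, hi0⟩ := Function.ne_iff.1 hc
  obtain ⟨i, hi, hmax⟩ := Finset.exists_max_image (Finset.univ.filter fun i => c i ≠ 0)
    (fun i => m.toSyn (m.degree (f i))) ⟨i0, by simpa using hi0⟩
  refine ⟨i, ?_⟩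
  rw [coeff_sum, Finset.sum_eq_single i]
  · rw [coeff_smul, smul_eq_mul]
    exact mul_ne_zero (Finset.mem_filter.1 hi).2 (m.coeff_degree_ne_zero_iff.2 (h0 i))
  · intro j _ hj
    rw [coeff_smul, smul_eq_mul]
    by_cases hcj : c j = 0
    · rw [hcj, zero_mul]
    · rw [m.coeff_eq_zero_of_lt, mul_zero]
      refine lt_of_le_of_ne (hmax j (by simpa using hcj)) fun h => hj (hinj ?_)
      exact m.toSyn.injective h
  · simp

theorem linearIndependent_of_degree_injective {ι : Type*} [Fintype ι] {f : ι → MvPolynomial σ K}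
    (h0 : ∀ i, f i ≠ 0) (hinj : Function.Injective fun i => m.degree (f i)) :
    LinearIndependent K f := by
  rw [Fintype.linearIndependent_iff]
  intro c hc i
  by_contra hci
  obtain ⟨j, hj⟩ := exists_coeff_sum_ne_zero h0 hinj (c := c) fun h => hci (congrFun h i)
  rw [hc] at hj
  simp at hj

theorem det_coeff_ne_zero {ι : Type*} [Fintype ι] [DecidableEq ι] {f : ι → MvPolynomial σ K}
    (h0 : ∀ i, f i ≠ 0) (hinj : Function.Injective fun i => m.degree (f i)) :
    (Matrix.of fun i j => coeff (m.degree (f j)) (f i)).det ≠ 0 := by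
  intro hdet
  obtain ⟨c, hc, hcm⟩ := Matrix.exists_vecMul_eq_zero_iff.2 hdet
  obtain ⟨j, hj⟩ := exists_coeff_sum_ne_zero h0 hinj hc
  apply hj
  have := congrFun hcm j
  rw [Matrix.vecMul, dotProduct] at this
  simpa [coeff_sum, coeff_smul] using this

theorem finite_leadingExps (V : Submodule K (MvPolynomial σ K)) [Module.Finite K V] :
    (m.leadingExps V).Finite := by
  by_contra h
  obtain ⟨s, hs, hcard⟩ := Set.Infinite.exists_subset_card_eq h (Module.finrank K V + 1)
  choose! f hf hf0 hfd using fun u (hu : u ∈ m.leadingExps V) => hu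
  have hli : LinearIndependent K (fun u : s => (⟨f u, hf u (hs u.2)⟩ : V)) := by
    refine LinearIndependent.of_comp V.subtype ?_
    refine m.linearIndependent_of_degree_injective (fun u => hf0 u (hs u.2)) fun u w huw => ?_
    have huw' : m.degree (f u) = m.degree (f w) := huw
    rw [hfd u (hs u.2), hfd w (hs w.2)] at huw'
    exact Subtype.ext huw'
  have := hli.fintype_card_le_finrank
  rw [Fintype.card_coe, hcard] at this
  omega

/-- The dimension of a space of polynomials is the number of its leading exponents. -/
theorem ncard_leadingExps (V : Submodule K (MvPolynomial σ K)) [Module.Finite K V] :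
    (m.leadingExps V).ncard = Module.finrank K V := by
  classical
  have hfin := m.finite_leadingExps V
  set s := hfin.toFinset with hs
  have hmem : ∀ u, u ∈ s ↔ u ∈ m.leadingExps V := fun u => hfin.mem_toFinset
  choose! f hf hf0 hfd using fun u (hu : u ∈ m.leadingExps V) => hu
  have hli : LinearIndependent K (fun u : s => f u) := by
    refine m.linearIndependent_of_degree_injective
      (fun u => hf0 u ((hmem _).1 u.2)) fun u w huw => ?_
    have huw' : m.degree (f u) = m.degree (f w) := huw
    rw [hfd u ((hmem _).1 u.2), hfd w ((hmem _).1 w.2)] at huw'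
    exact Subtype.ext huw'
  have hspan : Submodule.span K (Set.range fun u : s => f u) = V := by
    apply le_antisymm
    · rw [Submodule.span_le]
      rintro _ ⟨u, rfl⟩
      exact hf u ((hmem _).1 u.2)
    · have key : ∀ a : m.syn, ∀ p ∈ V, m.toSyn (m.degree p) = a →
          p ∈ Submodule.span K (Set.range fun u : s => f u) := by
        intro a
        induction a using WellFoundedLT.induction with
        | ind a ih =>
          intro p hp ha
          by_cases hp0 : p = 0
          · rw [hp0]; exact zero_mem _
          set u := m.degree p with hu
          have hus : u ∈ m.leadingExps V := ⟨p, hp, hp0, rfl⟩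
          have hfu : coeff u (f u) ≠ 0 := by
            have := m.coeff_degree_ne_zero_iff.2 (hf0 u hus)
            rwa [hfd u hus] at this
          set c := coeff u p / coeff u (f u) with hc
          have hmemu : f u ∈ Submodule.span K (Set.range fun u : s => f u) :=
            Submodule.subset_span ⟨⟨u, (hmem u).2 hus⟩, rfl⟩
          have hq : coeff u (p - c • f u) = 0 := by
            rw [coeff_sub, coeff_smul, smul_eq_mul, hc, div_mul_cancel₀ _ hfu, sub_self]
          rw [← sub_add_cancel p (c • f u)]
          refine add_mem ?_ (Submodule.smul_mem _ _ hmemu)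
          by_cases hq0 : p - c • f u = 0
          · rw [hq0]; exact zero_mem _
          refine ih (m.toSyn (m.degree (p - c • f u))) ?_ _
            (sub_mem hp (Submodule.smul_mem _ _ (hf u hus))) rfl
          rw [← ha]
          refine lt_of_le_of_ne ?_ fun h => ?_
          · refine m.degree_sub_le.trans (sup_le le_rfl ?_)
            refine m.degree_smul_le.trans ?_
            rw [hfd u hus]
          · have h1 := m.coeff_degree_ne_zero_iff.2 hq0
            rw [m.toSyn.injective h] at h1
            exact h1 hq
      exact fun p hp => key _ p hp rfl
  rw [Set.ncard_eq_toFinset_card _ hfin, ← hs]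
  have h1 := finrank_span_eq_card hli
  rw [hspan, Fintype.card_coe] at h1
  exact h1.symm

/-- A space of polynomials with a nonvanishing minor in the columns `u` has as many leading
exponents that are at least the smallest column. -/
theorem card_le_ncard_leadingExps {ι : Type*} [Fintype ι] [DecidableEq ι]
    {V : Submodule K (MvPolynomial σ K)} [Module.Finite K V] {f : ι → MvPolynomial σ K}
    (hf : ∀ i, f i ∈ V) {u : ι → σ →₀ ℕ} {w : σ →₀ ℕ} (hu : ∀ i, w ≼[m] u i)
    (hdet : (Matrix.of fun i j => coeff (u j) (f i)).det ≠ 0) :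
    Fintype.card ι ≤ (m.leadingExps V ∩ {x | w ≼[m] x}).ncard := by
  have hne : ∀ c : ι → K, c ≠ 0 → ∃ j, coeff (u j) (∑ i, c i • f i) ≠ 0 := by
    intro c hc
    by_contra! h
    refine hdet (Matrix.exists_vecMul_eq_zero_iff.1 ⟨c, hc, funext fun j => ?_⟩)
    rw [Matrix.vecMul, dotProduct]
    simpa [coeff_sum, coeff_smul] using h j
  have hli : LinearIndependent K f := by
    rw [Fintype.linearIndependent_iff]
    intro c hc i
    by_contra hci
    obtain ⟨j, hj⟩ := hne c fun h => hci (congrFun h i)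
    rw [hc] at hj
    simp at hj
  have hfd : Module.Finite K (Submodule.span K (Set.range f)) :=
    Module.Finite.span_of_finite K (Set.finite_range f)
  rw [← finrank_span_eq_card hli, ← m.ncard_leadingExps]
  refine Set.ncard_le_ncard (fun x hx => ?_) ((m.finite_leadingExps V).inter_of_left _)
  obtain ⟨p, hp, hp0, rfl⟩ := hx
  refine ⟨⟨p, Submodule.span_le.2 (by rintro _ ⟨i, rfl⟩; exact hf i) hp, hp0, rfl⟩, ?_⟩
  obtain ⟨c, rfl⟩ := (Submodule.mem_span_range_iff_exists_fun K).1 hp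
  have hc : c ≠ 0 := by
    rintro rfl
    exact hp0 (by simp)
  obtain ⟨j, hj⟩ := hne c hc
  exact (hu j).trans (m.le_degree (mem_support_iff.2 hj))

/-- Two finite sets of exponents agree if they have equally many elements above each exponent. -/
theorem eq_of_ncard_inter_eq {A B : Set (σ →₀ ℕ)} (hA : A.Finite) (hB : B.Finite)
    (h : ∀ u ∈ A ∪ B, (A ∩ {x | u ≼[m] x}).ncard = (B ∩ {x | u ≼[m] x}).ncard) : A = B := by
  by_contra hne
  have hD : ((A \ B) ∪ (B \ A)).Nonempty := by
    rw [Set.nonempty_iff_ne_empty]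
    intro h1
    rw [Set.union_empty_iff, Set.sdiff_eq_empty, Set.sdiff_eq_empty] at h1
    exact hne (subset_antisymm h1.1 h1.2)
  have hDf : ((A \ B) ∪ (B \ A)).Finite := hA.sdiff.union hB.sdiff
  obtain ⟨u, hu, hmax⟩ := Set.exists_max_image _ (fun x => m.toSyn x) hDf hD
  have hmain : ∀ A B : Set (σ →₀ ℕ), B.Finite → u ∈ B → u ∉ A →
      (∀ x ∈ A, x ∉ B → m.toSyn x ≤ m.toSyn u) →
      (A ∩ {x | u ≼[m] x}).ncard < (B ∩ {x | u ≼[m] x}).ncard := by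
    intro A B hB huB huA hmax
    refine Set.ncard_lt_ncard ⟨fun x hx => ⟨?_, hx.2⟩, fun hsub => ?_⟩ (hB.inter_of_left _)
    · by_contra hxB
      have : x = u := m.toSyn.injective (le_antisymm (hmax x hx.1 hxB) hx.2)
      exact huA (this ▸ hx.1)
    · exact huA (hsub ⟨huB, le_refl (m.toSyn u)⟩).1
  rcases hu with hu | hu
  · exact (hmain B A hA hu.1 hu.2 fun x hx hx' => hmax x (Or.inr ⟨hx, hx'⟩)).ne
      (h u (Or.inl hu.1)).symm
  · exact (hmain A B hB hu.1 hu.2 fun x hx hx' => hmax x (Or.inl ⟨hx, hx'⟩)).ne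
      (h u (Or.inr hu.1))

end MonomialOrder

/-! ### Initial ideals -/

namespace GradedPoly

open MvPolynomial Koszul
open scoped MonomialOrder

section Initial

variable {K : Type*} [Field K] {n : ℕ}

/-- The homogeneous elements of degree `e` of an ideal. -/
noncomputable def hpart (J : Ideal (MvPolynomial (Fin n) K)) (e : ℕ) :
    Submodule K (MvPolynomial (Fin n) K) :=
  homogeneousSubmodule (Fin n) K e ⊓ J.restrictScalars K

instance (J : Ideal (MvPolynomial (Fin n) K)) (e : ℕ) : Module.Finite K (hpart J e) := by
  have : Module.Finite K (homogeneousSubmodule (Fin n) K e) :=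
    Module.Finite.iff_fg.2 (homogeneousSubmodule_fg (Fin n) K e)
  exact Submodule.finiteDimensional_inf_left _ _

/-- The exponents of the leading monomials of the homogeneous elements of an ideal. -/
def leadingSet (J : Ideal (MvPolynomial (Fin n) K)) : Set (Fin n →₀ ℕ) :=
  {u | u ∈ (degRevLex n).leadingExps (hpart J u.degree)}

theorem degree_eq_of_mem_support {f : MvPolynomial (Fin n) K} {e : ℕ} (hf : f.IsHomogeneous e)
    {u : Fin n →₀ ℕ} (hu : u ∈ f.support) : u.degree = e :=
  (hf.degree_eq_sum_deg_support hu).symm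

theorem degree_eq_of_mem_leadingExps {V : Submodule K (MvPolynomial (Fin n) K)} {e : ℕ}
    (hV : V ≤ homogeneousSubmodule (Fin n) K e) {u : Fin n →₀ ℕ}
    (hu : u ∈ (degRevLex n).leadingExps V) : u.degree = e := by
  obtain ⟨f, hf, h0, rfl⟩ := hu
  exact degree_eq_of_mem_support (hV hf) ((degRevLex n).degree_mem_support h0)

theorem mem_leadingExps_hpart {J : Ideal (MvPolynomial (Fin n) K)} {e : ℕ} {u : Fin n →₀ ℕ} :
    u ∈ (degRevLex n).leadingExps (hpart J e) ↔ u.degree = e ∧ u ∈ leadingSet J := by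
  constructor
  · intro h
    have h1 : u.degree = e := degree_eq_of_mem_leadingExps inf_le_left h
    exact ⟨h1, by rw [leadingSet, Set.mem_ofPred_eq, h1]; exact h⟩
  · rintro ⟨rfl, h⟩
    exact h

theorem leadingSet_upward {J : Ideal (MvPolynomial (Fin n) K)} {u w : Fin n →₀ ℕ}
    (hu : u ∈ leadingSet J) (h : u ≤ w) : w ∈ leadingSet J := by
  obtain ⟨c, rfl⟩ := exists_add_of_le h
  obtain ⟨f, ⟨hf, hfJ⟩, h0, hfu⟩ := hu
  have hm : (monomial c (1 : K)) ≠ 0 := by simp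
  refine ⟨f * monomial c 1, ⟨?_, Ideal.mul_mem_right _ _ hfJ⟩, mul_ne_zero h0 hm, ?_⟩
  · rw [map_add]
    exact IsHomogeneous.mul hf (isHomogeneous_monomial _ rfl)
  · classical
    rw [(degRevLex n).degree_mul h0 hm, hfu, (degRevLex n).degree_monomial, if_neg one_ne_zero]

theorem mem_leadingSet_of_mem {J : Ideal (MvPolynomial (Fin n) K)}
    (hJ : J.IsHomogeneous (homogeneousSubmodule (Fin n) K)) {f : MvPolynomial (Fin n) K}
    (hf : f ∈ J) (h0 : f ≠ 0) : (degRevLex n).degree f ∈ leadingSet J := by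
  set u := (degRevLex n).degree f with hu
  have hc : coeff u (homogeneousComponent u.degree f) ≠ 0 := by
    rw [coeff_homogeneousComponent, if_pos rfl]
    exact (degRevLex n).coeff_degree_ne_zero_iff.2 h0
  refine ⟨homogeneousComponent u.degree f,
    ⟨homogeneousComponent_isHomogeneous _ _, homogeneousComponent_mem_of_mem hJ hf _⟩,
    fun h => hc (by rw [h, coeff_zero]), ?_⟩
  refine (degRevLex n).degree_eq_of_forall_le hc fun w hw => (degRevLex n).le_degree ?_
  rw [mem_support_iff, coeff_homogeneousComponent] at hw
  rw [mem_support_iff]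
  split_ifs at hw with h
  · exact hw
  · exact absurd rfl hw

/-- The initial ideal is the monomial ideal on the leading exponents. -/
theorem initialIdeal_eq {J : Ideal (MvPolynomial (Fin n) K)}
    (hJ : J.IsHomogeneous (homogeneousSubmodule (Fin n) K)) :
    initialIdeal J = Ideal.span ((fun u => monomial u (1 : K)) '' leadingSet J) := by
  rw [initialIdeal, (degRevLex n).span_leadingTerm_eq_span_monomial']
  congr 1
  ext p
  constructor
  · rintro ⟨f, ⟨hf, h0⟩, rfl⟩
    exact ⟨_, mem_leadingSet_of_mem hJ hf h0, rfl⟩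
  · rintro ⟨u, ⟨f, ⟨_, hf⟩, h0, hu⟩, rfl⟩
    exact ⟨f, ⟨hf, h0⟩, by simp only [hu]⟩

/-- The set of exponents is closed under adding exponents. -/
def IsUpward (L : Set (Fin n →₀ ℕ)) : Prop := ∀ u ∈ L, ∀ w, u ≤ w → w ∈ L

theorem mem_span_monomial_iff {L : Set (Fin n →₀ ℕ)} (hL : IsUpward L)
    {p : MvPolynomial (Fin n) K} :
    p ∈ Ideal.span ((fun u => monomial u (1 : K)) '' L) ↔ ∀ u ∈ p.support, u ∈ L := by
  rw [mem_ideal_span_monomial_image]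
  refine forall₂_congr fun u _ => ⟨?_, fun h => ⟨u, h, le_rfl⟩⟩
  rintro ⟨w, hw, hwu⟩
  exact hL w hw u hwu

theorem leadingSet_span_monomial {L : Set (Fin n →₀ ℕ)} (hL : IsUpward L) :
    leadingSet (Ideal.span ((fun u => monomial u (1 : K)) '' L)) = L := by
  classical
  ext u
  constructor
  · rintro ⟨f, ⟨_, hf⟩, h0, hu⟩
    exact (mem_span_monomial_iff hL).1 hf u (hu ▸ (degRevLex n).degree_mem_support h0)
  · intro hu
    refine ⟨monomial u 1, ⟨isHomogeneous_monomial _ rfl, Ideal.subset_span ⟨u, hu, rfl⟩⟩,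
      by simp, ?_⟩
    rw [(degRevLex n).degree_monomial, if_neg one_ne_zero]

theorem isHomogeneous_span_monomial (L : Set (Fin n →₀ ℕ)) :
    (Ideal.span ((fun u => monomial u (1 : K)) '' L)).IsHomogeneous
      (homogeneousSubmodule (Fin n) K) := by
  refine Ideal.homogeneous_span _ _ ?_
  rintro _ ⟨u, _, rfl⟩
  exact ⟨u.degree, isHomogeneous_monomial _ rfl⟩

end Initial

/-! ### Koszul homology in degree zero and initial ideals -/

section HilbertFunction

variable {K : Type*} [Field K] {n : ℕ}

theorem mem_opSpan_polyGr {Z : Finset (Fin n)} {e : ℕ} {p : MvPolynomial (Fin n) K} :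
    p ∈ opSpan (varOp (AlgEquiv.refl : MvPolynomial (Fin n) K ≃ₐ[K] _) (MvPolynomial (Fin n) K)) Z
      (polyGr K n e) ↔ p ∈ polyGr K n (e + 1) ∧ ∀ u ∈ p.support, ∃ l ∈ Z, u l ≠ 0 := by
  constructor
  · intro h
    have hle : opSpan (varOp (AlgEquiv.refl : MvPolynomial (Fin n) K ≃ₐ[K] _)
        (MvPolynomial (Fin n) K)) Z (polyGr K n e) ≤ polyGr K n (e + 1) ⊓
          (Ideal.span (X '' (Z : Set (Fin n)))).restrictScalars K := by
      refine opSpan_le.2 fun l hl q hq => ⟨mul_mem_polyGr (isHomogeneous_X K l) hq, ?_⟩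
      exact Ideal.mul_mem_right _ _ (Ideal.subset_span ⟨l, hl, rfl⟩)
    exact ⟨(hle h).1, mem_ideal_span_X_image.1 (hle h).2⟩
  · rintro ⟨hp, hZ⟩
    rw [p.as_sum]
    refine Submodule.sum_mem _ fun u hu => ?_
    obtain ⟨l, hl, hul⟩ := hZ u hu
    have hle : Finsupp.single l 1 ≤ u := by
      rw [Finsupp.single_le_iff]; omega
    obtain ⟨w, rfl⟩ := exists_add_of_le hle
    have h1 : monomial (Finsupp.single l 1 + w) (coeff (Finsupp.single l 1 + w) p) =
        varOp (AlgEquiv.refl : MvPolynomial (Fin n) K ≃ₐ[K] _) (MvPolynomial (Fin n) K) l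
          (monomial w (coeff (Finsupp.single l 1 + w) p)) := by
      rw [varOp_apply, AlgEquiv.coe_refl, id, X, smul_eq_mul, monomial_mul, one_mul]
    rw [h1]
    refine map_mem_opSpan hl (mem_polyGr_iff.2 fun x hx => ?_)
    have h2 := mem_polyGr_iff.1 hp _ hu
    rw [map_add, Finsupp.degree_single] at h2
    rw [Finset.mem_singleton.1 (support_monomial_subset hx)]
    omega

/-- In the graded reverse lexicographic order, the monomials of a given degree that involve one of
the last variables are smaller than those that do not. -/
theorem lt_of_lastVars {p : ℕ} {u w : Fin n →₀ ℕ} (hdeg : w.degree = u.degree)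
    (hu : ∀ l ∈ lastVars n p, u l = 0) (hw : ∃ l ∈ lastVars n p, w l ≠ 0) :
    w ≺[degRevLex n] u := by
  obtain ⟨l0, hl0, hw0⟩ := hw
  rw [degRevLex_lt_iff]
  right
  obtain ⟨j, hj, hmax⟩ := Finset.exists_max_image w.support id ⟨l0, by simpa using hw0⟩
  have hup : ∀ l, l0 ≤ l → l ∈ lastVars n p := fun l hl => by
    rw [mem_lastVars] at hl0 ⊢
    have : (l0 : ℕ) ≤ l := hl
    omega
  have hl0j : l0 ≤ j := hmax l0 (by simpa using hw0)
  refine ⟨hdeg, j, fun l hl => ?_, ?_⟩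
  · rw [hu l (hup l (hl0j.trans hl.le))]
    by_contra h
    exact absurd (hmax l (Finsupp.mem_support_iff.2 h)) (not_le.2 hl)
  · rw [hu j (hup j hl0j)]
    exact Nat.pos_of_ne_zero (Finsupp.mem_support_iff.1 hj)

/-- The leading exponents of `J + (x_l : l among the last variables)` in degree `e`. -/
theorem leadingExps_hpart_sup (J : Ideal (MvPolynomial (Fin n) K)) (e p : ℕ) :
    (degRevLex n).leadingExps (hpart J e ⊔
      opSpan (varOp (AlgEquiv.refl : MvPolynomial (Fin n) K ≃ₐ[K] _) (MvPolynomial (Fin n) K))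
        (lastVars n p) (polyGr K n e)) =
      {u | u.degree = e ∧ (u ∈ leadingSet J ∨ ∃ l ∈ lastVars n p, u l ≠ 0)} := by
  classical
  ext u
  constructor
  · rintro ⟨f, hf, h0, hu⟩
    obtain ⟨a, ha, b, hb, rfl⟩ := Submodule.mem_sup.1 hf
    rw [mem_opSpan_polyGr] at hb
    have hhom : (a + b).IsHomogeneous e := IsHomogeneous.add ha.1 hb.1
    have hdeg : u.degree = e :=
      degree_eq_of_mem_support hhom (hu ▸ (degRevLex n).degree_mem_support h0)
    refine ⟨hdeg, ?_⟩
    by_contra! hne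
    obtain ⟨hnJ, hnZ⟩ := hne
    have hcoeff : ∀ w : Fin n →₀ ℕ, (∀ l ∈ lastVars n p, w l = 0) →
        coeff w (a + b) = coeff w a := by
      intro w hw
      rw [coeff_add, add_eq_left]
      by_contra hc
      obtain ⟨l, hl, hl'⟩ := hb.2 w (mem_support_iff.2 hc)
      exact hl' (hw l hl)
    have hau : coeff u a ≠ 0 := by
      rw [← hcoeff u hnZ, ← hu]
      exact (degRevLex n).coeff_degree_ne_zero_iff.2 h0
    apply hnJ
    rw [leadingSet, Set.mem_ofPred_eq, hdeg]
    refine ⟨a, ha, fun h => hau (by rw [h, coeff_zero]),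
      (degRevLex n).degree_eq_of_forall_le hau fun w hw => ?_⟩
    by_cases hwZ : ∃ l ∈ lastVars n p, w l ≠ 0
    · exact (lt_of_lastVars ((degree_eq_of_mem_support ha.1 hw).trans hdeg.symm) hnZ hwZ).le
    · push Not at hwZ
      rw [← hu]
      refine (degRevLex n).le_degree ?_
      rw [mem_support_iff, hcoeff w hwZ]
      exact mem_support_iff.1 hw
  · rintro ⟨hdeg, h | h⟩
    · exact MonomialOrder.leadingExps_mono le_sup_left (mem_leadingExps_hpart.2 ⟨hdeg, h⟩)
    · refine ⟨monomial u 1, Submodule.mem_sup_right (mem_opSpan_polyGr.2 ⟨?_, fun w hw => ?_⟩),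
        by simp, ?_⟩
      · exact isHomogeneous_monomial _ hdeg
      · rwa [Finset.mem_singleton.1 (support_monomial_subset hw)]
      · rw [(degRevLex n).degree_monomial, if_neg one_ne_zero]

instance {ι M : Type*} [Finite ι] [AddCommGroup M] [Module K M] (T : ι → M →ₗ[K] M)
    (Z : Finset ι) (N : Submodule K M) [Module.Finite K N] : Module.Finite K (opSpan T Z N) := by
  unfold opSpan
  infer_instance

/-- The Hilbert function of the quotient by `J` and the last variables depends only on the leading
exponents of `J`. -/
theorem finrank_hpart_sup_eq {J J' : Ideal (MvPolynomial (Fin n) K)}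
    (h : leadingSet J = leadingSet J') (e p : ℕ) :
    Module.finrank K (hpart J e ⊔
      opSpan (varOp (AlgEquiv.refl : MvPolynomial (Fin n) K ≃ₐ[K] _) (MvPolynomial (Fin n) K))
        (lastVars n p) (polyGr K n e) : Submodule K (MvPolynomial (Fin n) K)) =
    Module.finrank K (hpart J' e ⊔
      opSpan (varOp (AlgEquiv.refl : MvPolynomial (Fin n) K ≃ₐ[K] _) (MvPolynomial (Fin n) K))
        (lastVars n p) (polyGr K n e) : Submodule K (MvPolynomial (Fin n) K)) := by
  rw [← (degRevLex n).ncard_leadingExps, ← (degRevLex n).ncard_leadingExps,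
    leadingExps_hpart_sup, leadingExps_hpart_sup, h]

theorem map_mkQ_opSpan (ψ : MvPolynomial (Fin n) K ≃ₐ[K] MvPolynomial (Fin n) K)
    (J : Ideal (MvPolynomial (Fin n) K)) (Z : Finset (Fin n)) (e : ℕ) :
    (opSpan (varOp ψ (MvPolynomial (Fin n) K)) Z (polyGr K n e)).map (J.mkQ.restrictScalars K) =
      opSpan (varOp ψ _) Z (quotGr J e) := by
  apply le_antisymm
  · rw [Submodule.map_le_iff_le_comap, opSpan_le]
    intro l hl m hm
    rw [Submodule.mem_comap, map_varOp]
    exact map_mem_opSpan hl ⟨m, hm, rfl⟩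
  · rw [opSpan_le]
    rintro l hl _ ⟨m, hm, rfl⟩
    exact ⟨_, map_mem_opSpan hl hm, map_varOp J.mkQ l m⟩

/-- The Koszul homology of `S / J` in homological degree zero, computed in the polynomial ring. -/
theorem hdim_quotGr_zero {ψ : MvPolynomial (Fin n) K ≃ₐ[K] MvPolynomial (Fin n) K}
    (hψ : IsGradedAut ψ) (J : Ideal (MvPolynomial (Fin n) K)) (Z : Finset (Fin n)) (e : ℕ) :
    hdim (varOp ψ _) (quotGr J) Z 0 e = Module.finrank K (homogeneousSubmodule (Fin n) K e) -
      Module.finrank K (hpart J e ⊔ opSpan (varOp ψ (MvPolynomial (Fin n) K)) Z (polyGr K n e) :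
        Submodule K (MvPolynomial (Fin n) K)) := by
  have hle : opSpan (varOp ψ (MvPolynomial (Fin n) K)) Z (polyGr K n e) ≤ polyGr K n (e + 1) :=
    opSpan_le.2 fun l _ q hq => hψ.varOp_mem_polyGr l e q hq
  have hker : ∀ q, q ∈ LinearMap.ker (J.mkQ.restrictScalars K) ↔ q ∈ J := fun q =>
    Submodule.Quotient.mk_eq_zero J
  have h1 := Submodule.finrank_map_sub_finrank_map (J.mkQ.restrictScalars K)
    (W := polyGr K n (e + 1))
    (U := hpart J e ⊔ opSpan (varOp ψ (MvPolynomial (Fin n) K)) Z (polyGr K n e))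
    (sup_le inf_le_left hle)
    (fun q hq => Submodule.mem_sup_left ⟨hq.1, (hker q).1 hq.2⟩)
  have h2 : (hpart J e ⊔ opSpan (varOp ψ (MvPolynomial (Fin n) K)) Z (polyGr K n e)).map
      (J.mkQ.restrictScalars K) = opSpan (varOp ψ _) Z (quotGr J e) := by
    have h3 : (hpart J e).map (J.mkQ.restrictScalars K) = ⊥ := by
      rw [Submodule.eq_bot_iff]
      rintro _ ⟨q, hq, rfl⟩
      exact (hker q).2 hq.2
    rw [Submodule.map_sup, h3, bot_sup_eq, map_mkQ_opSpan]
  rw [h2] at h1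
  rw [hdim_zero hψ.varOp_mem_quotGr]
  exact h1

end HilbertFunction

end GradedPoly

/-! ### Linear changes of coordinates -/

namespace GradedPoly

open MvPolynomial Koszul
open scoped MonomialOrder

section LinearChange

variable {K : Type*} [Field K] {n : ℕ}

theorem linearChange_X (g : Matrix.GeneralLinearGroup (Fin n) K) (j : Fin n) :
    linearChange g (X j) = ∑ i, C ((g : Matrix (Fin n) (Fin n) K) i j) * X i := by
  simp [linearChange]

theorem linearChange_comp (g h : Matrix.GeneralLinearGroup (Fin n) K) :
    (linearChange g).comp (linearChange h) = linearChange (g * h) := by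
  ext1 j
  rw [AlgHom.comp_apply, linearChange_X, linearChange_X, map_sum]
  simp only [map_mul, algHom_C, linearChange_X, Units.val_mul, Matrix.mul_apply, map_sum,
    Finset.sum_mul, Finset.mul_sum, algebraMap_eq]
  rw [Finset.sum_comm]
  refine Finset.sum_congr rfl fun i _ => Finset.sum_congr rfl fun k _ => ?_
  ring

theorem linearChange_one : linearChange (1 : Matrix.GeneralLinearGroup (Fin n) K) =
    AlgHom.id K _ := by
  ext1 j
  rw [linearChange_X, Finset.sum_eq_single j]
  · simp
  · intro i _ hi
    simp [Matrix.one_apply_ne hi]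
  · simp

/-- The automorphism of the polynomial ring given by `g ∈ GL_n(K)`. -/
noncomputable def linearAut (g : Matrix.GeneralLinearGroup (Fin n) K) :
    MvPolynomial (Fin n) K ≃ₐ[K] MvPolynomial (Fin n) K :=
  AlgEquiv.ofAlgHom (linearChange g) (linearChange g⁻¹)
    (by rw [linearChange_comp, mul_inv_cancel, linearChange_one])
    (by rw [linearChange_comp, inv_mul_cancel, linearChange_one])

theorem linearAut_apply (g : Matrix.GeneralLinearGroup (Fin n) K) (p : MvPolynomial (Fin n) K) :
    linearAut g p = linearChange g p := rfl

theorem linearAut_symm_apply (g : Matrix.GeneralLinearGroup (Fin n) K)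
    (p : MvPolynomial (Fin n) K) : (linearAut g).symm p = linearChange g⁻¹ p := rfl

theorem linearChange_isHomogeneous (g : Matrix.GeneralLinearGroup (Fin n) K)
    {p : MvPolynomial (Fin n) K} {d : ℕ} (hp : p.IsHomogeneous d) :
    (linearChange g p).IsHomogeneous d := by
  have := hp.aeval (fun j => ∑ i, C ((g : Matrix (Fin n) (Fin n) K) i j) * X i) (n := 1)
    fun j => IsHomogeneous.sum _ _ _ fun i _ => isHomogeneous_C_mul_X _ _
  rwa [one_mul] at this

theorem isGradedAut_linearAut (g : Matrix.GeneralLinearGroup (Fin n) K) :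
    IsGradedAut (linearAut g) := fun p d =>
  ⟨fun h => linearChange_isHomogeneous g h, fun h => by
    have := linearChange_isHomogeneous g⁻¹ h
    rwa [← linearAut_symm_apply, AlgEquiv.symm_apply_apply] at this⟩

theorem isGradedAut_refl : IsGradedAut (AlgEquiv.refl : MvPolynomial (Fin n) K ≃ₐ[K] _) :=
  fun _ _ => Iff.rfl

theorem mem_map_linearChange {I : Ideal (MvPolynomial (Fin n) K)}
    {g : Matrix.GeneralLinearGroup (Fin n) K} {p : MvPolynomial (Fin n) K} :
    p ∈ I.map (linearChange g) ↔ ∃ q ∈ I, linearChange g q = p :=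
  Ideal.mem_map_iff_of_surjective _ (linearAut g).surjective

theorem linearChange_mul_apply (g h : Matrix.GeneralLinearGroup (Fin n) K)
    (p : MvPolynomial (Fin n) K) :
    linearChange (g * h) p = linearChange g (linearChange h p) := by
  rw [← linearChange_comp, AlgHom.comp_apply]

theorem map_linearChange_mul (I : Ideal (MvPolynomial (Fin n) K))
    (g h : Matrix.GeneralLinearGroup (Fin n) K) :
    I.map (linearChange (g * h)) = (I.map (linearChange h)).map (linearChange g) := by
  ext p
  rw [mem_map_linearChange, mem_map_linearChange]
  constructor
  · rintro ⟨q, hq, rfl⟩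
    exact ⟨_, mem_map_linearChange.2 ⟨q, hq, rfl⟩, (linearChange_mul_apply g h q).symm⟩
  · rintro ⟨r, hr, rfl⟩
    obtain ⟨q, hq, rfl⟩ := mem_map_linearChange.1 hr
    exact ⟨q, hq, linearChange_mul_apply g h q⟩

theorem isHomogeneous_map_linearChange {I : Ideal (MvPolynomial (Fin n) K)}
    (hI : I.IsHomogeneous (homogeneousSubmodule (Fin n) K))
    (g : Matrix.GeneralLinearGroup (Fin n) K) :
    (I.map (linearChange g)).IsHomogeneous (homogeneousSubmodule (Fin n) K) := by
  obtain ⟨s, rfl⟩ := (Ideal.IsHomogeneous.iff_exists _ I).1 hI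
  rw [Ideal.map_span]
  refine Ideal.homogeneous_span _ _ ?_
  rintro _ ⟨_, ⟨⟨x, d, hx⟩, _, rfl⟩, rfl⟩
  exact ⟨d, linearChange_isHomogeneous g hx⟩

theorem hpart_map_linearChange (I : Ideal (MvPolynomial (Fin n) K))
    (g : Matrix.GeneralLinearGroup (Fin n) K) (e : ℕ) :
    hpart (I.map (linearChange g)) e = (hpart I e).map (linearAut g).toLinearMap := by
  ext p
  constructor
  · rintro ⟨hp, hpI⟩
    obtain ⟨q, hq, rfl⟩ := mem_map_linearChange.1 hpI
    exact ⟨q, ⟨(isGradedAut_linearAut g _ _).2 hp, hq⟩, rfl⟩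
  · rintro ⟨q, ⟨hq, hqI⟩, rfl⟩
    exact ⟨linearChange_isHomogeneous g hq, mem_map_linearChange.2 ⟨q, hqI, rfl⟩⟩

theorem finrank_map_linearAut (g : Matrix.GeneralLinearGroup (Fin n) K)
    (V : Submodule K (MvPolynomial (Fin n) K)) :
    Module.finrank K (V.map (linearAut g).toLinearMap) = Module.finrank K V :=
  LinearEquiv.finrank_map_eq (linearAut g).toLinearEquiv V

/-- The nonvanishing loci of nonzero polynomials meet `GL_n(K)`. -/
theorem exists_eval_ne_zero [CharZero K] {p : MvPolynomial (Fin n × Fin n) K} (hp : p ≠ 0) :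
    ∃ g : Matrix.GeneralLinearGroup (Fin n) K,
      eval (fun ij : Fin n × Fin n => (g : Matrix (Fin n) (Fin n) K) ij.1 ij.2) p ≠ 0 := by
  have hdet := Matrix.det_mvPolynomialX_ne_zero (Fin n) K
  obtain ⟨x, hx⟩ : ∃ x : Fin n × Fin n → K,
      eval x (p * (Matrix.mvPolynomialX (Fin n) (Fin n) K).det) ≠ 0 := by
    by_contra! h
    exact mul_ne_zero hp hdet (MvPolynomial.funext fun x => by rw [h x, map_zero])
  rw [map_mul, RingHom.map_det] at hx
  have hM : (eval x).mapMatrix (Matrix.mvPolynomialX (Fin n) (Fin n) K) =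
      Matrix.of fun i j => x (i, j) := by
    ext i j
    simp
  rw [hM] at hx
  exact ⟨Matrix.GeneralLinearGroup.mkOfDetNeZero _ (mul_ne_zero_iff.1 hx).2,
    (mul_ne_zero_iff.1 hx).1⟩

end LinearChange

/-! ### Generic initial ideals exist -/

section Galligo

variable {K : Type*} [Field K] {n : ℕ}

/-- The number of leading exponents of `g I` in degree `e` that are at least `w`. -/
noncomputable def leadingCount (I : Ideal (MvPolynomial (Fin n) K)) (e : ℕ) (w : Fin n →₀ ℕ)
    (g : Matrix.GeneralLinearGroup (Fin n) K) : ℕ :=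
  ((degRevLex n).leadingExps (hpart (I.map (linearChange g)) e) ∩ {x | w ≼[degRevLex n] x}).ncard

theorem leadingCount_le (I : Ideal (MvPolynomial (Fin n) K)) (e : ℕ) (w : Fin n →₀ ℕ)
    (g : Matrix.GeneralLinearGroup (Fin n) K) :
    leadingCount I e w g ≤ Module.finrank K (hpart I e) := by
  rw [← finrank_map_linearAut g (hpart I e), ← hpart_map_linearChange,
    ← (degRevLex n).ncard_leadingExps]
  exact Set.ncard_le_ncard Set.inter_subset_left ((degRevLex n).finite_leadingExps _)

/-- The coordinate change with indeterminate matrix. -/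
noncomputable def genericChange (K : Type*) [Field K] (n : ℕ) :
    MvPolynomial (Fin n) K →+* MvPolynomial (Fin n) (MvPolynomial (Fin n × Fin n) K) :=
  eval₂Hom (C.comp C) fun j => ∑ i, C (X (i, j)) * X i

theorem map_genericChange (g : Matrix.GeneralLinearGroup (Fin n) K)
    (p : MvPolynomial (Fin n) K) :
    map (eval fun ij : Fin n × Fin n => (g : Matrix (Fin n) (Fin n) K) ij.1 ij.2)
      (genericChange K n p) = linearChange g p := by
  have h : (map (eval fun ij : Fin n × Fin n => (g : Matrix (Fin n) (Fin n) K) ij.1 ij.2)).comp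
      (genericChange K n) = (linearChange g : MvPolynomial (Fin n) K →+* _) := by
    apply MvPolynomial.ringHom_ext
    · intro r; simp [genericChange]
    · intro j; simp [genericChange, linearChange_X]
  exact RingHom.congr_fun h p

/-- The counts of leading exponents are lower semicontinuous: this is witnessed by a minor of the
matrix of coefficients of `g I`. -/
theorem exists_leadingCount_le (I : Ideal (MvPolynomial (Fin n) K)) (e : ℕ) (w : Fin n →₀ ℕ)
    (g₀ : Matrix.GeneralLinearGroup (Fin n) K) :
    ∃ p : MvPolynomial (Fin n × Fin n) K, p ≠ 0 ∧
      ∀ g : Matrix.GeneralLinearGroup (Fin n) K,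
        eval (fun ij : Fin n × Fin n => (g : Matrix (Fin n) (Fin n) K) ij.1 ij.2) p ≠ 0 →
          leadingCount I e w g₀ ≤ leadingCount I e w g := by
  classical
  have hfin : ((degRevLex n).leadingExps (hpart (I.map (linearChange g₀)) e) ∩
      {x | w ≼[degRevLex n] x}).Finite :=
    ((degRevLex n).finite_leadingExps _).inter_of_left _
  set s := hfin.toFinset with hs
  have hmem : ∀ u : s, u.1 ∈ (degRevLex n).leadingExps (hpart (I.map (linearChange g₀)) e) ∧
      w ≼[degRevLex n] u.1 := fun u => hfin.mem_toFinset.1 u.2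
  choose f hf hf0 hfd using fun u : s => (hmem u).1
  have hf' : ∀ u : s, ∃ q ∈ hpart I e, linearChange g₀ q = f u := fun u => by
    have := hf u
    rw [hpart_map_linearChange] at this
    exact this
  choose q hq hqf using hf'
  set P : Matrix s s (MvPolynomial (Fin n × Fin n) K) :=
    Matrix.of fun u v => coeff v.1 (genericChange K n (q u)) with hP
  have heval : ∀ g : Matrix.GeneralLinearGroup (Fin n) K,
      eval (fun ij : Fin n × Fin n => (g : Matrix (Fin n) (Fin n) K) ij.1 ij.2) P.det =
        (Matrix.of fun u v : s => coeff v.1 (linearChange g (q u))).det := by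
    intro g
    rw [RingHom.map_det]
    congr 1
    ext u v
    rw [RingHom.mapMatrix_apply, Matrix.map_apply, Matrix.of_apply, hP, Matrix.of_apply,
      ← map_genericChange, coeff_map]
  refine ⟨P.det, fun h0 => ?_, fun g hg => ?_⟩
  · have h1 := heval g₀
    rw [h0, map_zero] at h1
    have h2 := (degRevLex n).det_coeff_ne_zero hf0 fun u v huv => by
      simp only [hfd] at huv
      exact Subtype.ext huv
    simp only [hfd] at h2
    simp only [hqf] at h1
    exact h2 h1.symm
  · rw [heval] at hg
    have h1 := (degRevLex n).card_le_ncard_leadingExps (w := w)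
      (V := hpart (I.map (linearChange g)) e) (f := fun u => linearChange g (q u))
      (u := fun v : s => v.1)
      (fun u => by rw [hpart_map_linearChange]; exact ⟨_, hq u, rfl⟩) (fun u => (hmem u).2) hg
    rw [Fintype.card_coe, hs, ← Set.ncard_eq_toFinset_card _ hfin] at h1
    exact h1

/-- The coordinate change `g` maximises all counts of leading exponents in degree `e`. -/
def IsMaximalAt (I : Ideal (MvPolynomial (Fin n) K)) (e : ℕ)
    (g : Matrix.GeneralLinearGroup (Fin n) K) : Prop :=
  ∀ w : Fin n →₀ ℕ, w.degree = e → ∀ g', leadingCount I e w g' ≤ leadingCount I e w g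

theorem exists_isMaximalAt (I : Ideal (MvPolynomial (Fin n) K)) (e : ℕ) :
    ∃ p : MvPolynomial (Fin n × Fin n) K, p ≠ 0 ∧
      ∀ g : Matrix.GeneralLinearGroup (Fin n) K,
        eval (fun ij : Fin n × Fin n => (g : Matrix (Fin n) (Fin n) K) ij.1 ij.2) p ≠ 0 →
          IsMaximalAt I e g := by
  have h : ∀ w : Fin n →₀ ℕ, ∃ p : MvPolynomial (Fin n × Fin n) K, p ≠ 0 ∧
      ∀ g : Matrix.GeneralLinearGroup (Fin n) K,
        eval (fun ij : Fin n × Fin n => (g : Matrix (Fin n) (Fin n) K) ij.1 ij.2) p ≠ 0 →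
          ∀ g', leadingCount I e w g' ≤ leadingCount I e w g := by
    intro w
    have hbdd : BddAbove (Set.range (leadingCount I e w)) :=
      ⟨_, by rintro _ ⟨g, rfl⟩; exact leadingCount_le I e w g⟩
    obtain ⟨g₀, hg₀⟩ := Nat.sSup_mem (Set.range_nonempty (leadingCount I e w)) hbdd
    obtain ⟨p, hp, hpg⟩ := exists_leadingCount_le I e w g₀
    refine ⟨p, hp, fun g hg g' => le_trans ?_ (hpg g hg)⟩
    rw [hg₀]
    exact le_csSup hbdd ⟨g', rfl⟩
  choose p hp hpg using h
  have hfin : {w : Fin n →₀ ℕ | w.degree = e}.Finite :=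
    (Finsupp.finite_of_degree_le e).subset fun w hw => le_of_eq hw
  refine ⟨∏ w ∈ hfin.toFinset, p w, Finset.prod_ne_zero_iff.2 fun w _ => hp w,
    fun g hg w hw => hpg w g ?_⟩
  rw [map_prod, Finset.prod_ne_zero_iff] at hg
  exact hg w (hfin.mem_toFinset.2 hw)

theorem IsMaximalAt.leadingExps_eq {I : Ideal (MvPolynomial (Fin n) K)} {e : ℕ}
    {g g' : Matrix.GeneralLinearGroup (Fin n) K} (hg : IsMaximalAt I e g)
    (hg' : IsMaximalAt I e g') :
    (degRevLex n).leadingExps (hpart (I.map (linearChange g)) e) =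
      (degRevLex n).leadingExps (hpart (I.map (linearChange g')) e) := by
  refine (degRevLex n).eq_of_ncard_inter_eq ((degRevLex n).finite_leadingExps _)
    ((degRevLex n).finite_leadingExps _) fun u hu => ?_
  have hdeg : u.degree = e := by
    rcases hu with hu | hu
    · exact (mem_leadingExps_hpart.1 hu).1
    · exact (mem_leadingExps_hpart.1 hu).1
  exact le_antisymm (hg' u hdeg g) (hg u hdeg g')

theorem IsMaximalAt.mem_leadingSet_iff {I : Ideal (MvPolynomial (Fin n) K)}
    {g g' : Matrix.GeneralLinearGroup (Fin n) K} {u : Fin n →₀ ℕ} (hg : IsMaximalAt I u.degree g)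
    (hg' : IsMaximalAt I u.degree g') :
    u ∈ leadingSet (I.map (linearChange g)) ↔ u ∈ leadingSet (I.map (linearChange g')) := by
  have h := hg.leadingExps_eq hg'
  have h1 := mem_leadingExps_hpart (J := I.map (linearChange g)) (e := u.degree) (u := u)
  have h2 := mem_leadingExps_hpart (J := I.map (linearChange g')) (e := u.degree) (u := u)
  rw [h, h2] at h1
  simpa using h1.symm

/-- Dickson's lemma. -/
theorem exists_finset_le (L : Set (Fin n →₀ ℕ)) :
    ∃ G : Finset (Fin n →₀ ℕ), (∀ v ∈ G, v ∈ L) ∧ ∀ u ∈ L, ∃ v ∈ G, v ≤ u := by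
  have hfin : {v | Minimal (· ∈ L) v}.Finite :=
    (setOfPred_minimal_antichain (· ∈ L)).finite_of_wellQuasiOrdered wellQuasiOrdered_le
  refine ⟨hfin.toFinset, fun v hv => (hfin.mem_toFinset.1 hv).prop, fun u hu => ?_⟩
  obtain ⟨v, hvu, hv⟩ := exists_minimal_le_of_wellFoundedLT (· ∈ L) u hu
  exact ⟨v, hfin.mem_toFinset.2 hv, hvu⟩

/-- The leading exponents of `g I` and `h I` agree if the former are contained in the latter:
in each degree there are as many as the dimension of `I` in that degree. -/
theorem leadingSet_eq_of_subset {I : Ideal (MvPolynomial (Fin n) K)} {L : Set (Fin n →₀ ℕ)}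
    {g : ℕ → Matrix.GeneralLinearGroup (Fin n) K} {h : Matrix.GeneralLinearGroup (Fin n) K}
    (hL : ∀ u : Fin n →₀ ℕ, u ∈ L ↔ u ∈ leadingSet (I.map (linearChange (g u.degree))))
    (hsub : L ⊆ leadingSet (I.map (linearChange h))) :
    leadingSet (I.map (linearChange h)) = L := by
  have hdeg : ∀ e, (degRevLex n).leadingExps (hpart (I.map (linearChange (g e))) e) =
      (degRevLex n).leadingExps (hpart (I.map (linearChange h)) e) := by
    intro e
    refine Set.eq_of_subset_of_ncard_le (fun u hu => ?_) ?_
      ((degRevLex n).finite_leadingExps _)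
    · obtain ⟨h1, h2⟩ := mem_leadingExps_hpart.1 hu
      refine mem_leadingExps_hpart.2 ⟨h1, hsub ((hL u).2 ?_)⟩
      rw [h1]
      exact h2
    · rw [(degRevLex n).ncard_leadingExps, (degRevLex n).ncard_leadingExps,
        hpart_map_linearChange, hpart_map_linearChange, finrank_map_linearAut,
        finrank_map_linearAut]
  refine subset_antisymm (fun u hu => (hL u).2 ?_) hsub
  have h1 : u ∈ (degRevLex n).leadingExps (hpart (I.map (linearChange h)) u.degree) :=
    mem_leadingExps_hpart.2 ⟨rfl, hu⟩
  rw [← hdeg] at h1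
  exact (mem_leadingExps_hpart.1 h1).2

/-- **Galligo's theorem**: generic initial ideals exist. -/
theorem exists_isGenericInitialIdeal [CharZero K] {I : Ideal (MvPolynomial (Fin n) K)}
    (hI : I.IsHomogeneous (homogeneousSubmodule (Fin n) K)) :
    ∃ J, IsGenericInitialIdeal I J := by
  classical
  choose p hp hpg using exists_isMaximalAt I
  choose g hg using fun e => exists_eval_ne_zero (hp e)
  obtain ⟨L, hL⟩ : ∃ L : Set (Fin n →₀ ℕ),
      ∀ u, u ∈ L ↔ u ∈ leadingSet (I.map (linearChange (g u.degree))) := 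
    ⟨{u | u ∈ leadingSet (I.map (linearChange (g u.degree)))}, fun u => by rw [Set.mem_ofPred_eq]⟩
  have hLg : ∀ h u, IsMaximalAt I u.degree h →
      (u ∈ L ↔ u ∈ leadingSet (I.map (linearChange h))) := fun h u hh => by
    rw [hL, (hpg u.degree _ (hg u.degree)).mem_leadingSet_iff hh]
  obtain ⟨G, hGL, hG⟩ := exists_finset_le L
  refine ⟨Ideal.span ((fun u => monomial u (1 : K)) '' L), ∏ v ∈ G, p v.degree,
    Finset.prod_ne_zero_iff.2 fun v _ => hp _, fun h hh => ?_⟩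
  rw [map_prod, Finset.prod_ne_zero_iff] at hh
  rw [initialIdeal_eq (isHomogeneous_map_linearChange hI h)]
  rw [leadingSet_eq_of_subset hL fun u hu => ?_]
  obtain ⟨v, hv, hvu⟩ := hG u hu
  exact leadingSet_upward ((hLg h v (hpg _ h (hh v hv))).1 (hGL v hv)) hvu

theorem isGenericInitialIdeal_gin [CharZero K] {I : Ideal (MvPolynomial (Fin n) K)}
    (hI : I.IsHomogeneous (homogeneousSubmodule (Fin n) K)) : IsGenericInitialIdeal I (gin I) :=
  Classical.epsilon_spec (exists_isGenericInitialIdeal hI)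

end Galligo

/-! ### Elementary changes of coordinates -/

section Borel

variable {K : Type*} [Field K] {n : ℕ}

/-- The elementary coordinate change `X_l ↦ X_l + t X_j`, for an indeterminate `t`. -/
noncomputable def elemChange (K : Type*) [Field K] {n : ℕ} (j l : Fin n) :
    MvPolynomial (Fin n) K →+* MvPolynomial (Fin n) (Polynomial K) :=
  eval₂Hom (C.comp Polynomial.C) fun i => X i + if i = l then C Polynomial.X * X j else 0

theorem map_elemChange {j l : Fin n} (hjl : j ≠ l) (t : K) :
    ∃ b : Matrix.GeneralLinearGroup (Fin n) K, ∀ p : MvPolynomial (Fin n) K,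
      map (Polynomial.evalRingHom t) (elemChange K j l p) = linearChange b p := by
  refine ⟨Matrix.GeneralLinearGroup.mkOfDetNeZero (Matrix.transvection j l t)
    (by rw [Matrix.det_transvection_of_ne _ _ hjl]; exact one_ne_zero), fun p => ?_⟩
  set b := Matrix.GeneralLinearGroup.mkOfDetNeZero (Matrix.transvection j l t)
    (by rw [Matrix.det_transvection_of_ne _ _ hjl]; exact one_ne_zero) with hb
  have hbm : (b : Matrix (Fin n) (Fin n) K) = Matrix.transvection j l t := rfl
  have h : (map (Polynomial.evalRingHom t)).comp (elemChange K j l) =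
      (linearChange b : MvPolynomial (Fin n) K →+* _) := by
    apply MvPolynomial.ringHom_ext
    · intro r; simp [elemChange]
    · intro i
      have h1 : linearChange b (X i) = X i + if i = l then C t * X j else 0 := by
        rw [linearChange_X, hbm]
        simp only [Matrix.transvection, Matrix.add_apply, map_add, add_mul,
          Finset.sum_add_distrib]
        congr 1
        · rw [Finset.sum_eq_single i]
          · simp
          · intro k _ hk; simp [Matrix.one_apply_ne hk]
          · simp
        · rw [Finset.sum_eq_single j]
          · by_cases hil : i = l
            · subst hil; simp
            · simp [Matrix.single_apply_of_col_ne _ _ (Ne.symm hil), hil]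
          · intro k _ hk
            simp [Matrix.single_apply_of_row_ne (Ne.symm hk)]
          · simp
      rw [RingHom.comp_apply, RingHom.coe_coe, h1]
      by_cases hil : i = l
      · simp [elemChange, hil]
      · simp [elemChange, hil]
  exact RingHom.congr_fun h p

theorem elemChange_coeff_zero (j l : Fin n) (p : MvPolynomial (Fin n) K) (u : Fin n →₀ ℕ) :
    (coeff u (elemChange K j l p)).coeff 0 = coeff u p := by
  have h : (map (Polynomial.evalRingHom (0 : K))).comp (elemChange K j l) =
      RingHom.id (MvPolynomial (Fin n) K) := by
    apply MvPolynomial.ringHom_ext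
    · intro r; simp [elemChange]
    · intro i
      by_cases hil : i = l
      · simp [elemChange, hil]
      · simp [elemChange, hil]
  have h1 := RingHom.congr_fun h p
  rw [RingHom.comp_apply, RingHom.id_apply] at h1
  conv_rhs => rw [← h1]
  rw [coeff_map, Polynomial.coe_evalRingHom, Polynomial.coeff_zero_eq_eval_zero]

/-- To first order in `t`, the coordinate change `X_l ↦ X_l + t X_j` acts by `X_j ∂/∂X_l`. -/
theorem elemChange_coeff_one (j l : Fin n) (p : MvPolynomial (Fin n) K) (u : Fin n →₀ ℕ) :
    (coeff u (elemChange K j l p)).coeff 1 = coeff u (X j * pderiv l p) := by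
  classical
  induction p using MvPolynomial.induction_on generalizing u with
  | C a =>
    have h1 : elemChange K j l (C a) = C (Polynomial.C a) := by simp [elemChange]
    rw [h1, pderiv_C, mul_zero, coeff_zero, coeff_C]
    split_ifs <;> simp
  | add p q hp hq =>
    rw [map_add, coeff_add, Polynomial.coeff_add, hp, hq, map_add, mul_add, coeff_add]
  | mul_X p i hp =>
    have h1 : elemChange K j l (X i) = X i + if i = l then C Polynomial.X * X j else 0 := by
      simp [elemChange]
    have h2 : ∀ q : MvPolynomial (Fin n) (Polynomial K), ∀ k : Fin n,
        (coeff u (q * (C Polynomial.X * X k))).coeff 1 = (coeff u (q * X k)).coeff 0 := by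
      intro q k
      rw [show q * (C Polynomial.X * X k) = C Polynomial.X * (q * X k) by ring, coeff_C_mul,
        Polynomial.coeff_X_mul]
    rw [map_mul, h1, mul_add, coeff_add, Polynomial.coeff_add, Derivation.leibniz, pderiv_X,
      smul_eq_mul, smul_eq_mul, mul_add, coeff_add, add_comm]
    congr 1
    · by_cases hil : i = l
      · subst hil
        rw [if_pos rfl, h2, Pi.single_eq_same, mul_one, mul_comm (X j), coeff_mul_X', coeff_mul_X']
        split_ifs
        · exact elemChange_coeff_zero _ _ _ _
        · simp
      · rw [if_neg hil, Pi.single_eq_of_ne hil]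
        simp
    · rw [show X j * (X i * pderiv l p) = (X j * pderiv l p) * X i by ring, coeff_mul_X',
        coeff_mul_X']
      split_ifs
      · exact hp _
      · simp

end Borel

end GradedPoly

/-! ### Strong stability of generic leading exponents -/

namespace GradedPoly

open MvPolynomial Koszul
open scoped MonomialOrder

section Stability

variable {K : Type*} [Field K] {n : ℕ}

theorem lt_exchange {j l : Fin n} (hjl : j < l) {u : Fin n →₀ ℕ} (hul : u l ≠ 0) :
    u ≺[degRevLex n] u - Finsupp.single l 1 + Finsupp.single j 1 := by
  rw [degRevLex_lt_iff]
  right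
  have h1 : u = u - Finsupp.single l 1 + Finsupp.single l 1 :=
    (tsub_add_cancel_of_le (Finsupp.single_le_iff.2 (Nat.one_le_iff_ne_zero.2 hul))).symm
  refine ⟨?_, l, fun k hk => ?_, ?_⟩
  · conv_lhs => rw [h1]
    simp
  · simp [Finsupp.single_eq_of_ne hk.ne', Finsupp.single_eq_of_ne (hjl.trans hk).ne']
  · simp [Finsupp.single_eq_of_ne hjl.ne']
    omega

theorem degree_exchange {j l : Fin n} {u : Fin n →₀ ℕ} (hul : u l ≠ 0) :
    (u - Finsupp.single l 1 + Finsupp.single j 1).degree = u.degree := by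
  conv_rhs => rw [← tsub_add_cancel_of_le
    (Finsupp.single_le_iff.2 (Nat.one_le_iff_ne_zero.2 hul) : Finsupp.single l 1 ≤ u)]
  simp

/-- Replacing one `X_l` by `X_j` in the leading monomial gives the leading monomial of
`X_j ∂f/∂X_l`. -/
theorem degree_X_mul_pderiv [CharZero K] {j l : Fin n} {f : MvPolynomial (Fin n) K} {u : Fin n →₀ ℕ}
    (h0 : f ≠ 0) (hu : (degRevLex n).degree f = u) (hul : u l ≠ 0) :
    X j * pderiv l f ≠ 0 ∧ (degRevLex n).degree (X j * pderiv l f) =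
      u - Finsupp.single l 1 + Finsupp.single j 1 := by
  have h1 : u - Finsupp.single l 1 + Finsupp.single l 1 = u :=
    tsub_add_cancel_of_le (Finsupp.single_le_iff.2 (Nat.one_le_iff_ne_zero.2 hul))
  have hc : coeff (u - Finsupp.single l 1) (pderiv l f) ≠ 0 := by
    rw [coeff_pderiv, h1]
    refine mul_ne_zero ?_ (Nat.cast_add_one_ne_zero _)
    rw [← hu]
    exact (degRevLex n).coeff_degree_ne_zero_iff.2 h0
  have hp0 : pderiv l f ≠ 0 := fun h => hc (by rw [h, coeff_zero])
  have hX : (X j : MvPolynomial (Fin n) K) ≠ 0 := X_ne_zero j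
  refine ⟨mul_ne_zero hX hp0, ?_⟩
  rw [(degRevLex n).degree_mul hX hp0, MonomialOrder.degree_X, add_comm]
  congr 1
  refine (degRevLex n).degree_eq_of_forall_le hc fun w hw => ?_
  rw [mem_support_iff, coeff_pderiv] at hw
  have h2 := (degRevLex n).le_degree (mem_support_iff.2 (left_ne_zero_of_mul hw))
  rw [hu, ← h1, map_add, map_add] at h2
  exact le_of_add_le_add_right h2

/-- The leading exponents of `g I` in degree `e` are closed under replacing a variable by an
earlier one if `g` maximises the counts of leading exponents: otherwise, composing `g` with a
generic elementary change of coordinates would increase one of them. -/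
theorem IsMaximalAt.exchange_mem [CharZero K] {I : Ideal (MvPolynomial (Fin n) K)}
    {g : Matrix.GeneralLinearGroup (Fin n) K} {j l : Fin n} (hjl : j < l) {u : Fin n →₀ ℕ}
    (hg : IsMaximalAt I u.degree g) (hu : u ∈ leadingSet (I.map (linearChange g)))
    (hul : u l ≠ 0) :
    u - Finsupp.single l 1 + Finsupp.single j 1 ∈ leadingSet (I.map (linearChange g)) := by
  classical
  by_contra hnot
  set u' := u - Finsupp.single l 1 + Finsupp.single j 1 with hu'
  have huu' : u ≺[degRevLex n] u' := lt_exchange hjl hul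
  have hdeg' : u'.degree = u.degree := degree_exchange hul
  set A := hpart (I.map (linearChange g)) u.degree with hA
  obtain ⟨f₀, hf₀, hf₀0, hf₀d⟩ := (mem_leadingExps_hpart (e := u.degree)).2 ⟨rfl, hu⟩
  have hfin : ((degRevLex n).leadingExps A ∩ {x | u' ≼[degRevLex n] x}).Finite :=
    ((degRevLex n).finite_leadingExps _).inter_of_left _
  set s := hfin.toFinset with hs
  have hmem : ∀ w : s, w.1 ∈ (degRevLex n).leadingExps A ∧ u' ≼[degRevLex n] w.1 :=
    fun w => hfin.mem_toFinset.1 w.2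
  choose f hf hf0 hfd using fun w : s => (hmem w).1
  let col : Option s → Fin n →₀ ℕ := fun c => c.elim u' fun w => w.1
  have hcol : ∀ c, u' ≼[degRevLex n] col c := by
    rintro (_ | w)
    · exact le_refl _
    · exact (hmem w).2
  -- The matrix of the elements above under an elementary change of coordinates with parameter `t`;
  -- the row of `f₀`, which vanishes for `t = 0`, is divided by `t`.
  let M : Matrix (Option s) (Option s) (Polynomial K) := Matrix.of fun a c =>
    a.elim (coeff (col c) (elemChange K j l f₀)).divX fun w =>
      coeff (col c) (elemChange K j l (f w))
  let B : Option s → MvPolynomial (Fin n) K := fun a => a.elim (X j * pderiv l f₀) f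
  have hB0 : ∀ a, B a ≠ 0 := by
    rintro (_ | w)
    · exact (degree_X_mul_pderiv hf₀0 hf₀d hul).1
    · exact hf0 w
  have hBd : ∀ a, (degRevLex n).degree (B a) = col a := by
    rintro (_ | w)
    · exact (degree_X_mul_pderiv hf₀0 hf₀d hul).2
    · exact hfd w
  have hcolinj : Function.Injective col := by
    have hne : ∀ w : s, w.1 ≠ u' := fun w h => by
      have h1 := (hmem w).1
      rw [h] at h1
      exact hnot (mem_leadingExps_hpart.1 h1).2
    rintro (_ | w) (_ | w') h
    · rfl
    · exact absurd h.symm (hne w')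
    · exact absurd h (hne w)
    · exact congrArg some (Subtype.ext h)
  have hM0 : M.det ≠ 0 := by
    intro h
    have h1 := (degRevLex n).det_coeff_ne_zero hB0 (by simpa only [hBd] using hcolinj)
    simp only [hBd] at h1
    apply h1
    have h2 := congrArg (Polynomial.evalRingHom (0 : K)) h
    rw [RingHom.map_det, map_zero] at h2
    rw [← h2]
    congr 1
    ext a c
    rw [RingHom.mapMatrix_apply, Matrix.map_apply, Polynomial.coe_evalRingHom,
      ← Polynomial.coeff_zero_eq_eval_zero]
    cases a with
    | none => exact (elemChange_coeff_one j l f₀ (col c)).symm.trans (Polynomial.coeff_divX).symm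
    | some w => exact (elemChange_coeff_zero j l (f w) (col c)).symm
  obtain ⟨t, ht⟩ : ∃ t : K, (Polynomial.X * M.det).eval t ≠ 0 := by
    by_contra! h
    exact mul_ne_zero Polynomial.X_ne_zero hM0
      (Polynomial.funext fun r => by rw [h r, Polynomial.eval_zero])
  rw [Polynomial.eval_mul, Polynomial.eval_X, mul_ne_zero_iff] at ht
  obtain ⟨ht0, ht⟩ := ht
  obtain ⟨b, hb⟩ := map_elemChange (K := K) hjl.ne t
  let R : Option s → MvPolynomial (Fin n) K := fun a =>
    a.elim (t⁻¹ • linearChange b f₀) fun w => linearChange b (f w)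
  have hbc : ∀ p c, (coeff c (elemChange K j l p)).eval t = coeff c (linearChange b p) := by
    intro p c
    rw [← hb, coeff_map, Polynomial.coe_evalRingHom]
  have hdet : (Matrix.of fun a c => coeff (col c) (R a)).det ≠ 0 := by
    rw [← Polynomial.coe_evalRingHom, RingHom.map_det] at ht
    convert ht using 2
    ext a c
    rw [RingHom.mapMatrix_apply, Matrix.map_apply, Polynomial.coe_evalRingHom]
    cases a with
    | none =>
      change coeff (col c) (t⁻¹ • linearChange b f₀) =
        (coeff (col c) (elemChange K j l f₀)).divX.eval t
      have h1 : (coeff (col c) (elemChange K j l f₀)).coeff 0 = 0 := by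
        rw [elemChange_coeff_zero]
        refine (degRevLex n).coeff_eq_zero_of_lt ?_
        rw [hf₀d]
        exact huu'.trans_le (hcol c)
      have h2 := congrArg (Polynomial.eval t)
        (Polynomial.divX_mul_X_add (coeff (col c) (elemChange K j l f₀)))
      rw [h1, map_zero, add_zero, Polynomial.eval_mul, Polynomial.eval_X, hbc] at h2
      rw [coeff_smul, ← h2, smul_eq_mul]
      field_simp
    | some w => exact (hbc (f w) (col c)).symm
  have hRmem : ∀ a, R a ∈ hpart (I.map (linearChange (b * g))) u.degree := by
    have h1 : ∀ p ∈ A, linearChange b p ∈ hpart (I.map (linearChange (b * g))) u.degree := by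
      intro p hp
      rw [map_linearChange_mul, hpart_map_linearChange]
      exact ⟨p, hp, rfl⟩
    rintro (_ | w)
    · exact Submodule.smul_mem _ _ (h1 f₀ hf₀)
    · exact h1 _ (hf w)
  have h1 := (degRevLex n).card_le_ncard_leadingExps hRmem hcol hdet
  have h2 := hg u' hdeg' (b * g)
  have h3 : leadingCount I u.degree u' g = s.card := by
    rw [hs, ← Set.ncard_eq_toFinset_card _ hfin]
    rfl
  rw [h3] at h2
  rw [Fintype.card_option, Fintype.card_coe] at h1
  exact absurd (h1.trans h2) (by omega)

end Stability

end GradedPoly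

/-! ### The generic initial ideal is strongly stable -/

namespace GradedPoly

open MvPolynomial Koszul
open scoped MonomialOrder

section Gin

variable {K : Type*} [Field K] {n : ℕ}

theorem exists_gin_eq [CharZero K] {I : Ideal (MvPolynomial (Fin n) K)}
    (hI : I.IsHomogeneous (homogeneousSubmodule (Fin n) K)) :
    ∃ p : MvPolynomial (Fin n × Fin n) K, p ≠ 0 ∧
      ∀ g : Matrix.GeneralLinearGroup (Fin n) K,
        eval (fun ij : Fin n × Fin n => (g : Matrix (Fin n) (Fin n) K) ij.1 ij.2) p ≠ 0 →
          gin I = Ideal.span ((fun u => monomial u (1 : K)) ''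
            leadingSet (I.map (linearChange g))) ∧
          leadingSet (gin I) = leadingSet (I.map (linearChange g)) := by
  obtain ⟨p, hp, hpg⟩ := isGenericInitialIdeal_gin hI
  refine ⟨p, hp, fun g hg => ?_⟩
  have h1 : gin I = Ideal.span ((fun u => monomial u (1 : K)) ''
      leadingSet (I.map (linearChange g))) := by
    rw [← hpg g hg, initialIdeal_eq (isHomogeneous_map_linearChange hI g)]
  refine ⟨h1, ?_⟩
  rw [h1, leadingSet_span_monomial fun u hu w huw => leadingSet_upward hu huw]

theorem gin_eq_span [CharZero K] {I : Ideal (MvPolynomial (Fin n) K)}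
    (hI : I.IsHomogeneous (homogeneousSubmodule (Fin n) K)) :
    gin I = Ideal.span ((fun u => monomial u (1 : K)) '' leadingSet (gin I)) := by
  obtain ⟨p, hp, hpg⟩ := exists_gin_eq hI
  obtain ⟨g, hg⟩ := exists_eval_ne_zero hp
  obtain ⟨h1, h2⟩ := hpg g hg
  rw [h2]
  exact h1

theorem isHomogeneous_gin [CharZero K] {I : Ideal (MvPolynomial (Fin n) K)}
    (hI : I.IsHomogeneous (homogeneousSubmodule (Fin n) K)) :
    (gin I).IsHomogeneous (homogeneousSubmodule (Fin n) K) := by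
  rw [gin_eq_span hI]
  exact isHomogeneous_span_monomial _

/-- A monomial ideal is strongly stable if it is closed under replacing a variable of a monomial by
an earlier one. -/
structure IsStronglyStable (J : Ideal (MvPolynomial (Fin n) K)) : Prop where
  eq_span : J = Ideal.span ((fun u => monomial u (1 : K)) '' leadingSet J)
  exchange_mem : ∀ u ∈ leadingSet J, ∀ j l, j < l → u l ≠ 0 →
    u - Finsupp.single l 1 + Finsupp.single j 1 ∈ leadingSet J

theorem isStronglyStable_gin [CharZero K] {I : Ideal (MvPolynomial (Fin n) K)}
    (hI : I.IsHomogeneous (homogeneousSubmodule (Fin n) K)) : IsStronglyStable (gin I) where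
  eq_span := gin_eq_span hI
  exchange_mem u hu j l hjl hul := by
    obtain ⟨p, hp, hpg⟩ := exists_gin_eq hI
    obtain ⟨q, hq, hqg⟩ := exists_isMaximalAt I u.degree
    obtain ⟨g, hg⟩ := exists_eval_ne_zero (mul_ne_zero hp hq)
    rw [map_mul, mul_ne_zero_iff] at hg
    rw [(hpg g hg.1).2] at hu ⊢
    exact (hqg g hg.2).exchange_mem hjl hu hul

theorem IsStronglyStable.mem_iff {J : Ideal (MvPolynomial (Fin n) K)} (hJ : IsStronglyStable J)
    {p : MvPolynomial (Fin n) K} : p ∈ J ↔ ∀ u ∈ p.support, u ∈ leadingSet J := by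
  rw [← mem_span_monomial_iff fun u hu w huw => leadingSet_upward hu huw, ← hJ.eq_span]

/-- The quotient by a strongly stable ideal is a stable family: modulo the variables after `X_a`,
the annihilator of `X_a` is spanned by monomials in `X_0, …, X_a`, and these are killed by all
`X_j` with `j ≤ a`. -/
theorem IsStronglyStable.isStable {J : Ideal (MvPolynomial (Fin n) K)}
    (hJ : IsStronglyStable J) :
    IsStable (varOp (AlgEquiv.refl : MvPolynomial (Fin n) K ≃ₐ[K] _)
      (MvPolynomial (Fin n) K ⧸ J)) (quotGr J) := by
  classical
  intro a e m hm ham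
  obtain ⟨f, hf, rfl⟩ := hm
  have hf' := mem_polyGr_iff.1 hf
  rw [← map_mkQ_opSpan] at ham
  obtain ⟨b, hb, hbm⟩ := ham
  rw [SetLike.mem_coe, mem_opSpan_polyGr] at hb
  rw [← map_varOp] at hbm
  have hbJ : X a * f - b ∈ J := by
    have := (Submodule.Quotient.eq J).1 hbm.symm
    exact this
  -- The terms of `f` that involve only the variables up to `X_a`.
  set f' : MvPolynomial (Fin n) K :=
    ∑ v ∈ f.support with ∀ l, a < l → v l = 0, monomial v (coeff v f) with hf'def
  have hcoeff : ∀ v, coeff v f' = if ∀ l, a < l → v l = 0 then coeff v f else 0 := by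
    intro v
    rw [hf'def, coeff_sum]
    simp only [coeff_monomial]
    rw [Finset.sum_ite_eq']
    simp only [Finset.mem_filter, mem_support_iff]
    by_cases h1 : coeff v f = 0
    · simp [h1]
    · simp [h1]
  have hmem' : f' ∈ polyGr K n (e + 1) := mem_polyGr_iff.2 fun v hv => by
    rw [mem_support_iff, hcoeff] at hv
    split_ifs at hv with h
    · exact hf' v (mem_support_iff.2 hv)
    · exact absurd rfl hv
  refine ⟨J.mkQ.restrictScalars K f', ⟨f', hmem', rfl⟩, ?_, fun j hj => ?_⟩
  · rw [← map_sub, ← map_mkQ_opSpan]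
    refine ⟨f - f', mem_opSpan_polyGr.2 ⟨sub_mem hf hmem', fun v hv => ?_⟩, rfl⟩
    rw [mem_support_iff, coeff_sub, hcoeff] at hv
    split_ifs at hv with h
    · exact absurd (sub_self _) hv
    · push Not at h
      obtain ⟨l, hl, hl'⟩ := h
      exact ⟨l, by simpa using hl, hl'⟩
  · rw [← map_varOp]
    refine (Submodule.Quotient.mk_eq_zero J).2 (hJ.mem_iff.2 fun w hw => ?_)
    rw [varOp_apply, AlgEquiv.coe_refl, id, smul_eq_mul, support_X_mul, Finset.mem_map] at hw
    obtain ⟨v, hv, rfl⟩ := hw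
    rw [mem_support_iff, hcoeff] at hv
    split_ifs at hv with hva
    swap
    · exact absurd rfl hv
    have h1 : Finsupp.single a 1 + v ∈ leadingSet J := by
      refine hJ.mem_iff.1 hbJ _ (mem_support_iff.2 ?_)
      have hb0 : coeff (Finsupp.single a 1 + v) b = 0 := by
        by_contra h
        obtain ⟨l, hl, hl'⟩ := hb.2 _ (mem_support_iff.2 h)
        have hal : a < l := by simpa using hl
        apply hl'
        rw [Finsupp.add_apply, hva l hal, Finsupp.single_eq_of_ne hal.ne']
      rw [coeff_sub, hb0, sub_zero, coeff_X_mul]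
      exact hv
    rcases hj.eq_or_lt with rfl | hj
    · exact h1
    · have h2 := hJ.exchange_mem _ h1 j a hj (by simp)
      rw [add_tsub_cancel_left, add_comm] at h2
      exact h2

end Gin

/-! ### Generic linear forms -/

section GenericForms

variable {K : Type*} [Field K] {n : ℕ}

theorem exists_linearChange_eq_rename (g : Matrix.GeneralLinearGroup (Fin n) K)
    (σ : Equiv.Perm (Fin n)) : ∃ h : Matrix.GeneralLinearGroup (Fin n) K,
      (∀ i j, (h : Matrix (Fin n) (Fin n) K) i j =
        (g : Matrix (Fin n) (Fin n) K) (σ.symm i) j) ∧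
      ∀ p, linearChange h p = rename σ (linearChange g p) := by
  have hdet : ((g : Matrix (Fin n) (Fin n) K).submatrix σ.symm id).det ≠ 0 := by
    rw [Matrix.det_permute]
    refine mul_ne_zero ?_ (Matrix.GeneralLinearGroup.det_ne_zero g)
    rcases Int.units_eq_one_or (Equiv.Perm.sign σ.symm) with h | h <;> rw [h] <;> simp
  refine ⟨Matrix.GeneralLinearGroup.mkOfDetNeZero _ hdet, fun i j => rfl, fun p => ?_⟩
  have h : linearChange (Matrix.GeneralLinearGroup.mkOfDetNeZero _ hdet) =
      (rename σ).comp (linearChange g) := by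
    ext1 j
    rw [AlgHom.comp_apply, linearChange_X, linearChange_X, map_sum]
    refine Fintype.sum_equiv σ.symm _ _ fun i => ?_
    rw [map_mul, rename_C, rename_X, Equiv.apply_symm_apply]
    rfl
  rw [h, AlgHom.comp_apply]

/-- There are coordinates such that the initial ideal of `I` is generic for all orderings of the
variables. -/
theorem exists_forall_rename [CharZero K] {I : Ideal (MvPolynomial (Fin n) K)}
    (hI : I.IsHomogeneous (homogeneousSubmodule (Fin n) K)) :
    ∃ g : Matrix.GeneralLinearGroup (Fin n) K, ∀ σ : Equiv.Perm (Fin n),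
      ∃ h : Matrix.GeneralLinearGroup (Fin n) K,
        (∀ p, linearChange h p = rename σ (linearChange g p)) ∧
        leadingSet (I.map (linearChange h)) = leadingSet (gin I) := by
  classical
  obtain ⟨p, hp, hpg⟩ := exists_gin_eq hI
  have hinj : ∀ σ : Equiv.Perm (Fin n), Function.Injective
      (fun ij : Fin n × Fin n => (σ.symm ij.1, ij.2)) := by
    rintro σ ⟨i, j⟩ ⟨i', j'⟩ h
    simpa using h
  obtain ⟨g, hg⟩ := exists_eval_ne_zero (p := ∏ σ : Equiv.Perm (Fin n),
    rename (fun ij : Fin n × Fin n => (σ.symm ij.1, ij.2)) p)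
    (Finset.prod_ne_zero_iff.2 fun σ _ h => hp (rename_injective _ (hinj σ)
      (h.trans (map_zero _).symm)))
  rw [map_prod, Finset.prod_ne_zero_iff] at hg
  refine ⟨g, fun σ => ?_⟩
  obtain ⟨h, hh, hr⟩ := exists_linearChange_eq_rename g σ
  refine ⟨h, hr, ((hpg h ?_).2).symm⟩
  have h1 := hg σ (Finset.mem_univ _)
  rw [eval_rename] at h1
  simpa only [hh, Function.comp_def] using h1

theorem exists_perm_mem_lastVars (Z : Finset (Fin n)) :
    ∃ σ : Equiv.Perm (Fin n), ∀ l, σ l ∈ lastVars n Z.card ↔ l ∈ Z := by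
  have hcard := card_lastVars (Z.card_le_univ.trans (Fintype.card_fin n).le)
  let e : {x // x ∈ Z} ≃ {x // x ∈ lastVars n Z.card} := Finset.equivOfCardEq hcard.symm
  refine ⟨e.extendSubtype, fun l => ⟨fun h => ?_, fun h => e.extendSubtype_mem l h⟩⟩
  by_contra hl
  exact e.extendSubtype_not_mem l hl h

theorem map_linearAut_sup {I : Ideal (MvPolynomial (Fin n) K)}
    {g h : Matrix.GeneralLinearGroup (Fin n) K} {σ : Equiv.Perm (Fin n)}
    (hr : ∀ p, linearChange h p = rename σ (linearChange g p)) {Z Z' : Finset (Fin n)}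
    (hσ : ∀ l, σ l ∈ Z' ↔ l ∈ Z) (e : ℕ) :
    (hpart I e ⊔ opSpan (varOp (linearAut g).symm (MvPolynomial (Fin n) K)) Z
      (polyGr K n e)).map (linearAut h).toLinearMap =
    hpart (I.map (linearChange h)) e ⊔
      opSpan (varOp (AlgEquiv.refl : MvPolynomial (Fin n) K ≃ₐ[K] _) (MvPolynomial (Fin n) K))
        Z' (polyGr K n e) := by
  rw [Submodule.map_sup, ← hpart_map_linearChange]
  congr 1
  have hX : ∀ l m, (linearAut h) (varOp (linearAut g).symm (MvPolynomial (Fin n) K) l m) =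
      varOp (AlgEquiv.refl : MvPolynomial (Fin n) K ≃ₐ[K] _) (MvPolynomial (Fin n) K) (σ l)
        (linearAut h m) := by
    intro l m
    rw [varOp_apply, varOp_apply, smul_eq_mul, smul_eq_mul, map_mul, linearAut_apply, hr,
      ← linearAut_apply g, AlgEquiv.apply_symm_apply, rename_X]
    rfl
  apply le_antisymm
  · rw [Submodule.map_le_iff_le_comap, opSpan_le]
    intro l hl m hm
    rw [Submodule.mem_comap, AlgEquiv.toLinearMap_apply, hX]
    exact map_mem_opSpan ((hσ l).2 hl) ((isGradedAut_linearAut h).map_mem_polyGr hm)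
  · rw [opSpan_le]
    intro l hl m hm
    refine ⟨varOp (linearAut g).symm (MvPolynomial (Fin n) K) (σ.symm l) ((linearAut h).symm m),
      map_mem_opSpan ((hσ _).1 (by simpa using hl))
        ((isGradedAut_linearAut h).symm.map_mem_polyGr hm), ?_⟩
    rw [AlgEquiv.toLinearMap_apply, hX, AlgEquiv.apply_symm_apply, Equiv.apply_symm_apply]

/-- For suitable linear forms, the quotients of `S / I` by any `p` of them have the same Hilbert
function as the quotient of `S / gin I` by the last `p` variables. -/
theorem exists_hdim_zero_eq [CharZero K] {I : Ideal (MvPolynomial (Fin n) K)}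
    (hI : I.IsHomogeneous (homogeneousSubmodule (Fin n) K)) :
    ∃ ψ : MvPolynomial (Fin n) K ≃ₐ[K] MvPolynomial (Fin n) K, IsGradedAut ψ ∧
      ∀ Z e, hdim (varOp ψ _) (quotGr I) Z 0 e =
        hdim (varOp (AlgEquiv.refl : MvPolynomial (Fin n) K ≃ₐ[K] _) _) (quotGr (gin I))
          (lastVars n Z.card) 0 e := by
  obtain ⟨g, hg⟩ := exists_forall_rename hI
  refine ⟨(linearAut g).symm, (isGradedAut_linearAut g).symm, fun Z e => ?_⟩
  obtain ⟨σ, hσ⟩ := exists_perm_mem_lastVars Z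
  obtain ⟨h, hr, hL⟩ := hg σ
  rw [hdim_quotGr_zero (isGradedAut_linearAut g).symm, hdim_quotGr_zero isGradedAut_refl,
    ← finrank_hpart_sup_eq hL, ← map_linearAut_sup hr hσ, finrank_map_linearAut]

end GenericForms

end GradedPoly

theorem corollary2p3 {K : Type*} [Field K] [CharZero K] {n : ℕ}
    (I : Ideal (MvPolynomial (Fin n) K))
    (hI : I.IsHomogeneous (MvPolynomial.homogeneousSubmodule (Fin n) K))
    (i k : ℕ) (hi : 1 < i)
    (h : GradedPoly.bettiNumber I i (i + k) =
      GradedPoly.bettiNumber (GradedPoly.gin I) i (i + k)) :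
    ∀ q : ℕ, i ≤ q → GradedPoly.bettiNumber I q (q + k) =
      GradedPoly.bettiNumber (GradedPoly.gin I) q (q + k) := by
  intro q hq
  obtain ⟨ψ, hψ, hzero⟩ := GradedPoly.exists_hdim_zero_eq hI
  have hJ := GradedPoly.isHomogeneous_gin hI
  have h1 := GradedPoly.bettiNumber_eq_hdim hψ hI hi k
  have h2 := GradedPoly.bettiNumber_eq_hdim GradedPoly.isGradedAut_refl hJ hi k
  have h3 := GradedPoly.bettiNumber_eq_hdim hψ hI (hi.trans_le hq) k
  have h4 := GradedPoly.bettiNumber_eq_hdim GradedPoly.isGradedAut_refl hJ (hi.trans_le hq) k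
  have h5 := Koszul.hdim_eq_of_hdim_eq GradedPoly.varOp_comm hψ.varOp_mem_quotGr
    GradedPoly.varOp_comm GradedPoly.isGradedAut_refl.varOp_mem_quotGr (Submodule.map_bot _)
    (GradedPoly.isStronglyStable_gin hI).isStable hzero hi
    (by rw [← h1, ← h2, h]) hq
  rw [← h3, ← h4] at h5
  exact_mod_cast h5
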